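/- **Conventions.** Let $k$ be a commutative ring and $A$, $U$ be $k$-algebras, and let $(U,A)$ be a left bialgebroid with source $s:A\to U$, target $t:A^{op}\to U$, coproduct $\Delta(u)=u_{(1)}\otimes_A u_{(2)}$ and counit $\varepsilon$. For $u\in U$, $a\in A$ write $a\triangleright u=s(a)u$, $u\triangleleft a=t(a)u$, $a\blacktriangleright u=ut(a)$, $u\blacktriangleleft a=us(a)$, and use the same notation for right bialgebroids. A left $U$-module $M$ has the right $A$-action $ma=t(a)m$ and the left $A$-action $am=s(a)m$. $(U,A)$ is a *left Hopf algebroid* if $${}_\blacktriangleright U\otimes_{A^{op}}U_\triangleleft\to U_\triangleleft\otimes_A{}_\triangleright U,\qquad u\otimes u'\mapsto u_{(1)}\otimes u_{(2)}u'$$ is bijective; $u_+\otimes u_-$ denotes the preimage of $u\otimes 1$. A right bialgebroid $(V,B)$ with coproduct $\Delta_r(v)=v^{(1)}\otimes_Bv^{(2)}$ and counit $\partial$ is a *right Hopf algebroid* if $${}_\blacktriangleright V\otimes_{B^{op}}V_\triangleleft\to V_\blacktriangleleft\otimes_B{}_\blacktriangleright V,\qquad v'\otimes v\mapsto v'v^{(1)}\otimes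 v^{(2)}$$ is bijective; $v^-\otimes v^+$ denotes the preimage of $1\otimes v$. Let $U^*=\mathrm{Hom}_{A^{op}}(U_\triangleleft,A)$, with pairing $\langle\phi,u\rangle=\phi(u)$. If $U_\triangleleft$ is finitely generated projective over $A$, then $U^*$ is a right bialgebroid over $A$ with product $\langle\phi\psi,u\rangle=\langle\psi,\langle\phi,u_{(1)}\rangle\triangleright u_{(2)}\rangle$, unit $\varepsilon$, source $s^r(a)=\varepsilon(-\blacktriangleleft a)$, target $t^r(a)=a\,\varepsilon(-)$, counit $\partial\phi=\langle\phi,1\rangle$, and coproduct $\Delta_r$ determined by $\langle\phi^{(1)},\langle\phi^{(2)},v\rangle\blacktriangleright u\rangle=\langle\phi,uv\rangle$. A *right $U$-contramodule* is a right $A$-module $M$ with a $k$-linear map $\gamma:\mathrm{Hom}_{A^{op}}(U_\triangleleft,M)\to M$ such that $\gamma(f(a\triangleright-))=\gamma(f)a$, $\gamma(u\mapsto\gamma(v\mapsto g(u\otimes v)))=\gamma(u\mapsto g(u_{(1)}\otimes u_{(2)}))$ for $g\in\mathrm{Hom}_{A^{op}}(U_\triangleleft\otimes_A{}_\triangleright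 U_\triangleleft,M)$, and $\gamma(m\,\varepsilon(-))=m$. Its left $A$-action is $am=\gamma(m\,\varepsilon(-\blacktriangleleft a))$. **Proposition.** Let $(U,A)$ be a left Hopf algebroid with $U_\triangleleft$ finitely generated projective over $A$. Let $M$ be a left $U^*$-module and a right $U^*$-comodule, with coaction $m\mapsto m^{(0)}\otimes_Am^{(1)}\in M\otimes_A{}_\blacktriangleright U^*$, whose two right $A$-actions agree, i.e. $t^r(a)m=ma$ (and whose $k$-actions agree). Then $(U^*,A)$ is a right Hopf algebroid, and the following hold. 1. $um=m^{(0)}\langle m^{(1)},u\rangle$ makes $M$ a left $U$-module, and there is a right $U$-contraaction $\gamma$ on the right $A$-module $M$ with $\gamma(m\langle\phi,-\rangle)=\phi m$ for all $m\in M$, $\phi\in U^*$. The right $A$-actions agree: $t(a)m=ma$. The left $A$-actions of this $U$-module and $U$-contramodule agree, $s(a)m=\gamma(m\,\varepsilon(-\blacktriangleleft a))$ for all $a,m$, if and only if those of the given $U^*$-module and $U^*$-comodule do, $s^r(a)m=m^{(0)}\partial(a\triangleright m^{(1)})$ for all $a,m$. 2. Let $C^n_{co}(U^*,M)=M\otimes_AU^*\otimes_A\cdots\otimes_AU^*$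 ($n$ factors ${}_\blacktriangleright U^*_\blacktriangleleft$) and $C^n(U,M)=\mathrm{Hom}_{A^{op}}(U^{\otimes_{A^{op}}n},M)$ with the tensor powers of ${}_\blacktriangleright U_\triangleleft$ and their right $A$-action $\triangleleft$ on the first factor, so that $C^0_{co}(U^*,M)=M=C^0(U,M)$. For every $n\ge0$ there is a $k$-linear isomorphism $\xi:C^n_{co}(U^*,M)\to C^n(U,M)$ with $$\xi(m\otimes\phi_1\otimes\cdots\otimes\phi_n)(u^1,\dots,u^n)=m\langle\phi_1,\langle\phi_2,\langle\dots\langle\phi_n,u^n\rangle\blacktriangleright\dots\rangle\blacktriangleright u^2\rangle\blacktriangleright u^1\rangle .$$ 3. The following formulas give well-defined $k$-linear maps. On $C^n_{co}(U^*,M)$, with $w=\phi_1\otimes\cdots\otimes\phi_n$, $$\delta'_i(m\otimes w)=\begin{cases}m\otimes\phi_1\otimes\cdots\otimes\phi_n\otimes1&i=0,\\ m\otimes\phi_1\otimes\cdots\otimes\Delta_r(\phi_{n-i+1})\otimes\cdots\otimes\phi_n&1\le i\le n,\\ m^{(0)}\otimes m^{(1)}\otimes\phi_1\otimes\cdots\otimes\phi_n&i=n+1;\end{cases}$$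 on $C^{n+1}_{co}(U^*,M)$, for $0\le j\le n$, $$\sigma'_j(m\otimes\phi_1\otimes\cdots\otimes\phi_{n+1})=m\otimes\phi_1\otimes\cdots\otimes\partial(\phi_{n-j+1})\otimes\cdots\otimes\phi_{n+1},$$ where the element $\partial(\phi_{n-j+1})$ of $A$ is absorbed into the left neighbour, as $\phi_{n-j}\blacktriangleleft\partial(\phi_{n-j+1})$ if $j<n$ and as $m\,\partial(\phi_1)$ if $j=n$; and, for $n\ge1$, $$\tau'(m\otimes\phi_1\otimes\cdots\otimes\phi_n)=\phi_n^+m^{(0)}\otimes m^{(1)}\phi_n^{-(1)}\otimes\phi_1\phi_n^{-(2)}\otimes\cdots\otimes\phi_{n-1}\phi_n^{-(n)},$$ while $\tau'(m)=m^{(1)}m^{(0)}$ for $n=0$. On $C^n(U,M)$, $$(\delta_if)(u^1,\dots,u^{n+1})=\begin{cases}f(u^1,\dots,\varepsilon(u^{n+1})\blacktriangleright u^n)&i=0,\ n\ge1,\\ f(u^1,\dots,u^{n-i+1}u^{n-i+2},\dots,u^{n+1})&1\le i\le n,\\ u^1f(u^2,\dots,u^{n+1})&i=n+1,\end{cases}$$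 and $(\delta_0m)(u)=m\,\varepsilon(u)$ for $n=0$; for $f\in C^{n+1}(U,M)$ and $0\le j\le n$, $$(\sigma_jf)(u^1,\dots,u^n)=f(u^1,\dots,u^{n-j},1,u^{n-j+1},\dots,u^n);$$ and, for $n\ge1$, $$(\tau f)(u^1,\dots,u^n)=\gamma\big(u^1_+f(u^2_+,\dots,u^n_+,u^n_-\cdots u^1_-(-))\big),$$ while $\tau(m)=\gamma(u\mapsto um)$ for $n=0$. 4. In all degrees and for all indices, $$\delta_i=\xi\circ\delta'_i\circ\xi^{-1},\qquad\sigma_j=\xi\circ\sigma'_j\circ\xi^{-1},\qquad\tau=\xi\circ\tau'\circ\xi^{-1}.$$ -/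

import Mathlib

open scoped TensorProduct
open MulOpposite

namespace HopfAlgd

section Tensor

variable {k B X Y Z : Type*} [CommRing k] [AddCommGroup X] [Module k X]
  [AddCommGroup Y] [Module k Y] [AddCommGroup Z] [Module k Z]

/-- The relations `x·b ⊗ y = x ⊗ b·y` that cut the tensor product over `B` out of the one
over `k`.  The two actions of `B` are given as families `r`, `l` of `k`-linear maps. -/
def balRel (r : B → X →ₗ[k] X) (l : B → Y →ₗ[k] Y) : Submodule k (X ⊗[k] Y) :=
  Submodule.span k {z | ∃ b x y, z = r b x ⊗ₜ[k] y - x ⊗ₜ[k] l b y}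

/-- The balanced tensor product `X ⊗_B Y` for the actions `r` on `X` and `l` on `Y`. -/
def Bal (r : B → X →ₗ[k] X) (l : B → Y →ₗ[k] Y) := (X ⊗[k] Y) ⧸ balRel r l

instance (r : B → X →ₗ[k] X) (l : B → Y →ₗ[k] Y) : AddCommGroup (Bal r l) :=
  inferInstanceAs (AddCommGroup ((X ⊗[k] Y) ⧸ balRel r l))

instance (r : B → X →ₗ[k] X) (l : B → Y →ₗ[k] Y) : Module k (Bal r l) :=
  inferInstanceAs (Module k ((X ⊗[k] Y) ⧸ balRel r l))

namespace Bal

variable (r : B → X →ₗ[k] X) (l : B → Y →ₗ[k] Y)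

/-- The quotient map `X ⊗_k Y → X ⊗_B Y`. -/
def proj : X ⊗[k] Y →ₗ[k] Bal r l := Submodule.mkQ (balRel r l)

/-- The class of the elementary tensor `x ⊗ y`. -/
def tmul : X →ₗ[k] Y →ₗ[k] Bal r l := (TensorProduct.mk k X Y).compr₂ (proj r l)

theorem tmul_bal (b : B) (x : X) (y : Y) : tmul r l (r b x) y = tmul r l x (l b y) := by
  refine (Submodule.Quotient.eq _).2 (Submodule.subset_span ⟨b, x, y, rfl⟩)

variable {r l}

/-- A `B`-balanced bilinear map induces a linear map on `X ⊗_B Y`. -/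
def lift (f : X →ₗ[k] Y →ₗ[k] Z) (h : ∀ b x y, f (r b x) y = f x (l b y)) :
    Bal r l →ₗ[k] Z :=
  (balRel r l).liftQ (TensorProduct.lift f) (by
    refine Submodule.span_le.2 ?_
    rintro _ ⟨b, x, y, rfl⟩
    simp [h])

@[simp] theorem lift_tmul (f : X →ₗ[k] Y →ₗ[k] Z) (h : ∀ b x y, f (r b x) y = f x (l b y))
    (x : X) (y : Y) : lift f h (tmul r l x y) = f x y := by
  refine ((balRel r l).liftQ_apply (TensorProduct.lift f) _).trans ?_
  simp

/-- Every element of `X ⊗_B Y` is a finite sum of elementary tensors. -/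
theorem exists_rep (z : Bal r l) :
    ∃ (n : ℕ) (x : Fin n → X) (y : Fin n → Y), z = ∑ i, tmul r l (x i) (y i) := by
  obtain ⟨w, rfl⟩ : ∃ w, proj r l w = z := Submodule.mkQ_surjective (balRel r l) z
  induction w using TensorProduct.induction_on with
  | zero => exact ⟨0, Fin.elim0, Fin.elim0, by rw [map_zero]; rfl⟩
  | tmul x y => exact ⟨1, fun _ => x, fun _ => y, by simp [tmul]⟩
  | add a b ha hb =>
    obtain ⟨n, x, y, h⟩ := ha
    obtain ⟨m, x', y', h'⟩ := hb
    refine ⟨n + m, Fin.append x x', Fin.append y y', ?_⟩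
    rw [map_add, h, h', Fin.sum_univ_add]
    simp

theorem hom_ext {f g : Bal r l →ₗ[k] Z} (h : ∀ x y, f (tmul r l x y) = g (tmul r l x y)) :
    f = g := by
  ext z
  obtain ⟨n, x, y, rfl⟩ := exists_rep z
  simp [h]

/-- The map `id ⊗ g` for a map `g` that commutes with the action on the right factor. -/
def mapRight (g : Y →ₗ[k] Y) (hg : ∀ b y, g (l b y) = l b (g y)) : Bal r l →ₗ[k] Bal r l :=
  lift ((tmul r l).compl₂ g) (fun b x y => by simp [hg, tmul_bal])

@[simp] theorem mapRight_tmul (g : Y →ₗ[k] Y) (hg : ∀ b y, g (l b y) = l b (g y)) (x : X)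
    (y : Y) : mapRight g hg (tmul r l x y) = tmul r l x (g y) := by
  simp [mapRight]

/-- The map `f ⊗ id` for a map `f` that commutes with the action on the left factor. -/
def mapLeft (f : X →ₗ[k] X) (hf : ∀ b x, f (r b x) = r b (f x)) : Bal r l →ₗ[k] Bal r l :=
  lift ((tmul r l).comp f) (fun b x y => by simp [hf, tmul_bal])

@[simp] theorem mapLeft_tmul (f : X →ₗ[k] X) (hf : ∀ b x, f (r b x) = r b (f x)) (x : X)
    (y : Y) : mapLeft f hf (tmul r l x y) = tmul r l (f x) y := by
  simp [mapLeft]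

end Bal

/-- The triple tensor product `X ⊗_B Y ⊗_B Y`, where `B` acts on `Y` by `l` from the left and by
`r'` from the right. -/
abbrev Bal3 (r : B → X →ₗ[k] X) (l r' : B → Y →ₗ[k] Y)
    (h : ∀ a b y, r' a (l b y) = l b (r' a y)) :=
  Bal (fun a => Bal.mapRight (r := r) (l := l) (r' a) (h a)) l

/-- The map `z ↦ z ⊗ y` from `X ⊗_B Y` to `X ⊗_B Y ⊗_B Y`. -/
def Bal3.snoc (r : B → X →ₗ[k] X) (l r' : B → Y →ₗ[k] Y)
    (h : ∀ a b y, r' a (l b y) = l b (r' a y)) (y : Y) : Bal r l →ₗ[k] Bal3 r l r' h :=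
  (Bal.tmul _ l).flip y

/-- The map `y ⊗ y' ↦ x ⊗ y ⊗ y'` from `Y ⊗_B Y` to `X ⊗_B Y ⊗_B Y`. -/
def Bal3.cons (r : B → X →ₗ[k] X) (l r' : B → Y →ₗ[k] Y)
    (h : ∀ a b y, r' a (l b y) = l b (r' a y)) (x : X) : Bal r' l →ₗ[k] Bal3 r l r' h :=
  Bal.lift ((Bal.tmul _ l).comp (Bal.tmul r l x)) (fun b y y' => by
    have := Bal.tmul_bal (fun a => Bal.mapRight (r := r) (l := l) (r' a) (h a)) l b
      (Bal.tmul r l x y) y'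
    simpa using this)

/-- The relations that define `X ⊗_B Y ⊗_B ⋯ ⊗_B Y` (with `n` factors `Y`): the action `ρ` on `X`
is balanced against the left action `l` on the first factor `Y`, and the right action `r` on each
factor `Y` against `l` on the next one. -/
def towerRel (ρ : B → X →ₗ[k] X) (l r : B → Y →ₗ[k] Y) (n : ℕ) :
    Submodule k (X ⊗[k] (⨂[k] _ : Fin n, Y)) :=
  Submodule.span k
    ({z | ∃ (h : 0 < n) (b : B) (x : X) (y : Fin n → Y),
        z = ρ b x ⊗ₜ[k] PiTensorProduct.tprod k y
          - x ⊗ₜ[k] PiTensorProduct.tprod k (Function.update y ⟨0, h⟩ (l b (y ⟨0, h⟩)))} ∪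
     {z | ∃ (i : ℕ) (h : i + 1 < n) (b : B) (x : X) (y : Fin n → Y),
        z = x ⊗ₜ[k] PiTensorProduct.tprod k
              (Function.update y ⟨i, by omega⟩ (r b (y ⟨i, by omega⟩)))
          - x ⊗ₜ[k] PiTensorProduct.tprod k
              (Function.update y ⟨i + 1, h⟩ (l b (y ⟨i + 1, h⟩)))})

/-- The tensor product `X ⊗_B Y ⊗_B ⋯ ⊗_B Y` with `n` factors `Y`. -/
def Tower (ρ : B → X →ₗ[k] X) (l r : B → Y →ₗ[k] Y) (n : ℕ) :=
  (X ⊗[k] (⨂[k] _ : Fin n, Y)) ⧸ towerRel ρ l r n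

instance (ρ : B → X →ₗ[k] X) (l r : B → Y →ₗ[k] Y) (n : ℕ) : AddCommGroup (Tower ρ l r n) :=
  inferInstanceAs (AddCommGroup ((X ⊗[k] (⨂[k] _ : Fin n, Y)) ⧸ towerRel ρ l r n))

instance (ρ : B → X →ₗ[k] X) (l r : B → Y →ₗ[k] Y) (n : ℕ) : Module k (Tower ρ l r n) :=
  inferInstanceAs (Module k ((X ⊗[k] (⨂[k] _ : Fin n, Y)) ⧸ towerRel ρ l r n))

/-- The class of the elementary tensor `x ⊗ y₁ ⊗ ⋯ ⊗ yₙ`. -/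
def Tower.tmul (ρ : B → X →ₗ[k] X) (l r : B → Y →ₗ[k] Y) {n : ℕ} (x : X) (y : Fin n → Y) :
    Tower ρ l r n :=
  Submodule.Quotient.mk (x ⊗ₜ[k] PiTensorProduct.tprod k y)

end Tensor

/-- An `Aᵉ`-ring `U`: source and target maps `s : A → U`, `t : Aᵒᵖ → U` with commuting images. -/
structure AeRing (k A U : Type*) [CommRing k] [Ring A] [Algebra k A] [Ring U] [Algebra k U] where
  s : A →ₐ[k] U
  t : Aᵐᵒᵖ →ₐ[k] U
  comm : ∀ a b, s a * t b = t b * s a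

namespace AeRing

variable {k A U : Type*} [CommRing k] [Ring A] [Algebra k A] [Ring U] [Algebra k U]
  (E : AeRing k A U)

/-- `a ▷ u = s(a) u`. -/
def lact (a : A) : U →ₗ[k] U := LinearMap.mulLeft k (E.s a)
/-- `u ◁ a = t(a) u`. -/
def ract (a : A) : U →ₗ[k] U := LinearMap.mulLeft k (E.t (op a))
/-- `a ▸ u = u t(a)`. -/
def blact (a : A) : U →ₗ[k] U := LinearMap.mulRight k (E.t (op a))
/-- `u ◂ a = u s(a)`. -/
def bract (a : A) : U →ₗ[k] U := LinearMap.mulRight k (E.s a)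

@[simp] theorem lact_apply (a : A) (u : U) : E.lact a u = E.s a * u := rfl
@[simp] theorem ract_apply (a : A) (u : U) : E.ract a u = E.t (op a) * u := rfl
@[simp] theorem blact_apply (a : A) (u : U) : E.blact a u = u * E.t (op a) := rfl
@[simp] theorem bract_apply (a : A) (u : U) : E.bract a u = u * E.s a := rfl

theorem comm_lact (a b : A) (u : U) : E.ract a (E.lact b u) = E.lact b (E.ract a u) := by
  simp [← mul_assoc, E.comm]

theorem comm_blact (a b : A) (u : U) : E.bract a (E.blact b u) = E.blact b (E.bract a u) := by
  simp [mul_assoc, E.comm]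

/-- `U_◁ ⊗_A ▷U`, the target of a left coproduct. -/
abbrev LeftTensor := Bal E.ract E.lact
/-- `U_◂ ⊗_A ▸U`, the target of a right coproduct. -/
abbrev RightTensor := Bal E.bract E.blact
/-- `▸U ⊗_{Aᵒᵖ} U_◁`, the source of the Hopf-Galois maps. -/
abbrev OpTensor := Bal E.blact E.ract

/-- `u ⊗ v` in `U_◁ ⊗_A ▷U`. -/
abbrev ltmul (u v : U) : E.LeftTensor := Bal.tmul E.ract E.lact u v
/-- `u ⊗ v` in `U_◂ ⊗_A ▸U`. -/
abbrev rtmul (u v : U) : E.RightTensor := Bal.tmul E.bract E.blact u v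
/-- `u ⊗ v` in `▸U ⊗_{Aᵒᵖ} U_◁`. -/
abbrev otmul (u v : U) : E.OpTensor := Bal.tmul E.blact E.ract u v

end AeRing

/-- A left bialgebroid `(U, A, s, t, Δ, ε)`.  In the axioms, the Sweedler notation
`Δ(u) = u₍₁₎ ⊗ u₍₂₎` is made explicit as: for every way of writing `Δ(u)` as a finite sum of
elementary tensors. -/
structure LeftBialgebroid (k A U : Type*) [CommRing k] [Ring A] [Algebra k A] [Ring U]
    [Algebra k U] extends AeRing k A U where
  comul : U →ₗ[k] toAeRing.LeftTensor
  counit : U →ₗ[k] A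
  /-- `Δ(a ▷ u ◁ b) = (a ▷ u₍₁₎) ⊗ (u₍₂₎ ◁ b)` -/
  comul_bimod : ∀ (a b : A) (u : U) (n : ℕ) (x y : Fin n → U),
    comul u = ∑ i, toAeRing.ltmul (x i) (y i) →
    comul (s a * t (op b) * u) = ∑ i, toAeRing.ltmul (s a * x i) (t (op b) * y i)
  /-- `ε(a ▷ u ◁ b) = a ε(u) b` -/
  counit_bimod : ∀ (a b : A) (u : U), counit (s a * t (op b) * u) = a * counit u * b
  /-- `Δ(u₍₁₎) ⊗ u₍₂₎ = u₍₁₎ ⊗ Δ(u₍₂₎)` in `U ⊗_A U ⊗_A U` -/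
  coassoc : ∀ (u : U) (n : ℕ) (x y : Fin n → U),
    comul u = ∑ i, toAeRing.ltmul (x i) (y i) →
    ∑ i, Bal3.snoc _ _ _ toAeRing.comm_lact (y i) (comul (x i)) =
      ∑ i, Bal3.cons _ _ _ toAeRing.comm_lact (x i) (comul (y i))
  /-- `ε(u₍₁₎) ▷ u₍₂₎ = u` -/
  counit_left : ∀ (u : U) (n : ℕ) (x y : Fin n → U),
    comul u = ∑ i, toAeRing.ltmul (x i) (y i) → ∑ i, s (counit (x i)) * y i = u
  /-- `u₍₁₎ ◁ ε(u₍₂₎) = u` -/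
  counit_right : ∀ (u : U) (n : ℕ) (x y : Fin n → U),
    comul u = ∑ i, toAeRing.ltmul (x i) (y i) → ∑ i, t (op (counit (y i))) * x i = u
  /-- `Δ` takes values in the Sweedler-Takeuchi product -/
  takeuchi : ∀ (a : A) (u : U) (n : ℕ) (x y : Fin n → U),
    comul u = ∑ i, toAeRing.ltmul (x i) (y i) →
    ∑ i, toAeRing.ltmul (x i * t (op a)) (y i) = ∑ i, toAeRing.ltmul (x i) (y i * s a)
  comul_one : comul 1 = toAeRing.ltmul 1 1
  comul_mul : ∀ (u v : U) (n m : ℕ) (x y : Fin n → U) (x' y' : Fin m → U),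
    comul u = ∑ i, toAeRing.ltmul (x i) (y i) → comul v = ∑ j, toAeRing.ltmul (x' j) (y' j) →
    comul (u * v) = ∑ i, ∑ j, toAeRing.ltmul (x i * x' j) (y i * y' j)
  counit_one : counit 1 = 1
  /-- `ε(a ▸ u) = ε(u ◂ a)` -/
  counit_blact : ∀ (a : A) (u : U), counit (u * t (op a)) = counit (u * s a)
  counit_mul : ∀ u v : U, counit (u * v) = counit (u * s (counit v))

/-- A right bialgebroid `(V, B, s, t, Δ, ∂)`, with Sweedler notation `Δ(v) = v⁽¹⁾ ⊗ v⁽²⁾` made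
explicit in the same way. -/
structure RightBialgebroid (k B V : Type*) [CommRing k] [Ring B] [Algebra k B] [Ring V]
    [Algebra k V] extends AeRing k B V where
  comul : V →ₗ[k] toAeRing.RightTensor
  counit : V →ₗ[k] B
  /-- `Δ(a ▸ v ◂ b) = (a ▸ v⁽¹⁾) ⊗ (v⁽²⁾ ◂ b)` -/
  comul_bimod : ∀ (a b : B) (v : V) (n : ℕ) (x y : Fin n → V),
    comul v = ∑ i, toAeRing.rtmul (x i) (y i) →
    comul (v * t (op a) * s b) = ∑ i, toAeRing.rtmul (x i * t (op a)) (y i * s b)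
  /-- `∂(a ▸ v ◂ b) = a ∂(v) b` -/
  counit_bimod : ∀ (a b : B) (v : V), counit (v * t (op a) * s b) = a * counit v * b
  /-- `Δ(v⁽¹⁾) ⊗ v⁽²⁾ = v⁽¹⁾ ⊗ Δ(v⁽²⁾)` in `V ⊗_B V ⊗_B V` -/
  coassoc : ∀ (v : V) (n : ℕ) (x y : Fin n → V),
    comul v = ∑ i, toAeRing.rtmul (x i) (y i) →
    ∑ i, Bal3.snoc _ _ _ toAeRing.comm_blact (y i) (comul (x i)) =
      ∑ i, Bal3.cons _ _ _ toAeRing.comm_blact (x i) (comul (y i))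
  /-- `∂(v⁽¹⁾) ▸ v⁽²⁾ = v` -/
  counit_left : ∀ (v : V) (n : ℕ) (x y : Fin n → V),
    comul v = ∑ i, toAeRing.rtmul (x i) (y i) → ∑ i, y i * t (op (counit (x i))) = v
  /-- `v⁽¹⁾ ◂ ∂(v⁽²⁾) = v` -/
  counit_right : ∀ (v : V) (n : ℕ) (x y : Fin n → V),
    comul v = ∑ i, toAeRing.rtmul (x i) (y i) → ∑ i, x i * s (counit (y i)) = v
  /-- `Δ` takes values in the Sweedler-Takeuchi product -/
  takeuchi : ∀ (a : B) (v : V) (n : ℕ) (x y : Fin n → V),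
    comul v = ∑ i, toAeRing.rtmul (x i) (y i) →
    ∑ i, toAeRing.rtmul (s a * x i) (y i) = ∑ i, toAeRing.rtmul (x i) (t (op a) * y i)
  comul_one : comul 1 = toAeRing.rtmul 1 1
  comul_mul : ∀ (v w : V) (n m : ℕ) (x y : Fin n → V) (x' y' : Fin m → V),
    comul v = ∑ i, toAeRing.rtmul (x i) (y i) → comul w = ∑ j, toAeRing.rtmul (x' j) (y' j) →
    comul (v * w) = ∑ i, ∑ j, toAeRing.rtmul (x i * x' j) (y i * y' j)
  counit_one : counit 1 = 1
  /-- `∂(a ▷ v) = ∂(v ◁ a)` -/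
  counit_lact : ∀ (a : B) (v : V), counit (s a * v) = counit (t (op a) * v)
  counit_mul : ∀ v w : V, counit (v * w) = counit (t (op (counit v)) * w)


/-- `Hom_{Aᵒᵖ}(U_◁, M)` for a right `A`-module `M`: the maps `f` with `f(u ◁ a) = f(u) a`. -/
def RHom {k A U : Type*} [CommRing k] [Ring A] [Algebra k A] [Ring U] [Algebra k U]
    (E : AeRing k A U) (M : Type*) [AddCommGroup M] [Module k M] [Module Aᵐᵒᵖ M]
    [IsScalarTower k Aᵐᵒᵖ M] : Submodule k (U →ₗ[k] M) where
  carrier := {f | ∀ a u, f (E.t (op a) * u) = op a • f u}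
  zero_mem' := by intro a u; simp
  add_mem' := by intro f g hf hg a u; simp [hf a u, hg a u]
  smul_mem' := by
    intro c f hf a u
    have : SMulCommClass k Aᵐᵒᵖ M := IsScalarTower.to_smulCommClass
    simp [hf a u, smul_comm c (op a)]

/-- The right dual `U^* = Hom_{Aᵒᵖ}(U_◁, A)` of a left bialgebroid. -/
def RightDual {k A U : Type*} [CommRing k] [Ring A] [Algebra k A] [Ring U] [Algebra k U]
    (H : LeftBialgebroid k A U) : Type _ := RHom H.toAeRing A

namespace LeftBialgebroid

variable {k A U : Type*} [CommRing k] [Ring A] [Algebra k A] [Ring U] [Algebra k U]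
  (H : LeftBialgebroid k A U)

instance : AddCommGroup (RightDual H) := inferInstanceAs (AddCommGroup (RHom H.toAeRing A))
instance : Module k (RightDual H) := inferInstanceAs (Module k (RHom H.toAeRing A))

/-- The pairing `⟨φ, u⟩ = φ(u)`. -/
def pair : RightDual H →ₗ[k] U →ₗ[k] A := (RHom H.toAeRing A).subtype

/-- A right `A`-linear map `U_◁ → A` as an element of `U^*`. -/
def mkDual (f : U →ₗ[k] A) (hf : ∀ a u, f (H.t (op a) * u) = f u * a) : RightDual H :=
  ⟨f, fun a u => by simpa using hf a u⟩

@[simp] theorem pair_mkDual (f : U →ₗ[k] A) (hf : ∀ a u, f (H.t (op a) * u) = f u * a) (u : U) :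
    H.pair (H.mkDual f hf) u = f u := rfl

theorem pair_ract (φ : RightDual H) (a : A) (u : U) :
    H.pair φ (H.t (op a) * u) = H.pair φ u * a := by
  exact φ.2 a u

theorem dual_ext {φ ψ : RightDual H} (h : ∀ u, H.pair φ u = H.pair ψ u) : φ = ψ :=
  Subtype.ext (LinearMap.ext h)

/-- The map `x ⊗ y ↦ ⟨ψ, ⟨φ, x⟩ ▷ y⟩`. -/
def convPair (φ ψ : RightDual H) : H.LeftTensor →ₗ[k] A :=
  Bal.lift
    (((LinearMap.mul k U).compr₂ (H.pair ψ)).comp (H.s.toLinearMap.comp (H.pair φ)))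
    (fun b x y => by simp [pair_ract, mul_assoc])

@[simp] theorem convPair_tmul (φ ψ : RightDual H) (x y : U) :
    H.convPair φ ψ (H.ltmul x y) = H.pair ψ (H.s (H.pair φ x) * y) := by
  simp [convPair]

theorem comul_t {u : U} (a : A) {n : ℕ} {x y : Fin n → U}
    (h : H.comul u = ∑ i, H.ltmul (x i) (y i)) :
    H.comul (H.t (op a) * u) = ∑ i, H.ltmul (x i) (H.t (op a) * y i) := by
  simpa using H.comul_bimod 1 a u n x y h

theorem comul_s {u : U} (a : A) {n : ℕ} {x y : Fin n → U}
    (h : H.comul u = ∑ i, H.ltmul (x i) (y i)) :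
    H.comul (H.s a * u) = ∑ i, H.ltmul (H.s a * x i) (y i) := by
  simpa using H.comul_bimod a 1 u n x y h

theorem counit_t_mul (a : A) (u : U) : H.counit (H.t (op a) * u) = H.counit u * a := by
  simpa using H.counit_bimod 1 a u

theorem counit_s_mul (a : A) (u : U) : H.counit (H.s a * u) = a * H.counit u := by
  simpa using H.counit_bimod a 1 u

/-- `Δ(u ◂ a) = (u₍₁₎ ◂ a) ⊗ u₍₂₎` -/
theorem comul_mul_s {u : U} (a : A) {n : ℕ} {x y : Fin n → U}
    (h : H.comul u = ∑ i, H.ltmul (x i) (y i)) :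
    H.comul (u * H.s a) = ∑ i, H.ltmul (x i * H.s a) (y i) := by
  have h1 : H.comul 1 = ∑ _i : Fin 1, H.ltmul 1 1 := by simpa using H.comul_one
  have h2 := H.comul_s a h1
  rw [mul_one] at h2
  have := H.comul_mul u (H.s a) n 1 x y _ _ h h2
  simpa using this

/-- `Δ(a ▸ u) = u₍₁₎ ⊗ (a ▸ u₍₂₎)` -/
theorem comul_mul_t {u : U} (a : A) {n : ℕ} {x y : Fin n → U}
    (h : H.comul u = ∑ i, H.ltmul (x i) (y i)) :
    H.comul (u * H.t (op a)) = ∑ i, H.ltmul (x i) (y i * H.t (op a)) := by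
  have h1 : H.comul 1 = ∑ _i : Fin 1, H.ltmul 1 1 := by simpa using H.comul_one
  have h2 := H.comul_t a h1
  rw [mul_one] at h2
  have := H.comul_mul u (H.t (op a)) n 1 x y _ _ h h2
  simpa using this

theorem exists_rep (u : U) :
    ∃ (n : ℕ) (x y : Fin n → U), H.comul u = ∑ i, H.ltmul (x i) (y i) :=
  Bal.exists_rep (H.comul u)

/-- The convolution product `(φψ)(u) = ⟨ψ, ⟨φ, u₍₁₎⟩ ▷ u₍₂₎⟩` on `U^*`. -/
instance : Mul (RightDual H) where
  mul φ ψ := H.mkDual ((H.convPair φ ψ).comp H.comul) (by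
    intro a u
    obtain ⟨n, x, y, h⟩ := H.exists_rep u
    simp only [LinearMap.comp_apply, H.comul_t a h, h, map_sum, convPair_tmul, Finset.sum_mul]
    refine Finset.sum_congr rfl fun i _ => ?_
    rw [← mul_assoc, H.comm, mul_assoc, pair_ract])

/-- The unit of `U^*` is the counit of `U`. -/
instance : One (RightDual H) where
  one := H.mkDual H.counit (fun a u => H.counit_t_mul a u)

@[simp] theorem pair_one (u : U) : H.pair 1 u = H.counit u := rfl

theorem pair_mul (φ ψ : RightDual H) (u : U) :
    H.pair (φ * ψ) u = H.convPair φ ψ (H.comul u) := rfl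

theorem pair_mul_rep (φ ψ : RightDual H) {u : U} {n : ℕ} {x y : Fin n → U}
    (h : H.comul u = ∑ i, H.ltmul (x i) (y i)) :
    H.pair (φ * ψ) u = ∑ i, H.pair ψ (H.s (H.pair φ (x i)) * y i) := by
  rw [pair_mul, h]
  simp

theorem dual_mul_assoc (φ ψ χ : RightDual H) : φ * ψ * χ = φ * (ψ * χ) := by
  refine H.dual_ext fun u => ?_
  obtain ⟨n, x, y, h⟩ := H.exists_rep u
  let G : Bal3 H.ract H.lact H.ract H.comm_lact →ₗ[k] A :=
    Bal.lift (((LinearMap.mul k U).compr₂ (H.pair χ)).comp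
      (H.s.toLinearMap.comp (H.convPair φ ψ))) (by
      intro b z w
      obtain ⟨m, p, q, rfl⟩ := Bal.exists_rep z
      simp only [map_sum, LinearMap.sum_apply, Bal.mapRight_tmul]
      refine Finset.sum_congr rfl fun i _ => ?_
      simp only [LinearMap.comp_apply, AlgHom.toLinearMap_apply, LinearMap.compr₂_apply,
        LinearMap.mul_apply', convPair_tmul, AeRing.ract_apply, AeRing.lact_apply]
      rw [← mul_assoc (H.s _) (H.t _), H.comm, mul_assoc (H.t _), pair_ract, map_mul H.s,
        mul_assoc (H.s _)])
  have hG := congrArg G (H.coassoc u n x y h)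
  simp only [map_sum] at hG
  rw [H.pair_mul_rep _ _ h, H.pair_mul_rep _ _ h]
  refine Eq.trans ?_ (hG.trans ?_)
  · refine Finset.sum_congr rfl fun i _ => ?_
    simp [G, Bal3.snoc, pair_mul]
  · refine Finset.sum_congr rfl fun i _ => ?_
    obtain ⟨m, p, q, h'⟩ := H.exists_rep (y i)
    rw [H.pair_mul_rep _ _ (H.comul_s _ h'), h']
    simp [G, Bal3.cons]

instance : Ring (RightDual H) where
  __ := (inferInstance : AddCommGroup (RightDual H))
  mul_assoc := H.dual_mul_assoc
  one_mul φ := by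
    refine H.dual_ext fun u => ?_
    obtain ⟨n, x, y, h⟩ := H.exists_rep u
    rw [H.pair_mul_rep _ _ h, ← map_sum]
    exact congrArg _ (H.counit_left u n x y h)
  mul_one φ := by
    refine H.dual_ext fun u => ?_
    obtain ⟨n, x, y, h⟩ := H.exists_rep u
    rw [H.pair_mul_rep _ _ h]
    conv_rhs => rw [← H.counit_right u n x y h]
    simp [counit_s_mul, pair_ract]
  left_distrib φ ψ χ := by
    refine H.dual_ext fun u => ?_
    obtain ⟨n, x, y, h⟩ := H.exists_rep u
    simp [H.pair_mul_rep _ _ h, Finset.sum_add_distrib]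
  right_distrib φ ψ χ := by
    refine H.dual_ext fun u => ?_
    obtain ⟨n, x, y, h⟩ := H.exists_rep u
    simp [H.pair_mul_rep _ _ h, Finset.sum_add_distrib, add_mul]
  zero_mul φ := by
    refine H.dual_ext fun u => ?_
    obtain ⟨n, x, y, h⟩ := H.exists_rep u
    simp [H.pair_mul_rep _ _ h]
  mul_zero φ := by
    refine H.dual_ext fun u => ?_
    obtain ⟨n, x, y, h⟩ := H.exists_rep u
    simp [H.pair_mul_rep _ _ h]

instance : Algebra k (RightDual H) :=
  Algebra.ofModule
    (fun c φ ψ => by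
      refine H.dual_ext fun u => ?_
      obtain ⟨n, x, y, h⟩ := H.exists_rep u
      simp [H.pair_mul_rep _ _ h, Finset.smul_sum])
    (fun c φ ψ => by
      refine H.dual_ext fun u => ?_
      obtain ⟨n, x, y, h⟩ := H.exists_rep u
      simp [H.pair_mul_rep _ _ h, Finset.smul_sum])

/-- `s^r(a) = ε((·) ◂ a)` -/
def dualS (a : A) : RightDual H :=
  H.mkDual (H.counit.comp (H.bract a)) (fun b u => by simp [mul_assoc, counit_t_mul])

/-- `t^r(a) = a ε(·)` -/
def dualT (a : A) : RightDual H :=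
  H.mkDual ((LinearMap.mulLeft k a).comp H.counit) (fun b u => by simp [mul_assoc, counit_t_mul])

@[simp] theorem pair_dualS (a : A) (u : U) : H.pair (H.dualS a) u = H.counit (u * H.s a) := rfl

@[simp] theorem pair_dualT (a : A) (u : U) : H.pair (H.dualT a) u = a * H.counit u := rfl

theorem dualS_mul (a : A) (φ : RightDual H) (u : U) :
    H.pair (H.dualS a * φ) u = H.pair φ (u * H.s a) := by
  obtain ⟨n, x, y, h⟩ := H.exists_rep u
  rw [H.pair_mul_rep _ _ h, ← H.counit_left _ _ _ _ (H.comul_mul_s a h)]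
  simp

theorem dualT_mul (a : A) (φ : RightDual H) (u : U) :
    H.pair (H.dualT a * φ) u = H.pair φ (H.s a * u) := by
  obtain ⟨n, x, y, h⟩ := H.exists_rep u
  rw [H.pair_mul_rep _ _ h]
  conv_rhs => rw [← H.counit_left _ _ _ _ h]
  simp [mul_assoc, Finset.mul_sum]

theorem mul_dualT (a : A) (φ : RightDual H) (u : U) :
    H.pair (φ * H.dualT a) u = a * H.pair φ u := by
  obtain ⟨n, x, y, h⟩ := H.exists_rep u
  rw [H.pair_mul_rep _ _ h]
  conv_rhs => rw [← H.counit_right _ _ _ _ h]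
  simp [counit_s_mul, pair_ract, Finset.mul_sum]

theorem mul_dualS (a : A) (φ : RightDual H) (u : U) :
    H.pair (φ * H.dualS a) u = H.pair φ (u * H.t (op a)) := by
  obtain ⟨n, x, y, h⟩ := H.exists_rep u
  rw [H.pair_mul_rep _ _ h, ← H.counit_right _ _ _ _ (H.comul_mul_t a h)]
  simp [mul_assoc, counit_s_mul, pair_ract, counit_blact]

/-- The `Aᵉ`-ring structure of `U^*`. -/
def dualAeRing : AeRing k A (RightDual H) where
  s := AlgHom.ofLinearMap
    { toFun := H.dualS
      map_add' := fun a b => H.dual_ext fun u => by simp [mul_add]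
      map_smul' := fun c a => H.dual_ext fun u => by simp }
    (H.dual_ext fun u => by simp)
    (fun a b => H.dual_ext fun u => by
      change H.pair (H.dualS (a * b)) u = H.pair (H.dualS a * H.dualS b) u
      rw [dualS_mul]; simp [mul_assoc])
  t := AlgHom.ofLinearMap
    { toFun := fun a => H.dualT (unop a)
      map_add' := fun a b => H.dual_ext fun u => by simp [add_mul]
      map_smul' := fun c a => H.dual_ext fun u => by simp }
    (H.dual_ext fun u => by simp)
    (fun a b => H.dual_ext fun u => by
      change H.pair (H.dualT (unop (a * b))) u = H.pair (H.dualT (unop a) * H.dualT (unop b)) u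
      rw [mul_dualT]; simp [mul_assoc])
  comm a b := H.dual_ext fun u => by
    change H.pair (H.dualS a * H.dualT (unop b)) u = H.pair (H.dualT (unop b) * H.dualS a) u
    rw [mul_dualT, mul_dualS]
    simp [counit_blact]

@[simp] theorem dualAeRing_s (a : A) : H.dualAeRing.s a = H.dualS a := rfl

@[simp] theorem dualAeRing_t (a : A) : H.dualAeRing.t (op a) = H.dualT a := rfl

/-- The right `A`-module `U_◁` is finitely generated and projective. -/
def FinProj : Prop :=
  letI : Module Aᵐᵒᵖ U := Module.compHom U (H.t : Aᵐᵒᵖ →+* U)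
  Module.Finite Aᵐᵒᵖ U ∧ Module.Projective Aᵐᵒᵖ U

/-- A finite dual basis of `U_◁`: elements `eᵢ` of `U` and `eⁱ` of `U^*` with
`u = ∑ eᵢ ◁ ⟨eⁱ, u⟩`. -/
structure DualBasis where
  n : ℕ
  e : Fin n → U
  f : Fin n → RightDual H
  sum_eq : ∀ u, ∑ i, H.t (op (H.pair (f i) u)) * e i = u

theorem FinProj.nonempty_dualBasis {H : LeftBialgebroid k A U} (hU : H.FinProj) :
    Nonempty (DualBasis H) := by
  let _ : Module Aᵐᵒᵖ U := Module.compHom U (H.t : Aᵐᵒᵖ →+* U)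
  obtain ⟨h1, h2⟩ : Module.Finite Aᵐᵒᵖ U ∧ Module.Projective Aᵐᵒᵖ U := hU
  have smul_def : ∀ (a : Aᵐᵒᵖ) (u : U), a • u = H.t a * u := fun a u => rfl
  obtain ⟨n, p, hp⟩ := Module.Finite.exists_fin' Aᵐᵒᵖ U
  obtain ⟨g, hg⟩ := Module.projective_lifting_property p LinearMap.id hp
  refine ⟨⟨n, fun i => p (Pi.single i 1), fun i => H.mkDual
    { toFun := fun u => unop (g u i)
      map_add' := fun u v => by simp
      map_smul' := fun c u => by
        have : c • u = (algebraMap k Aᵐᵒᵖ c) • u := by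
          rw [smul_def, AlgHom.commutes, Algebra.smul_def]
        rw [this, map_smul]
        simp [Algebra.smul_def, Algebra.commutes] }
    (fun a u => ?_), fun u => ?_⟩⟩
  · change unop (g (H.t (op a) * u) i) = unop (g u i) * a
    rw [← smul_def, map_smul]
    rfl
  · simp only [pair_mkDual, LinearMap.coe_mk, AddHom.coe_mk, op_unop]
    have h3 : p (g u) = u := LinearMap.congr_fun hg u
    conv_rhs => rw [← h3, pi_eq_sum_univ' (g u), map_sum]
    refine Finset.sum_congr rfl fun i _ => ?_
    rw [map_smul, smul_def]

/-- A choice of a finite dual basis of `U_◁`. -/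
noncomputable def FinProj.basis {H : LeftBialgebroid k A U} (hU : H.FinProj) : DualBasis H :=
  Classical.choice hU.nonempty_dualBasis

/-- `(v ⇀ φ)(u) = φ(uv)` -/
def hit (φ : RightDual H) (v : U) : RightDual H :=
  H.mkDual ((H.pair φ).comp (LinearMap.mulRight k v)) (fun a u => by simp [mul_assoc, pair_ract])

@[simp] theorem pair_hit (φ : RightDual H) (u v : U) :
    H.pair (H.hit φ v) u = H.pair φ (u * v) := rfl

/-- The pairing `⟨φ ⊗ ψ, u ⊗ v⟩ = ⟨φ, ⟨ψ, v⟩ ▸ u⟩` of `U^*_◂ ⊗_A ▸U^*` with `▸U ⊗_{Aᵒᵖ} U_◁`. -/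
def pair2 (u v : U) : H.dualAeRing.RightTensor →ₗ[k] A :=
  Bal.lift (LinearMap.mk₂ k (fun φ ψ => H.pair φ (u * H.t (op (H.pair ψ v))))
    (fun _ _ _ => by simp) (fun _ _ _ => by simp) (fun _ _ _ => by simp [mul_add])
    (fun _ _ _ => by simp))
    (fun b φ ψ => by simp [mul_dualS, mul_dualT, mul_assoc])

@[simp] theorem pair2_tmul (u v : U) (φ ψ : RightDual H) :
    H.pair2 u v (Bal.tmul _ _ φ ψ) = H.pair φ (u * H.t (op (H.pair ψ v))) := by
  simp [pair2]

variable {H} in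
theorem DualBasis.sum_pair (b : DualBasis H) (φ : RightDual H) :
    ∑ i, b.f i * H.dualT (H.pair φ (b.e i)) = φ := by
  refine H.dual_ext fun u => ?_
  conv_rhs => rw [← b.sum_eq u]
  simp [mul_dualT, pair_ract]

/-- The partial pairing `φ ⊗ ψ ↦ φ ◂ ⟨ψ, v⟩`. -/
def slice2 (v : U) : H.dualAeRing.RightTensor →ₗ[k] RightDual H :=
  Bal.lift (LinearMap.mk₂ k (fun φ ψ => φ * H.dualS (H.pair ψ v))
    (fun _ _ _ => by simp [add_mul]) (fun _ _ _ => by simp)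
    (fun φ _ _ => H.dual_ext fun u => by simp [mul_dualS, mul_add])
    (fun _ _ _ => H.dual_ext fun u => by simp [mul_dualS]))
    (fun b φ ψ => H.dual_ext fun u => by simp [mul_dualS, mul_dualT]; simp [mul_assoc])

@[simp] theorem slice2_tmul (v : U) (φ ψ : RightDual H) :
    H.slice2 v (Bal.tmul _ _ φ ψ) = φ * H.dualS (H.pair ψ v) := by
  simp [slice2]

theorem pair_slice2 (u v : U) (z : H.dualAeRing.RightTensor) :
    H.pair (H.slice2 v z) u = H.pair2 u v z := by
  obtain ⟨n, x, y, rfl⟩ := Bal.exists_rep z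
  simp [mul_dualS]

variable {H} in
theorem DualBasis.recon2 (b : DualBasis H) (z : H.dualAeRing.RightTensor) :
    ∑ i, H.dualAeRing.rtmul (H.slice2 (b.e i) z) (b.f i) = z := by
  obtain ⟨n, x, y, rfl⟩ := Bal.exists_rep z
  simp only [AeRing.rtmul, map_sum, LinearMap.sum_apply]
  rw [Finset.sum_comm]
  refine Finset.sum_congr rfl fun j _ => ?_
  conv_rhs => rw [← b.sum_pair (y j), map_sum]
  refine Finset.sum_congr rfl fun i _ => ?_
  rw [slice2_tmul]
  exact Bal.tmul_bal H.dualAeRing.bract H.dualAeRing.blact _ _ _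

variable {H} in
theorem DualBasis.pair2_ext (b : DualBasis H) {z w : H.dualAeRing.RightTensor}
    (h : ∀ u v, H.pair2 u v z = H.pair2 u v w) : z = w := by
  rw [← b.recon2 z, ← b.recon2 w]
  refine Finset.sum_congr rfl fun i _ => ?_
  have : H.slice2 (b.e i) z = H.slice2 (b.e i) w :=
    H.dual_ext fun u => by rw [pair_slice2, pair_slice2, h]
  rw [this]

/-- The right coproduct `φ ↦ ∑ (eᵢ ⇀ φ) ⊗ eⁱ` of `U^*`. -/
def DualBasis.comul {H : LeftBialgebroid k A U} (b : DualBasis H) :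
    RightDual H →ₗ[k] H.dualAeRing.RightTensor where
  toFun φ := ∑ i, H.dualAeRing.rtmul (H.hit φ (b.e i)) (b.f i)
  map_add' φ ψ := by
    rw [← Finset.sum_add_distrib]
    refine Finset.sum_congr rfl fun i _ => ?_
    have : H.hit (φ + ψ) (b.e i) = H.hit φ (b.e i) + H.hit ψ (b.e i) :=
      H.dual_ext fun u => by simp
    rw [this]; simp [AeRing.rtmul]
  map_smul' c φ := by
    rw [RingHom.id_apply, Finset.smul_sum]
    refine Finset.sum_congr rfl fun i _ => ?_
    have : H.hit (c • φ) (b.e i) = c • H.hit φ (b.e i) := H.dual_ext fun u => by simp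
    rw [this]; simp [AeRing.rtmul]

variable {H} in
/-- The coproduct of `U^*` is dual to the product of `U`:
`⟨φ⁽¹⁾, ⟨φ⁽²⁾, v⟩ ▸ u⟩ = ⟨φ, uv⟩`. -/
theorem DualBasis.pair2_comul (b : DualBasis H) (φ : RightDual H) (u v : U) :
    H.pair2 u v (b.comul φ) = H.pair φ (u * v) := by
  conv_rhs => rw [← b.sum_eq v]
  simp [DualBasis.comul, Finset.mul_sum, mul_assoc]

variable {H} in
theorem DualBasis.pair_rep (b : DualBasis H) {φ : RightDual H} {n : ℕ} {x y : Fin n → RightDual H}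
    (h : b.comul φ = ∑ i, H.dualAeRing.rtmul (x i) (y i)) (u v : U) :
    ∑ i, H.pair (x i) (u * H.t (op (H.pair (y i) v))) = H.pair φ (u * v) := by
  rw [← b.pair2_comul, h]
  simp

/-- The triple pairing. -/
def pair3 (u v w : U) :
    Bal3 H.dualAeRing.bract H.dualAeRing.blact H.dualAeRing.bract H.dualAeRing.comm_blact
      →ₗ[k] A :=
  Bal.lift (LinearMap.mk₂ k (fun z ψ => H.pair2 u (v * H.t (op (H.pair ψ w))) z)
    (fun _ _ _ => by simp) (fun _ _ _ => by simp)
    (fun z _ _ => by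
      obtain ⟨n, x, y, rfl⟩ := Bal.exists_rep z
      simp [mul_add, Finset.sum_add_distrib])
    (fun _ z _ => by
      obtain ⟨n, x, y, rfl⟩ := Bal.exists_rep z
      simp [Finset.smul_sum]))
    (fun b z ψ => by
      obtain ⟨n, x, y, rfl⟩ := Bal.exists_rep z
      simp [mul_dualS, mul_dualT, mul_assoc])

/-- The partial triple pairing. -/
def slice3 (w : U) :
    Bal3 H.dualAeRing.bract H.dualAeRing.blact H.dualAeRing.bract H.dualAeRing.comm_blact
      →ₗ[k] H.dualAeRing.RightTensor :=
  Bal.lift (LinearMap.mk₂ k (fun z ψ => Bal.mapRight (r := H.dualAeRing.bract)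
      (H.dualAeRing.bract (H.pair ψ w)) (H.dualAeRing.comm_blact _) z)
    (fun _ _ _ => by simp) (fun _ _ _ => by simp)
    (fun z _ _ => by
      obtain ⟨n, x, y, rfl⟩ := Bal.exists_rep z
      simp [mul_add, Finset.sum_add_distrib, -dualAeRing_s])
    (fun _ z _ => by
      obtain ⟨n, x, y, rfl⟩ := Bal.exists_rep z
      simp [Finset.smul_sum, -dualAeRing_s]))
    (fun b z ψ => by
      obtain ⟨n, x, y, rfl⟩ := Bal.exists_rep z
      simp [mul_dualT, mul_assoc, -dualAeRing_s])

variable {H} in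
theorem DualBasis.pair3_ext (b : DualBasis H)
    {z w : Bal3 H.dualAeRing.bract H.dualAeRing.blact H.dualAeRing.bract H.dualAeRing.comm_blact}
    (h : ∀ u v x, H.pair3 u v x z = H.pair3 u v x w) : z = w := by
  have recon : ∀ z : Bal3 H.dualAeRing.bract H.dualAeRing.blact H.dualAeRing.bract
      H.dualAeRing.comm_blact, ∑ i, Bal.tmul _ _ (H.slice3 (b.e i) z) (b.f i) = z := by
    intro z
    obtain ⟨n, x, y, rfl⟩ := Bal.exists_rep z
    simp only [map_sum, LinearMap.sum_apply]
    rw [Finset.sum_comm]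
    refine Finset.sum_congr rfl fun j _ => ?_
    conv_rhs => rw [← b.sum_pair (y j), map_sum]
    refine Finset.sum_congr rfl fun i _ => ?_
    rw [slice3, Bal.lift_tmul]
    exact Bal.tmul_bal (fun a => Bal.mapRight (r := H.dualAeRing.bract) (l := H.dualAeRing.blact)
      (H.dualAeRing.bract a) (H.dualAeRing.comm_blact a)) H.dualAeRing.blact _ _ _
  have key : ∀ u v x z, H.pair2 u v (H.slice3 x z) = H.pair3 u v x z := by
    intro u v x z
    obtain ⟨n, p, q, rfl⟩ := Bal.exists_rep z
    simp only [map_sum]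
    refine Finset.sum_congr rfl fun i _ => ?_
    obtain ⟨m, p', q', h'⟩ := Bal.exists_rep (p i)
    rw [h']
    simp [slice3, pair3, mul_dualS]
  rw [← recon z, ← recon w]
  refine Finset.sum_congr rfl fun i _ => ?_
  have : H.slice3 (b.e i) z = H.slice3 (b.e i) w :=
    b.pair2_ext fun u v => by rw [key, key, h]
  rw [this]

/-- The right bialgebroid `U^*`, for a left bialgebroid `U` with `U_◁` finitely generated
projective. The coproduct is characterised by `⟨φ⁽¹⁾, ⟨φ⁽²⁾, v⟩ ▸ u⟩ = ⟨φ, uv⟩`. -/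
noncomputable def dual (hU : H.FinProj) : RightBialgebroid k A (RightDual H) where
  toAeRing := H.dualAeRing
  comul := hU.basis.comul
  counit := H.pair.flip 1
  comul_bimod a b φ n x y h := hU.basis.pair2_ext fun u v => by
    rw [hU.basis.pair2_comul]
    have := hU.basis.pair_rep h u (v * H.t (op b))
    simp only [AeRing.rtmul, map_sum, dualAeRing_s, dualAeRing_t, pair2_tmul, mul_dualS, mul_dualT]
    rw [← Finset.mul_sum, this, mul_assoc]
  counit_bimod a b φ := by
    change H.pair (φ * H.dualT a * H.dualS b) 1 = a * H.pair φ 1 * b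
    rw [mul_dualS, mul_dualT, one_mul, ← mul_one (H.t (op b)), pair_ract, mul_assoc]
  coassoc φ n x y h := hU.basis.pair3_ext fun u v w => by
    have h1 : ∀ (x : RightDual H) (z : H.dualAeRing.RightTensor),
        H.pair3 u v w (Bal3.cons _ _ _ H.dualAeRing.comm_blact x z) =
          H.pair x (u * H.t (op (H.pair2 v w z))) := by
      intro x z
      obtain ⟨m, p, q, rfl⟩ := Bal.exists_rep z
      simp [Bal3.cons, pair3, Finset.mul_sum]
    have h2 : ∀ (y : RightDual H) (z : H.dualAeRing.RightTensor),
        H.pair3 u v w (Bal3.snoc _ _ _ H.dualAeRing.comm_blact y z) =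
          H.pair2 u (v * H.t (op (H.pair y w))) z := by
      intro y z
      simp [Bal3.snoc, pair3]
    simp only [map_sum, h1, h2, hU.basis.pair2_comul]
    rw [hU.basis.pair_rep h, ← mul_assoc u v w, ← hU.basis.pair_rep h]
    simp only [mul_assoc]
  counit_left φ n x y h := H.dual_ext fun u => by
    have := hU.basis.pair_rep h 1 u
    rw [one_mul] at this
    rw [← this]
    change H.pair (∑ i, y i * H.dualT (H.pair (x i) 1)) u = _
    simp only [map_sum, LinearMap.sum_apply, mul_dualT]
    refine Finset.sum_congr rfl fun i _ => ?_
    rw [one_mul, ← H.pair_ract, mul_one]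
  counit_right φ n x y h := H.dual_ext fun u => by
    have := hU.basis.pair_rep h u 1
    rw [mul_one] at this
    rw [← this]
    simp [mul_dualS]
  takeuchi a φ n x y h := hU.basis.pair2_ext fun u v => by
    have h1 := hU.basis.pair_rep h (u * H.s a) v
    have h2 := hU.basis.pair_rep h u (H.s a * v)
    simp only [AeRing.rtmul, map_sum, dualAeRing_s, dualAeRing_t, pair2_tmul, dualS_mul, dualT_mul]
    rw [h2, ← mul_assoc, ← h1]
    simp [mul_assoc, H.comm]
  comul_one := hU.basis.pair2_ext fun u v => by
    rw [hU.basis.pair2_comul, pair2_tmul]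
    simp [H.counit_mul u v, counit_blact]
  comul_mul φ ψ n m x y x' y' hφ hψ := hU.basis.pair2_ext fun u v => by
    obtain ⟨nu, p, q, hu⟩ := H.exists_rep u
    obtain ⟨nv, p', q', hv⟩ := H.exists_rep v
    have huv := H.comul_mul u v _ _ _ _ _ _ hu hv
    have hL : H.pair (φ * ψ) (u * v) =
        ∑ a, ∑ b, ∑ i, H.pair ψ (H.s (H.pair (x i) (p a * H.t (op (H.pair (y i) (p' b))))) *
          (q a * q' b)) := by
      rw [pair_mul, huv]
      simp only [map_sum, convPair_tmul, ← hU.basis.pair_rep hφ, Finset.sum_mul]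
    obtain ⟨Z, hZ⟩ : ∃ Z : Fin n → U, ∀ i, Z i = ∑ b, H.s (H.pair (y i) (p' b)) * q' b :=
      ⟨_, fun _ => rfl⟩
    have hR : ∀ i j, H.pair (x i * x' j) (u * H.t (op (H.pair (y i * y' j) v))) =
        ∑ a, H.pair (x' j) (H.s (H.pair (x i) (p a)) * q a * H.t (op (H.pair (y' j) (Z i)))) := by
      intro i j
      rw [H.pair_mul_rep _ _ (H.comul_mul_t _ hu), H.pair_mul_rep _ _ hv, hZ]
      simp only [map_sum, mul_assoc]
    have hT : ∀ i b, ∑ a, H.pair ψ (H.s (H.pair (x i) (p a * H.t (op (H.pair (y i) (p' b))))) *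
          (q a * q' b)) =
        ∑ a, H.pair ψ (H.s (H.pair (x i) (p a)) * q a * (H.s (H.pair (y i) (p' b)) * q' b)) := by
      intro i b
      have := congrArg (H.convPair (x i) (H.hit ψ (q' b)))
        (H.takeuchi (H.pair (y i) (p' b)) u _ _ _ hu)
      simpa only [map_sum, convPair_tmul, pair_hit, mul_assoc] using this
    rw [hU.basis.pair2_comul, hL]
    simp only [AeRing.rtmul, map_sum, pair2_tmul, hR]
    have hS : ∀ i, ∑ j, ∑ a, H.pair (x' j) (H.s (H.pair (x i) (p a)) * q a *
          H.t (op (H.pair (y' j) (Z i)))) =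
        ∑ b, ∑ a, H.pair ψ (H.s (H.pair (x i) (p a)) * q a *
          (H.s (H.pair (y i) (p' b)) * q' b)) := by
      intro i
      rw [Finset.sum_comm]
      simp only [hU.basis.pair_rep hψ]
      simp only [hZ, Finset.mul_sum, map_sum]
      rw [Finset.sum_comm]
    simp only [hS, ← hT]
    rw [Finset.sum_comm' (t' := Finset.univ) (s' := fun _ => Finset.univ) (by simp)]
    rw [Finset.sum_comm (s := (Finset.univ : Finset (Fin n)))]
    refine Finset.sum_congr rfl fun b _ => ?_
    rw [Finset.sum_comm]
  counit_one := H.counit_one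
  counit_lact a φ := by simp [dualS_mul, dualT_mul]
  counit_mul φ ψ := by
    have h1 : H.comul 1 = ∑ _i : Fin 1, H.ltmul 1 1 := by simpa using H.comul_one
    change H.pair (φ * ψ) 1 = H.pair (H.dualT (H.pair φ 1) * ψ) 1
    simp [H.pair_mul_rep _ _ h1, H.counit_one]

end LeftBialgebroid

namespace LeftBialgebroid

variable {k A U : Type*} [CommRing k] [Ring A] [Algebra k A] [Ring U] [Algebra k U]
  (H : LeftBialgebroid k A U)

/-- The map `x ⊗ y ↦ x ⊗ y u'` on `U_◁ ⊗_A ▷U`. -/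
def mulSnd (u' : U) : H.LeftTensor →ₗ[k] H.LeftTensor :=
  Bal.mapRight (LinearMap.mulRight k u') (fun b y => by simp [mul_assoc])

@[simp] theorem mulSnd_tmul (u' x y : U) :
    H.mulSnd u' (Bal.tmul H.ract H.lact x y) = Bal.tmul H.ract H.lact x (y * u') :=
  Bal.mapRight_tmul _ _ x y

/-- The Hopf-Galois map `▸U ⊗_{Aᵒᵖ} U_◁ → U_◁ ⊗_A ▷U`, `u ⊗ u' ↦ u₍₁₎ ⊗ u₍₂₎ u'`. -/
def galois : H.OpTensor →ₗ[k] H.LeftTensor :=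
  Bal.lift
    (LinearMap.mk₂ k (fun u u' => H.mulSnd u' (H.comul u))
      (fun _ _ _ => by simp) (fun _ _ _ => by simp)
      (fun u _ _ => by
        obtain ⟨n, x, y, h⟩ := H.exists_rep u
        simp [h, AeRing.ltmul, mul_add, Finset.sum_add_distrib])
      (fun _ u _ => by
        obtain ⟨n, x, y, h⟩ := H.exists_rep u
        simp [h, AeRing.ltmul, Finset.smul_sum]))
    (fun a u u' => by
      obtain ⟨n, x, y, h⟩ := H.exists_rep u
      simp [H.comul_mul_t a h, AeRing.ltmul, h, mul_assoc])

/-- A left bialgebroid is a left Hopf algebroid if its Hopf-Galois map is bijective. -/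
def IsHopf : Prop := Function.Bijective H.galois

end LeftBialgebroid

namespace RightBialgebroid

variable {k B V : Type*} [CommRing k] [Ring B] [Algebra k B] [Ring V] [Algebra k V]
  (R : RightBialgebroid k B V)

/-- `Δ(v ◁ b) = (v⁽¹⁾ ◁ b) ⊗ v⁽²⁾` -/
theorem comul_t_mul {v : V} (b : B) {n : ℕ} {x y : Fin n → V}
    (h : R.comul v = ∑ i, R.rtmul (x i) (y i)) :
    R.comul (R.t (op b) * v) = ∑ i, R.rtmul (R.t (op b) * x i) (y i) := by
  have h1 : R.comul 1 = ∑ _i : Fin 1, R.rtmul 1 1 := by simpa using R.comul_one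
  have h2 := R.comul_bimod b 1 1 _ _ _ h1
  simp only [one_mul, map_one, mul_one] at h2
  simpa using R.comul_mul (R.t (op b)) v 1 n _ _ x y h2 h

/-- The map `x ⊗ y ↦ v' x ⊗ y` on `V_◂ ⊗_B ▸V`. -/
def mulFst (v' : V) : R.RightTensor →ₗ[k] R.RightTensor :=
  Bal.mapLeft (LinearMap.mulLeft k v') (fun b y => by simp [mul_assoc])

@[simp] theorem mulFst_tmul (v' x y : V) :
    R.mulFst v' (Bal.tmul R.bract R.blact x y) = Bal.tmul R.bract R.blact (v' * x) y :=
  Bal.mapLeft_tmul _ _ x y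

/-- The Hopf-Galois map `▸V ⊗_{Bᵒᵖ} V_◁ → V_◂ ⊗_B ▸V`, `v' ⊗ v ↦ v' v⁽¹⁾ ⊗ v⁽²⁾`. -/
def galois : R.OpTensor →ₗ[k] R.RightTensor :=
  Bal.lift
    (LinearMap.mk₂ k (fun v' v => R.mulFst v' (R.comul v))
      (fun _ _ v => by
        obtain ⟨n, x, y, h⟩ := Bal.exists_rep (R.comul v)
        simp [h, add_mul, Finset.sum_add_distrib])
      (fun _ _ v => by
        obtain ⟨n, x, y, h⟩ := Bal.exists_rep (R.comul v)
        simp [h, Finset.smul_sum])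
      (fun _ _ _ => by simp) (fun _ _ _ => by simp))
    (fun b v' v => by
      obtain ⟨n, x, y, h⟩ := Bal.exists_rep (R.comul v)
      simp [R.comul_t_mul b h, AeRing.rtmul, h, mul_assoc])

/-- A right bialgebroid is a right Hopf algebroid if its Hopf-Galois map is bijective. -/
def IsHopf : Prop := Function.Bijective R.galois

/-- `IterComul R n v L` says that `v⁽¹⁾ ⊗ ⋯ ⊗ v⁽ⁿ⁺¹⁾` is the sum of the elementary tensors given by
the entries of the list `L`, as obtained by writing out iterated coproducts: `v⁽¹⁾` for `n = 0`,
and `Δⁿ(v⁽¹⁾) ⊗ v⁽²⁾` for `Δⁿ⁺¹(v)`. -/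
inductive IterComul : (n : ℕ) → V → List (Fin (n + 1) → V) → Prop
  | zero (v : V) : IterComul 0 v [fun _ => v]
  | succ {n m : ℕ} (v : V) (x y : Fin m → V) (L : Fin m → List (Fin (n + 1) → V))
      (h : R.comul v = ∑ i, R.rtmul (x i) (y i)) (hL : ∀ i, IterComul n (x i) (L i)) :
      IterComul (n + 1) v
        (List.ofFn fun i => (L i).map fun w => (Fin.snoc w (y i) : Fin (n + 2) → V)).flatten

end RightBialgebroid

/-- The right action of `b` on a right `B`-module `M`, as a `k`-linear map. -/
def rsmul (k : Type*) {B M : Type*} [CommRing k] [Ring B] [Algebra k B] [AddCommGroup M]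
    [Module k M] [Module Bᵐᵒᵖ M] [IsScalarTower k Bᵐᵒᵖ M] (b : B) : M →ₗ[k] M where
  toFun m := op b • m
  map_add' := smul_add _
  map_smul' c m := by
    have : SMulCommClass k Bᵐᵒᵖ M := IsScalarTower.to_smulCommClass
    exact smul_comm _ _ _

@[simp] theorem rsmul_apply (k : Type*) {B M : Type*} [CommRing k] [Ring B] [Algebra k B]
    [AddCommGroup M] [Module k M] [Module Bᵐᵒᵖ M] [IsScalarTower k Bᵐᵒᵖ M] (b : B) (m : M) :
    rsmul k b m = op b • m := rfl

section Coefficients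

variable {k B V : Type*} [CommRing k] [Ring B] [Algebra k B] [Ring V] [Algebra k V]
  (R : RightBialgebroid k B V) (M : Type*) [AddCommGroup M] [Module k M] [Module Bᵐᵒᵖ M]
  [IsScalarTower k Bᵐᵒᵖ M]

/-- A right comodule structure over a right bialgebroid `V` on a right `B`-module `M`: a coaction
`M → M ⊗_B ▸V`, `m ↦ m⁽⁰⁾ ⊗ m⁽¹⁾` of the `B`-coring `V`. -/
structure RightComodule where
  coact : M →ₗ[k] Bal (rsmul k (B := B) (M := M)) R.blact
  /-- right `B`-linearity -/
  coact_smul : ∀ (b : B) (m : M) (n : ℕ) (x : Fin n → M) (y : Fin n → V),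
    coact m = ∑ i, Bal.tmul _ _ (x i) (y i) →
    coact (op b • m) = ∑ i, Bal.tmul _ _ (x i) (y i * R.s b)
  /-- coassociativity, in `M ⊗_B V ⊗_B V` -/
  coassoc : ∀ (m : M) (n : ℕ) (x : Fin n → M) (y : Fin n → V),
    coact m = ∑ i, Bal.tmul _ _ (x i) (y i) →
    ∑ i, Bal3.snoc _ _ _ R.comm_blact (y i) (coact (x i)) =
      ∑ i, Bal3.cons _ _ _ R.comm_blact (x i) (R.comul (y i))
  /-- `m⁽⁰⁾ ∂(m⁽¹⁾) = m` -/
  counit : ∀ (m : M) (n : ℕ) (x : Fin n → M) (y : Fin n → V),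
    coact m = ∑ i, Bal.tmul _ _ (x i) (y i) → ∑ i, op (R.counit (y i)) • x i = m

variable {R M}

/-- The map `m ↦ m⁽⁰⁾ g(m⁽¹⁾)` for a left `B`-linear `g : ▸V → B`. -/
def RightComodule.contract (ρ : RightComodule R M) (g : V →ₗ[k] B)
    (hg : ∀ b v, g (v * R.t (op b)) = b * g v) : M →ₗ[k] M :=
  (Bal.lift (LinearMap.mk₂ k (fun (x : M) (y : V) => op (g y) • x)
      (fun _ _ _ => by simp) (fun c x y => (rsmul k (g y)).map_smul c x)
      (fun _ _ _ => by simp [add_smul]) (fun _ _ _ => by simp))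
    (fun b x y => by
      change op (g y) • op b • x = op (g (y * R.t (op b))) • x
      rw [hg, op_mul, mul_smul])).comp ρ.coact

/-- The left `B`-action `b m = m⁽⁰⁾ ∂(b ▷ m⁽¹⁾)` on a right comodule. -/
def RightComodule.lsmul (ρ : RightComodule R M) (b : B) : M →ₗ[k] M :=
  ρ.contract (R.counit.comp (R.lact b)) (fun c v => by
    have := R.counit_bimod c 1 (R.s b * v)
    simpa [mul_assoc] using this)

variable (R M) in
/-- `C_coⁿ(V, M) = M ⊗_B V ⊗_B ⋯ ⊗_B V` with `n` factors `V`. -/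
abbrev CoCochain (n : ℕ) := Tower (rsmul k (B := B) (M := M)) R.blact R.bract n

variable (R M) in
/-- The elementary tensor `m ⊗ v₁ ⊗ ⋯ ⊗ vₙ` in `C_coⁿ(V, M)`. -/
abbrev coTmul {n : ℕ} (m : M) (v : Fin n → V) : CoCochain R M n :=
  Tower.tmul (rsmul k (B := B) (M := M)) R.blact R.bract m v

/-- The linear maps `δ'`, `σ'`, `τ'` are the cofaces, the codegeneracies and the cyclic operator of
`C_co(V, M)`, for a left `V`-module and right `V`-comodule `M`. The formulas are required for every
way of writing the tensors that occur in them as finite sums of elementary ones, so they determine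
the maps. Tuples are indexed from `0`, that is, `v i` is `vᵢ₊₁`. -/
structure IsCoOperators [Module V M] (ρ : RightComodule R M)
    (δ' : ∀ n, Fin (n + 2) → CoCochain R M n →ₗ[k] CoCochain R M (n + 1))
    (σ' : ∀ n, Fin (n + 1) → CoCochain R M (n + 1) →ₗ[k] CoCochain R M n)
    (τ' : ∀ n, CoCochain R M n →ₗ[k] CoCochain R M n) : Prop where
  /-- `δ'₀(m ⊗ v₁ ⊗ ⋯ ⊗ vₙ) = m ⊗ v₁ ⊗ ⋯ ⊗ vₙ ⊗ 1` -/
  coface_zero : ∀ (n : ℕ) (m : M) (v : Fin n → V),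
    δ' n 0 (coTmul R M m v) = coTmul R M m (Fin.snoc v 1 : Fin (n + 1) → V)
  /-- `δ'ᵢ₊₁(m ⊗ v₁ ⊗ ⋯ ⊗ vₙ) = m ⊗ v₁ ⊗ ⋯ ⊗ Δ(vₙ₋ᵢ) ⊗ ⋯ ⊗ vₙ` for `0 ≤ i < n` -/
  coface_mid : ∀ (n : ℕ) (i : Fin n) (m : M) (v : Fin n → V) (N : ℕ) (x y : Fin N → V),
    R.comul (v i.rev) = ∑ j, R.rtmul (x j) (y j) →
    δ' n i.succ.castSucc (coTmul R M m v) = ∑ j, coTmul R M m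
      (Fin.insertNth (α := fun _ => V) i.rev.castSucc (x j) (Function.update v i.rev (y j)))
  /-- `δ'ₙ₊₁(m ⊗ v₁ ⊗ ⋯ ⊗ vₙ) = m⁽⁰⁾ ⊗ m⁽¹⁾ ⊗ v₁ ⊗ ⋯ ⊗ vₙ` -/
  coface_last : ∀ (n : ℕ) (m : M) (v : Fin n → V) (N : ℕ) (x : Fin N → M) (y : Fin N → V),
    ρ.coact m = ∑ j, Bal.tmul _ _ (x j) (y j) →
    δ' n (Fin.last (n + 1)) (coTmul R M m v) =
      ∑ j, coTmul R M (x j) (Fin.cons (y j) v : Fin (n + 1) → V)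
  /-- `σ'ₙ(m ⊗ v₁ ⊗ ⋯ ⊗ vₙ₊₁) = m ∂(v₁) ⊗ v₂ ⊗ ⋯ ⊗ vₙ₊₁` -/
  codegeneracy_last : ∀ (n : ℕ) (m : M) (v : Fin (n + 1) → V),
    σ' n (Fin.last n) (coTmul R M m v) = coTmul R M (op (R.counit (v 0)) • m) (Fin.tail v)
  /-- `σ'ⱼ(m ⊗ v₁ ⊗ ⋯ ⊗ vₙ₊₁) = m ⊗ v₁ ⊗ ⋯ ⊗ vₙ₋ⱼ ◂ ∂(vₙ₊₁₋ⱼ) ⊗ ⋯ ⊗ vₙ₊₁` for `0 ≤ j < n`, where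
  `q = n - 1 - j`, so that `∂` is applied to the entry with index `q + 1` -/
  codegeneracy : ∀ (n : ℕ) (q : Fin n) (m : M) (v : Fin (n + 1) → V),
    σ' n q.succ.rev (coTmul R M m v) = coTmul R M m
      (Fin.removeNth q.succ
        (Function.update v q.castSucc (v q.castSucc * R.s (R.counit (v q.succ)))))
  /-- In degree zero, `τ'(m) = m⁽¹⁾ m⁽⁰⁾`. -/
  cyclic_zero : ∀ (m : M) (v : Fin 0 → V) (N : ℕ) (x : Fin N → M) (y : Fin N → V),
    ρ.coact m = ∑ j, Bal.tmul _ _ (x j) (y j) →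
    τ' 0 (coTmul R M m v) = coTmul R M (∑ j, y j • x j) v
  /-- With `n + 1` in place of `n`: `τ'(m ⊗ v₁ ⊗ ⋯ ⊗ vₙ) =
  vₙ⁺ m⁽⁰⁾ ⊗ m⁽¹⁾ vₙ⁻⁽¹⁾ ⊗ v₁ vₙ⁻⁽²⁾ ⊗ ⋯ ⊗ vₙ₋₁ vₙ⁻⁽ⁿ⁾`, where `v⁻ ⊗ v⁺` is the preimage of `1 ⊗ v`
  under the Hopf-Galois map. -/
  cyclic_succ : ∀ (n : ℕ) (m : M) (v : Fin (n + 1) → V)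
    (N : ℕ) (x : Fin N → M) (y : Fin N → V)
    (K : ℕ) (p q : Fin K → V) (L : Fin K → List (Fin (n + 1) → V)),
    ρ.coact m = ∑ i, Bal.tmul _ _ (x i) (y i) →
    R.galois (∑ j, R.otmul (p j) (q j)) = R.rtmul 1 (v (Fin.last n)) →
    (∀ j, R.IterComul n (p j) (L j)) →
    τ' (n + 1) (coTmul R M m v) = ∑ i, ∑ j, ((L j).map fun w =>
      coTmul R M (q j • x i) ((Fin.cons (y i) (Fin.init v) : Fin (n + 1) → V) * w)).sum

end Coefficients

section Cochains

variable {k A U : Type*} [CommRing k] [Ring A] [Algebra k A] [Ring U] [Algebra k U]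
  (H : LeftBialgebroid k A U) (M : Type*) [AddCommGroup M] [Module k M] [Module Aᵐᵒᵖ M]
  [IsScalarTower k Aᵐᵒᵖ M]

/-- `Cⁿ(U, M) = Hom_{Aᵒᵖ}(U^{⊗_{Aᵒᵖ} n}, M)`, where the tensor product is formed with respect to
`▸U_◁`: the `k`-multilinear maps `f` in `n` arguments from `U` with
`f(…, a ▸ uⁱ, uⁱ⁺¹, …) = f(…, uⁱ, uⁱ⁺¹ ◁ a, …)` and `f(u¹ ◁ a, u², …) = f(u¹, u², …) a`.
For `n = 0` these are the elements of `M`. -/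
def Cochain (n : ℕ) : Submodule k (MultilinearMap k (fun _ : Fin n => U) M) where
  carrier := {f |
    (∀ (h : 0 < n) (a : A) (u : Fin n → U),
      f (Function.update u ⟨0, h⟩ (H.t (op a) * u ⟨0, h⟩)) = op a • f u) ∧
    (∀ (i : ℕ) (h : i + 1 < n) (a : A) (u : Fin n → U),
      f (Function.update u ⟨i, by omega⟩ (u ⟨i, by omega⟩ * H.t (op a))) =
        f (Function.update u ⟨i + 1, h⟩ (H.t (op a) * u ⟨i + 1, h⟩)))}
  zero_mem' := by simp
  add_mem' := by
    rintro f g ⟨hf, hf'⟩ ⟨hg, hg'⟩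
    exact ⟨fun h a u => by simp [hf h a u, hg h a u], fun i h a u => by simp [hf' i h, hg' i h]⟩
  smul_mem' := by
    rintro c f ⟨hf, hf'⟩
    have : SMulCommClass k Aᵐᵒᵖ M := IsScalarTower.to_smulCommClass
    exact ⟨fun h a u => by simp [hf h a u, smul_comm c (op a)],
      fun i h a u => by simp [hf' i h]⟩

variable {M}

/-- The element `m⟨φ, -⟩ : u ↦ m ⟨φ, u⟩` of `Hom_{Aᵒᵖ}(U_◁, M)`. -/
def dyad (m : M) (φ : RightDual H) : RHom H.toAeRing M where
  val :=
    { toFun := fun u => op (H.pair φ u) • m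
      map_add' := fun _ _ => by simp [add_smul]
      map_smul' := fun _ _ => by simp }
  property a u := by simp [H.pair_ract, mul_smul]

/-- A right contramodule structure over a left bialgebroid `U` on a right `A`-module `M`: a
contraaction `γ : Hom_{Aᵒᵖ}(U_◁, M) → M`. -/
structure IsContraaction (γ : RHom H.toAeRing M →ₗ[k] M) : Prop where
  /-- `γ(f(a ▷ -)) = γ(f) a` -/
  smul : ∀ (a : A) (f g : RHom H.toAeRing M), (∀ u, g.1 u = f.1 (H.s a * u)) →
    γ g = op a • γ f
  /-- `γ(u ↦ γ(v ↦ g(u ⊗ v))) = γ(u ↦ g(u₍₁₎ ⊗ u₍₂₎))` for `g` in `Hom_{Aᵒᵖ}(U_◁ ⊗_A ▷U, M)`; the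
  three functions of which `γ` is taken here lie in `Hom_{Aᵒᵖ}(U_◁, M)` by right linearity of `g`
  and `γ`. -/
  coassoc : ∀ (g : H.LeftTensor →ₗ[k] M),
    (∀ (a : A) (u v : U), g (H.ltmul u (H.t (op a) * v)) = op a • g (H.ltmul u v)) →
    ∀ (inner : U → RHom H.toAeRing M) (outer diag : RHom H.toAeRing M),
    (∀ u v, (inner u).1 v = g (H.ltmul u v)) → (∀ u, outer.1 u = γ (inner u)) →
    (∀ u, diag.1 u = g (H.comul u)) → γ outer = γ diag
  /-- `γ(m ε(-)) = m` -/
  counit : ∀ m : M, γ (dyad H m 1) = m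

/-- The linear maps `δ`, `σ`, `τ` are the cofaces, the codegeneracies and the cyclic operator of
`C(U, M)`, for a left `U`-action `act` and a right contraaction `γ` on `M`. The translation map
`u₊ ⊗ u₋` is the preimage of `u ⊗ 1` under the Hopf-Galois map. Tuples are indexed from `0`, that
is, `u i` is `uⁱ⁺¹`. -/
structure IsOperators (act : U →ₐ[k] Module.End k M) (γ : RHom H.toAeRing M →ₗ[k] M)
    (δ : ∀ n, Fin (n + 2) → Cochain H M n →ₗ[k] Cochain H M (n + 1))
    (σ : ∀ n, Fin (n + 1) → Cochain H M (n + 1) →ₗ[k] Cochain H M n)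
    (τ : ∀ n, Cochain H M n →ₗ[k] Cochain H M n) : Prop where
  /-- `(δ₀ m)(u) = m ε(u)` in degree zero -/
  coface_zero_zero : ∀ (f : Cochain H M 0) (u : Fin 1 → U),
    (δ 0 0 f).1 u = op (H.counit (u 0)) • f.1 (Fin.tail u)
  /-- `(δ₀ f)(u¹, …, uⁿ⁺¹) = f(u¹, …, ε(uⁿ⁺¹) ▸ uⁿ)` for `n ≥ 1` -/
  coface_zero_succ : ∀ (n : ℕ) (f : Cochain H M (n + 1)) (u : Fin (n + 2) → U),
    (δ (n + 1) 0 f).1 u = f.1 (Function.update (Fin.init u) (Fin.last n)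
      (u (Fin.last n).castSucc * H.t (op (H.counit (u (Fin.last (n + 1)))))))
  /-- `(δᵢ₊₁ f)(u¹, …, uⁿ⁺¹) = f(u¹, …, uⁿ⁻ⁱ uⁿ⁻ⁱ⁺¹, …, uⁿ⁺¹)` for `0 ≤ i < n` -/
  coface_mid : ∀ (n : ℕ) (i : Fin n) (f : Cochain H M n) (u : Fin (n + 1) → U),
    (δ n i.succ.castSucc f).1 u = f.1 (Fin.contractNth i.rev.castSucc (· * ·) u)
  /-- `(δₙ₊₁ f)(u¹, …, uⁿ⁺¹) = u¹ f(u², …, uⁿ⁺¹)` -/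
  coface_last : ∀ (n : ℕ) (f : Cochain H M n) (u : Fin (n + 1) → U),
    (δ n (Fin.last (n + 1)) f).1 u = act (u 0) (f.1 (Fin.tail u))
  /-- `(σⱼ f)(u¹, …, uⁿ) = f(u¹, …, uⁿ⁻ʲ, 1, uⁿ⁻ʲ⁺¹, …, uⁿ)` for `f` of degree `n + 1` -/
  codegeneracy : ∀ (n : ℕ) (j : Fin (n + 1)) (f : Cochain H M (n + 1)) (u : Fin n → U),
    (σ n j f).1 u = f.1 (Fin.insertNth (α := fun _ => U) j.rev 1 u)
  /-- In degree zero, `τ(m) = γ((-)m)`. -/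
  cyclic_zero : ∀ (f : Cochain H M 0) (u : Fin 0 → U), ∃ g : RHom H.toAeRing M,
    (∀ w, g.1 w = act w (f.1 u)) ∧ (τ 0 f).1 u = γ g
  /-- With `n + 1` in place of `n`:
  `(τ f)(u¹, …, uⁿ) = γ(w ↦ u¹₊ f(u²₊, …, uⁿ₊, uⁿ₋ ⋯ u¹₋ w))`. -/
  cyclic_succ : ∀ (n : ℕ) (f : Cochain H M (n + 1)) (u : Fin (n + 1) → U)
    (N : Fin (n + 1) → ℕ) (p q : ∀ i, Fin (N i) → U),
    (∀ i, H.galois (∑ j, H.otmul (p i j) (q i j)) = H.ltmul (u i) 1) →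
    ∃ g : RHom H.toAeRing M,
      (∀ w, g.1 w = ∑ J : (∀ i, Fin (N i)),
        act (p 0 (J 0)) (f.1 (Fin.snoc (fun i : Fin n => p i.succ (J i.succ))
          ((List.ofFn fun i => q i (J i)).reverse.prod * w) : Fin (n + 1) → U))) ∧
      (τ (n + 1) f).1 u = γ g

/-- The iterated pairing `⟨φ₁, ⟨φ₂, ⟨… ⟨φₙ, uⁿ⟩ ▸ …⟩ ▸ u²⟩ ▸ u¹⟩`, which is `1` for `n = 0`. -/
def nestedPair : ∀ {n : ℕ}, (Fin n → RightDual H) → (Fin n → U) → A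
  | 0, _, _ => 1
  | _ + 1, φ, u =>
    H.pair (φ 0) (u 0 * H.t (op (nestedPair (Fin.tail φ) (Fin.tail u))))

/-- The map `m ↦ m⁽⁰⁾ ⟨m⁽¹⁾, u⟩` on a right `U^*`-comodule. -/
noncomputable def comoduleAct {H : LeftBialgebroid k A U} {hU : H.FinProj}
    (ρ : RightComodule (H.dual hU) M) (u : U) : M →ₗ[k] M :=
  ρ.contract (H.pair.flip u) (fun b φ => H.mul_dualT b φ u)

end Cochains

end HopfAlgd

/-! Everything rests on the operators `harp φ u` = ⟨φ, u₍₁₎⟩ ▷ u₍₂₎ on `U`. By `pair_mul_eq_harp`,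
`harp φ` is the transpose of left multiplication by φ on `U^*`. It commutes with left and right
multiplication by `t(a)`, satisfies `ε(harp φ u) = ⟨φ, u⟩`, and is multiplicative along the dual
coproduct: ∑ `harp φ⁽¹⁾ u * harp φ⁽²⁾ v = harp φ (u * v)` (`harp_mul`). Hence the nested pairing
that defines ξ is ε of the plain product ∏ `harp φᵢ uⁱ` (`nestedPair_eq`). Statements about ξ
thereby become statements about products in `U`: a coproduct in one tensor factor multiplies two
adjacent arguments, and inserting 1 produces `harp φ 1 = s⟨φ, 1⟩`, which is absorbed by a neighbour.

A finite dual basis (eᵢ, eⁱ) of `U_◁` supplies the inverses. Any balanced map is determined by its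
values on generators, with nested pairings as coefficients (`balanced_expansion_coef`), so f ↦ ∑
f(e_J) ⊗ e^J inverts ξ. The contraaction is γ(f) = ∑ eⁱ f(eᵢ). Its axioms follow because the
functions m⟨φ, -⟩ span `Hom_{Aᵒᵖ}(U_◁, M)` and γ sends m⟨φ, -⟩ to φm.

The Hopf-Galois map of `U^*` is the transpose of that of `U` (`opPair_galois`) under two pairings
that the dual basis shows to be nondegenerate. Bijectivity therefore passes to the dual.

For the cyclic operator take f = ξ(m ⊗ φ₁ ⊗ ⋯ ⊗ φₙ). The function under γ is m⁽⁰⁾ times a value of 1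
⊗ φₙ at a tensor built from the uⁱ₊ and uⁱ₋. Transposition replaces 1 ⊗ φₙ by φₙ⁻ ⊗ φₙ⁺ and applies
the Galois map of `U`, which by `galois_translation` cancels all translation elements at once. What
is left, as a function of w, is ⟨φₙ⁺, ⟨φₙ⁻, P⟩ ▷ w⟩ with P = `harp m⁽¹⁾ u¹ * harp φ₁ u² * ⋯ * harp
φₙ₋₁ uⁿ`. Applying γ yields φₙ⁺m⁽⁰⁾⟨φₙ⁻, P⟩, and `sum_iterComul` distributes φₙ⁻ over the factors of
P, which is ξ of the formula for τ'.

Well-definedness is obtained by transport. The formulas on `C(U, M)` are functions of f, and on the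
spanning elements ξ(m ⊗ φ) they are seen to be cochains. The operators on `C_co(U^*, M)` are then
defined by conjugation with ξ, so nothing has to be checked on the quotient of the tensor product.
-/

namespace HopfAlgd

/-! ### The right action of the dual on `U`. -/

namespace LeftBialgebroid

variable {k A U : Type*} [CommRing k] [Ring A] [Algebra k A] [Ring U] [Algebra k U]
  (H : LeftBialgebroid k A U)

/-- The map `x ⊗ y ↦ ⟨φ, x⟩ ▷ y`. -/
def contractLeft (φ : RightDual H) : H.LeftTensor →ₗ[k] U :=
  Bal.lift ((LinearMap.mul k U).comp (H.s.toLinearMap.comp (H.pair φ)))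
    (fun b x y => by simp [pair_ract, mul_assoc])

@[simp] theorem contractLeft_tmul (φ : RightDual H) (x y : U) :
    H.contractLeft φ (Bal.tmul H.ract H.lact x y) = H.s (H.pair φ x) * y := by
  simp [contractLeft]

/-- The right action `φ ↦ (u ↦ ⟨φ, u₍₁₎⟩ ▷ u₍₂₎)` of `U^*` on `U`. -/
def harp : RightDual H →ₗ[k] U →ₗ[k] U :=
  LinearMap.mk₂ k (fun φ u => H.contractLeft φ (H.comul u))
    (fun φ ψ u => by
      obtain ⟨n, x, y, h⟩ := H.exists_rep u
      simp [h, add_mul, Finset.sum_add_distrib])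
    (fun c φ u => by
      obtain ⟨n, x, y, h⟩ := H.exists_rep u
      simp [h, Finset.smul_sum])
    (fun _ _ _ => by simp) (fun _ _ _ => by simp)

theorem harp_apply (φ : RightDual H) (u : U) :
    H.harp φ u = H.contractLeft φ (H.comul u) := rfl

theorem harp_rep (φ : RightDual H) {u : U} {n : ℕ} {x y : Fin n → U}
    (h : H.comul u = ∑ i, H.ltmul (x i) (y i)) :
    H.harp φ u = ∑ i, H.s (H.pair φ (x i)) * y i := by
  simp [harp_apply, h]

/-- The defining property of `harp`: it moves left multiplication on `U^*` to the other side of the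
pairing. -/
theorem pair_mul_eq_harp (φ ψ : RightDual H) (u : U) :
    H.pair (φ * ψ) u = H.pair ψ (H.harp φ u) := by
  obtain ⟨n, x, y, h⟩ := H.exists_rep u
  rw [H.pair_mul_rep _ _ h, H.harp_rep _ h, map_sum]

theorem harp_t_mul (φ : RightDual H) (a : A) (u : U) :
    H.harp φ (H.t (op a) * u) = H.t (op a) * H.harp φ u := by
  obtain ⟨n, x, y, h⟩ := H.exists_rep u
  rw [H.harp_rep _ h, H.harp_rep _ (H.comul_t a h), Finset.mul_sum]
  refine Finset.sum_congr rfl fun i _ => ?_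
  rw [← mul_assoc, H.comm, mul_assoc]

theorem harp_mul_t (φ : RightDual H) (a : A) (u : U) :
    H.harp φ (u * H.t (op a)) = H.harp φ u * H.t (op a) := by
  obtain ⟨n, x, y, h⟩ := H.exists_rep u
  rw [H.harp_rep _ h, H.harp_rep _ (H.comul_mul_t a h), Finset.sum_mul]
  simp [mul_assoc]

/-- This is the Takeuchi condition contracted with φ: `s^r(a)` puts `t(a)` to the right of u₍₁₎,
which may be traded for `s(a)` to the right of u₍₂₎. -/
theorem harp_mul_dualS (φ : RightDual H) (a : A) (u : U) :
    H.harp (φ * H.dualS a) u = H.harp φ u * H.s a := by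
  obtain ⟨n, x, y, h⟩ := H.exists_rep u
  have := congrArg (H.contractLeft φ) (H.takeuchi a u _ _ _ h)
  simp only [map_sum, contractLeft_tmul, AeRing.ltmul] at this
  rw [H.harp_rep _ h, H.harp_rep _ h, Finset.sum_mul]
  simpa [mul_dualS, mul_assoc] using this

theorem harp_mul_dualT (φ : RightDual H) (a : A) (u : U) :
    H.harp (φ * H.dualT a) u = H.s a * H.harp φ u := by
  obtain ⟨n, x, y, h⟩ := H.exists_rep u
  rw [H.harp_rep _ h, H.harp_rep _ h, Finset.mul_sum]
  simp [mul_dualT, mul_assoc]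

@[simp] theorem harp_one (u : U) : H.harp 1 u = u := by
  obtain ⟨n, x, y, h⟩ := H.exists_rep u
  rw [H.harp_rep _ h]
  exact H.counit_left u n x y h

theorem comul_one_rep : H.comul 1 = ∑ _i : Fin 1, H.ltmul 1 1 := by simpa using H.comul_one

theorem harp_apply_one (φ : RightDual H) : H.harp φ 1 = H.s (H.pair φ 1) := by
  simp [H.harp_rep _ H.comul_one_rep]

-- The counit ε is the unit of `U^*`, so this is φ1 = φ. It recovers the pairing from `harp`.
@[simp] theorem counit_harp (φ : RightDual H) (u : U) : H.counit (H.harp φ u) = H.pair φ u := by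
  rw [← H.pair_one, ← pair_mul_eq_harp, mul_one]

/-- The map `x ⊗ y ↦ (φ ⇀ x) ⊗ y`. -/
def harpFst (φ : RightDual H) : H.LeftTensor →ₗ[k] H.LeftTensor :=
  Bal.mapLeft (H.harp φ) (fun a u => H.harp_t_mul φ a u)

@[simp] theorem harpFst_tmul (φ : RightDual H) (x y : U) :
    H.harpFst φ (Bal.tmul H.ract H.lact x y) = Bal.tmul H.ract H.lact (H.harp φ x) y :=
  Bal.mapLeft_tmul _ _ x y

/-- The coproduct is linear for the right action `harp`:
`Δ(⟨φ, u₍₁₎⟩ ▷ u₍₂₎) = (⟨φ, u₍₁₎⟩ ▷ u₍₂₎) ⊗ u₍₃₎`. -/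
theorem comul_harp (φ : RightDual H) (u : U) :
    H.comul (H.harp φ u) = H.harpFst φ (H.comul u) := by
  obtain ⟨n, x, y, h⟩ := H.exists_rep u
  -- Contracting the first leg of the triple tensor product with φ turns the two sides of
  -- coassociativity into the two sides of the claim.
  let G : Bal3 H.ract H.lact H.ract H.comm_lact →ₗ[k] H.LeftTensor :=
    Bal.lift ((Bal.tmul H.ract H.lact).comp (H.contractLeft φ)) (by
      intro b z w
      obtain ⟨m, p, q, rfl⟩ := Bal.exists_rep z
      simp only [map_sum, LinearMap.sum_apply, Bal.mapRight_tmul]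
      refine Finset.sum_congr rfl fun i _ => ?_
      simp only [LinearMap.comp_apply, contractLeft_tmul]
      rw [← Bal.tmul_bal]
      simp only [AeRing.ract_apply]
      rw [← mul_assoc, H.comm, mul_assoc])
  have hG := congrArg G (H.coassoc u n x y h)
  simp only [map_sum] at hG
  have h1 : ∀ i, G (Bal3.snoc _ _ _ H.comm_lact (y i) (H.comul (x i))) =
      Bal.tmul H.ract H.lact (H.harp φ (x i)) (y i) := by
    intro i
    simp [G, Bal3.snoc, harp_apply]
  have h2 : ∀ i, G (Bal3.cons _ _ _ H.comm_lact (x i) (H.comul (y i))) =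
      H.comul (H.s (H.pair φ (x i)) * y i) := by
    intro i
    obtain ⟨m, p, q, h'⟩ := H.exists_rep (y i)
    rw [H.comul_s _ h', h']
    simp [G, Bal3.cons]
  simp only [h1, h2] at hG
  rw [H.harp_rep _ h, map_sum, ← hG, h]
  simp [AeRing.ltmul]

/-- `⟨φ⁽¹⁾, u₍₁₎⟩ ▷ u₍₂₎ · ⟨φ⁽²⁾, v₍₁₎⟩ ▷ v₍₂₎ = ⟨φ, u₍₁₎v₍₁₎⟩ ▷ u₍₂₎v₍₂₎` -/
theorem harp_mul {hU : H.FinProj} {φ : RightDual H} {n : ℕ} {x y : Fin n → RightDual H}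
    (h : (H.dual hU).comul φ = ∑ i, (H.dual hU).rtmul (x i) (y i)) (u v : U) :
    ∑ i, H.harp (x i) u * H.harp (y i) v = H.harp φ (u * v) := by
  obtain ⟨nu, p, q, hu⟩ := H.exists_rep u
  obtain ⟨nv, p', q', hv⟩ := H.exists_rep v
  have h' : hU.basis.comul φ = ∑ i, H.dualAeRing.rtmul (x i) (y i) := h
  -- The double sum for Δ(uv) is reindexed by a single `Fin (nu * nv)`, the form that `harp_rep`
  -- accepts.
  rw [H.harp_rep _ (n := nu * nv) (x := fun c => p (finProdFinEquiv.symm c).1 *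
      p' (finProdFinEquiv.symm c).2) (y := fun c => q (finProdFinEquiv.symm c).1 *
      q' (finProdFinEquiv.symm c).2) (by
    rw [H.comul_mul u v _ _ _ _ _ _ hu hv, finProdFinEquiv.symm.sum_comp
      (fun c : Fin nu × Fin nv => H.ltmul (p c.1 * p' c.2) (q c.1 * q' c.2)),
      Fintype.sum_prod_type])]
  rw [finProdFinEquiv.symm.sum_comp (fun c : Fin nu × Fin nv =>
    H.s (H.pair φ (p c.1 * p' c.2)) * (q c.1 * q' c.2)), Fintype.sum_prod_type]
  -- The scalar `s⟨φ⁽²⁾, v₍₁₎⟩` between the two factors is absorbed into φ⁽¹⁾ by `harp_mul_dualS`;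
  -- summing over i then gives ⟨φ, u₍₁₎v₍₁₎⟩ by duality of product and coproduct.
  have key : ∀ i, H.harp (x i) u * H.harp (y i) v =
      ∑ a, ∑ b, H.s (H.pair (x i) (p a * H.t (op (H.pair (y i) (p' b))))) * (q a * q' b) := by
    intro i
    rw [H.harp_rep (y i) hv, Finset.mul_sum, Finset.sum_comm]
    refine Finset.sum_congr rfl fun b _ => ?_
    rw [← mul_assoc, ← H.harp_mul_dualS, H.harp_rep _ hu, Finset.sum_mul]
    simp [mul_dualS, mul_assoc]
  simp only [key]
  rw [Finset.sum_comm]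
  refine Finset.sum_congr rfl fun a _ => ?_
  rw [Finset.sum_comm]
  refine Finset.sum_congr rfl fun b _ => ?_
  rw [← hU.basis.pair_rep h', map_sum, Finset.sum_mul]

/-! ### The Hopf-Galois map of the dual -/

/-- `⟨φ ⊗ ψ, u ⊗ v⟩ = ⟨φ, ⟨ψ, v⟩ ▸ u⟩`, as a functional on `▸U ⊗_{Aᵒᵖ} U_◁`. -/
def opPair (z : H.dualAeRing.RightTensor) : H.OpTensor →ₗ[k] A :=
  Bal.lift (LinearMap.mk₂ k (fun u v => H.pair2 u v z)
    (fun u u' v => by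
      obtain ⟨n, x, y, rfl⟩ := Bal.exists_rep z
      simp [add_mul, Finset.sum_add_distrib])
    (fun c u v => by
      obtain ⟨n, x, y, rfl⟩ := Bal.exists_rep z
      simp [Finset.smul_sum])
    (fun u v v' => by
      obtain ⟨n, x, y, rfl⟩ := Bal.exists_rep z
      simp [mul_add, Finset.sum_add_distrib])
    (fun c u v => by
      obtain ⟨n, x, y, rfl⟩ := Bal.exists_rep z
      simp [Finset.smul_sum]))
    (fun b u v => by
      obtain ⟨n, x, y, rfl⟩ := Bal.exists_rep z
      simp [pair_ract, mul_assoc])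

@[simp] theorem opPair_tmul (z : H.dualAeRing.RightTensor) (u v : U) :
    H.opPair z (Bal.tmul H.blact H.ract u v) = H.pair2 u v z := by
  simp [opPair]

theorem opPair_sum {n : ℕ} (z : Fin n → H.dualAeRing.RightTensor) (w : H.OpTensor) :
    H.opPair (∑ i, z i) w = ∑ i, H.opPair (z i) w := by
  obtain ⟨m, u, v, rfl⟩ := Bal.exists_rep w
  simp only [map_sum, opPair_tmul]
  rw [Finset.sum_comm]

/-- `⟨φ ⊗ ψ, u ⊗ v⟩ = ⟨ψ, ⟨φ, u⟩ ▷ v⟩`, as a pairing of `▸U^* ⊗_{Aᵒᵖ} U^*_◁` with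
`U_◁ ⊗_A ▷U`. -/
def convPairing : H.dualAeRing.OpTensor →ₗ[k] H.LeftTensor →ₗ[k] A :=
  Bal.lift (LinearMap.mk₂ k (fun φ ψ => H.convPair φ ψ)
    (fun _ _ _ => Bal.hom_ext fun _ _ => by simp [add_mul])
    (fun _ _ _ => Bal.hom_ext fun _ _ => by simp)
    (fun _ _ _ => Bal.hom_ext fun _ _ => by simp)
    (fun _ _ _ => Bal.hom_ext fun _ _ => by simp))
    (fun b φ ψ => Bal.hom_ext fun _ _ => by simp [mul_dualT, dualT_mul, mul_assoc])

@[simp] theorem convPairing_tmul (φ ψ : RightDual H) (x y : U) :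
    H.convPairing (Bal.tmul H.dualAeRing.blact H.dualAeRing.ract φ ψ)
      (Bal.tmul H.ract H.lact x y) = H.pair ψ (H.s (H.pair φ x) * y) := by
  simp [convPairing]

theorem galois_tmul (u v : U) :
    H.galois (Bal.tmul H.blact H.ract u v) = H.mulSnd v (H.comul u) := by
  simp [galois]

/-- The Hopf-Galois map of `U^*`, with its source and target expressed in terms of the underlying
`Aᵉ`-ring of `U^*`. -/
noncomputable def dualGalois (hU : H.FinProj) :
    H.dualAeRing.OpTensor →ₗ[k] H.dualAeRing.RightTensor := (H.dual hU).galois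

/-- The Hopf-Galois map of `U^*` is the transpose of the Hopf-Galois map of `U`. -/
theorem opPair_galois (hU : H.FinProj) (z : H.dualAeRing.OpTensor) (w : H.OpTensor) :
    H.opPair (H.dualGalois hU z) w = H.convPairing z (H.galois w) := by
  have key : ∀ φ ψ u v, H.opPair (H.dualGalois hU (Bal.tmul _ _ φ ψ)) (Bal.tmul _ _ u v) =
      H.convPairing (Bal.tmul _ _ φ ψ) (H.galois (Bal.tmul _ _ u v)) := by
    intro φ ψ u v
    obtain ⟨n, p, q, h⟩ := Bal.exists_rep ((H.dual hU).comul ψ)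
    obtain ⟨m, x, y, h'⟩ := H.exists_rep u
    have h1 : H.dualGalois hU (Bal.tmul _ _ φ ψ) =
        ∑ i, H.dualAeRing.rtmul (φ * p i) (q i) := by
      change (H.dual hU).galois (Bal.tmul _ _ φ ψ) = ∑ i, (H.dual hU).rtmul (φ * p i) (q i)
      rw [RightBialgebroid.galois, Bal.lift_tmul, LinearMap.mk₂_apply, h, map_sum]
      exact Finset.sum_congr rfl fun i _ => (H.dual hU).mulFst_tmul _ _ _
    rw [h1, galois_tmul, h']
    -- Both sides are equal to `⟨ψ, harp φ u * v⟩`.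
    simp only [opPair_tmul, map_sum, AeRing.rtmul, AeRing.ltmul, pair2_tmul, mulSnd_tmul,
      convPairing_tmul, pair_mul_eq_harp, harp_mul_t]
    rw [hU.basis.pair_rep h, H.harp_rep _ h', Finset.sum_mul, map_sum]
    simp [mul_assoc]
  obtain ⟨n, x, y, rfl⟩ := Bal.exists_rep z
  obtain ⟨m, u, v, rfl⟩ := Bal.exists_rep w
  simp only [map_sum, opPair_sum, LinearMap.sum_apply]
  exact Finset.sum_congr rfl fun i _ => Finset.sum_congr rfl fun j _ => key _ _ _ _

variable {H}

theorem DualBasis.opPair_injective (b : DualBasis H) : Function.Injective H.opPair :=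
  fun z w h => b.pair2_ext fun u v => by rw [← opPair_tmul, ← opPair_tmul, h]

/-- Expanding each first leg as ∑ eⁱ t^r⟨·, eᵢ⟩ and moving the scalar across the tensor sign leaves
second legs that are visible to the pairing alone. Nondegeneracy in this argument is immediate from
that. -/
theorem DualBasis.convPairing_recon (b : DualBasis H) (z : H.dualAeRing.OpTensor) :
    ∑ i, H.dualAeRing.otmul (b.f i) (H.mkDual ((H.convPairing z).comp
      (Bal.tmul H.ract H.lact (b.e i))) (fun a u => by
        obtain ⟨n, x, y, rfl⟩ := Bal.exists_rep z
        simp only [map_sum, LinearMap.comp_apply, LinearMap.sum_apply, convPairing_tmul,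
          Finset.sum_mul]
        refine Finset.sum_congr rfl fun j _ => ?_
        rw [← mul_assoc, H.comm, mul_assoc, pair_ract])) = z := by
  obtain ⟨n, x, y, rfl⟩ := Bal.exists_rep z
  have key : ∀ i, H.dualAeRing.otmul (b.f i) (H.mkDual ((H.convPairing
      (∑ j, Bal.tmul H.dualAeRing.blact H.dualAeRing.ract (x j) (y j))).comp
      (Bal.tmul H.ract H.lact (b.e i))) (fun a u => by
        simp only [map_sum, LinearMap.comp_apply, LinearMap.sum_apply, convPairing_tmul,
          Finset.sum_mul]
        refine Finset.sum_congr rfl fun j _ => ?_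
        rw [← mul_assoc, H.comm, mul_assoc, pair_ract])) =
      ∑ j, Bal.tmul H.dualAeRing.blact H.dualAeRing.ract
        (b.f i * H.dualT (H.pair (x j) (b.e i))) (y j) := by
    intro i
    have h1 : ∀ j, Bal.tmul H.dualAeRing.blact H.dualAeRing.ract
        (b.f i * H.dualT (H.pair (x j) (b.e i))) (y j) =
        Bal.tmul H.dualAeRing.blact H.dualAeRing.ract (b.f i)
          (H.dualT (H.pair (x j) (b.e i)) * y j) := fun j =>
      Bal.tmul_bal H.dualAeRing.blact H.dualAeRing.ract _ _ _
    simp only [h1, ← map_sum]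
    refine congrArg _ (H.dual_ext fun u => ?_)
    simp [dualT_mul]
  refine (Finset.sum_congr rfl fun i _ => key i).trans ?_
  rw [Finset.sum_comm]
  refine Finset.sum_congr rfl fun j _ => ?_
  conv_rhs => rw [← b.sum_pair (x j), map_sum, LinearMap.sum_apply]

theorem DualBasis.convPairing_injective (b : DualBasis H) :
    Function.Injective H.convPairing := fun z w h => by
  rw [← b.convPairing_recon z, ← b.convPairing_recon w]
  simp only [h]

/-- The reconstruction formula for a tensor, read with an arbitrary right linear functional in place
of the pairing, produces a preimage. -/
theorem DualBasis.convPairing_surjective (b : DualBasis H) (g : H.LeftTensor →ₗ[k] A)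
    (hg : ∀ a u v, g (H.ltmul u (H.t (op a) * v)) = g (H.ltmul u v) * a) :
    ∃ z, H.convPairing z = g := by
  refine ⟨∑ i, H.dualAeRing.otmul (b.f i) (H.mkDual (g.comp (Bal.tmul H.ract H.lact (b.e i)))
    (fun a v => by simpa using hg a (b.e i) v)), Bal.hom_ext fun u v => ?_⟩
  conv_rhs => rw [← b.sum_eq u]
  simp only [map_sum, LinearMap.sum_apply, AeRing.otmul, convPairing_tmul, pair_mkDual,
    LinearMap.comp_apply]
  refine Finset.sum_congr rfl fun i _ => ?_
  rw [← AeRing.lact_apply, ← Bal.tmul_bal, AeRing.ract_apply]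

theorem opPair_otmul_t (z : H.dualAeRing.RightTensor) (a : A) (u v : U) :
    H.opPair z (H.otmul (H.t (op a) * u) v) = H.opPair z (H.otmul u v) * a := by
  obtain ⟨n, x, y, rfl⟩ := Bal.exists_rep z
  simp [pair_ract, mul_assoc, Finset.sum_mul]

/-- The Galois map carries the action of `t(a)` on the first leg to the action on the second leg.
With `opPair_otmul_t`, this makes functionals pulled back along the inverse Galois map right linear.
-/
theorem galois_t_mul (a : A) (u v : U) :
    H.galois (H.otmul (H.t (op a) * u) v) =
      Bal.mapRight (LinearMap.mulLeft k (H.t (op a)))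
        (fun b y => by simp [← mul_assoc, H.comm]) (H.galois (H.otmul u v)) := by
  obtain ⟨n, x, y, h⟩ := H.exists_rep u
  simp [galois_tmul, h, H.comul_t a h, AeRing.ltmul, mul_assoc]

/-- The dual of a left Hopf algebroid that is finitely generated projective over `A` is a right
Hopf algebroid. -/
theorem IsHopf.dual (hH : H.IsHopf) (hU : H.FinProj) : (H.dual hU).IsHopf := by
  change Function.Bijective (H.dualGalois hU)
  -- Injectivity of the transpose comes from surjectivity for `U`. For surjectivity, the functional
  -- `opPair y` composed with the inverse Galois map of `U` is represented by some z, and z is the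
  -- preimage of y.
  refine ⟨fun z w h => hU.basis.convPairing_injective (LinearMap.ext fun y => ?_), fun y => ?_⟩
  · obtain ⟨y, rfl⟩ := hH.2 y
    rw [← H.opPair_galois hU, h, H.opPair_galois hU]
  · let e := LinearEquiv.ofBijective H.galois hH
    have he : ∀ w, e w = H.galois w := fun _ => rfl
    have ht : ∀ (a : A) z, e.symm (Bal.mapRight (LinearMap.mulLeft k (H.t (op a)))
        (fun b y => by simp [← mul_assoc, H.comm]) z) =
        Bal.mapLeft (LinearMap.mulLeft k (H.t (op a))) (fun b y => by simp [mul_assoc])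
          (e.symm z) := by
      intro a z
      obtain ⟨w, rfl⟩ := e.surjective z
      rw [e.symm_apply_apply, e.symm_apply_eq]
      obtain ⟨n, x, y, rfl⟩ := Bal.exists_rep w
      simp only [map_sum, he]
      exact Finset.sum_congr rfl fun i _ => (H.galois_t_mul a _ _).symm
    obtain ⟨z, hz⟩ := hU.basis.convPairing_surjective
      ((H.opPair y).comp e.symm.toLinearMap) (fun a u v => by
        have h1 : H.ltmul u (H.t (op a) * v) = Bal.mapRight (LinearMap.mulLeft k (H.t (op a)))
          (fun b y => by simp [← mul_assoc, H.comm]) (H.ltmul u v) := by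
            simp [AeRing.ltmul]
        rw [h1, LinearMap.comp_apply, LinearMap.comp_apply, LinearEquiv.coe_coe, ht]
        obtain ⟨n, p, q, hw⟩ := Bal.exists_rep (e.symm (H.ltmul u v))
        rw [hw]
        simp only [map_sum, Finset.sum_mul]
        exact Finset.sum_congr rfl fun i _ => H.opPair_otmul_t _ _ _ _)
    refine ⟨z, hU.basis.opPair_injective (LinearMap.ext fun w => ?_)⟩
    rw [opPair_galois, hz]
    simp [← he]

end LeftBialgebroid

/-! ### Products of tuples under contraction and adjustment of neighbouring entries. -/

section Products

theorem prod_ofFn_contractNth {R : Type*} [Monoid R] : ∀ {n : ℕ} (i : Fin n) (g : Fin (n + 1) → R),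
    (List.ofFn (Fin.contractNth i.castSucc (· * ·) g)).prod = (List.ofFn g).prod
  | n + 1, ⟨0, _⟩, g => by
    rw [List.ofFn_succ, List.ofFn_succ, List.ofFn_succ]
    simp only [List.prod_cons, ← mul_assoc]
    congr 1
  | n + 1, ⟨i + 1, h⟩, g => by
    have ih := prod_ofFn_contractNth ⟨i, by omega⟩ (fun j => g j.succ)
    rw [List.ofFn_succ, List.ofFn_succ (f := g), List.prod_cons, List.prod_cons, ← ih]
    congr 1
    · congr 2
      funext j
      simp [Fin.contractNth]

/-- Only the product of the entries i and i+1 matters. This is the form in which both balancing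
relations, for tensors and for cochains, are verified. -/
theorem prod_ofFn_update {R : Type*} [Monoid R] : ∀ {n : ℕ} (y : Fin n → R) (i : ℕ)
    (h : i + 1 < n) (a b : R), a * y ⟨i + 1, h⟩ = y ⟨i, by omega⟩ * b →
    (List.ofFn (Function.update y ⟨i, by omega⟩ a)).prod =
      (List.ofFn (Function.update y ⟨i + 1, h⟩ b)).prod
  | 0, y, i, h, a, b, hab => by omega
  | 1, y, i, h, a, b, hab => by omega
  | n + 2, y, 0, h, a, b, hab => by
    simp only [List.ofFn_succ, List.prod_cons, ← mul_assoc]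
    congr 1
  | n + 2, y, i + 1, h, a, b, hab => by
    have ih := prod_ofFn_update (fun j => y j.succ) i (by omega) a b hab
    have e : ∀ (j : ℕ) (hj : j + 1 < n + 2) (c : R),
        (fun l : Fin (n + 1) => Function.update y ⟨j + 1, hj⟩ c l.succ) =
          Function.update (fun l => y l.succ) ⟨j, by omega⟩ c := by
      intro j hj c
      have := Fin.tail_update_succ (q := y) (i := (⟨j, by omega⟩ : Fin (n + 1))) (y := c)
      exact this
    rw [List.ofFn_succ, List.ofFn_succ (f := Function.update y ⟨i + 1 + 1, h⟩ b),
      List.prod_cons, List.prod_cons, e, e, ih]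
    rfl

end Products

/-! ### Expansion of balanced multilinear maps in generators. -/

section Expansion

variable {k A W Z : Type*} [CommRing k] [AddCommGroup W] [Module k W] [AddCommGroup Z]
  [Module k Z]

/-- The coefficients in the expansion of a balanced multilinear map with respect to generators with
coordinate functions `c`. -/
def expansionCoef [One A] (r : A → W →ₗ[k] W) {N : ℕ} (c : Fin N → W → A) :
    ∀ {n : ℕ}, (Fin n → Fin N) → (Fin n → W) → A
  | 0, _, _ => 1
  | _ + 1, J, w => c (J 0) (r (expansionCoef r c (Fin.tail J) (Fin.tail w)) (w 0))

theorem sum_fin_cons {X : Type*} [AddCommMonoid X] {N n : ℕ} (F : (Fin (n + 1) → Fin N) → X) :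
    ∑ J, F J = ∑ J : Fin n → Fin N, ∑ i, F (Fin.cons i J) := by
  rw [← (Fin.consEquiv (fun _ : Fin (n + 1) => Fin N)).sum_comp, Fintype.sum_prod_type,
    Finset.sum_comm]
  rfl

/-- A multilinear map that is balanced with respect to right and left actions `r` and `l` is
determined by its values on generators. -/
theorem balanced_expansion [One A] (l r : A → W →ₗ[k] W) {N : ℕ} (g : Fin N → W)
    (c : Fin N → W → A) (hc : ∀ w, ∑ i, l (c i w) (g i) = w) (hr : ∀ w, r 1 w = w) :
    ∀ {n : ℕ} (T : MultilinearMap k (fun _ : Fin (n + 1) => W) Z)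
    (_ : ∀ (i : ℕ) (h : i + 1 < n + 1) (b : A) (w : Fin (n + 1) → W),
      T (Function.update w ⟨i, by omega⟩ (r b (w ⟨i, by omega⟩))) =
        T (Function.update w ⟨i + 1, h⟩ (l b (w ⟨i + 1, h⟩)))) (w : Fin (n + 1) → W),
    T w = ∑ J : Fin n → Fin N,
      T (Fin.cons (r (expansionCoef r c J (Fin.tail w)) (w 0)) (fun i => g (J i)))
  | 0, T, hT, w => by
    -- The empty coefficient is 1, which is why `hr` is required.
    simp only [expansionCoef, hr, Finset.univ_unique, Finset.sum_singleton]
    congr 1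
    funext i
    exact Fin.cases rfl (fun j => j.elim0) i
  | n + 1, T, hT, w => by
    have hT' : ∀ (i : ℕ) (h : i + 1 < n + 1) (b : A) (v : Fin (n + 1) → W),
        T.curryLeft (w 0) (Function.update v ⟨i, by omega⟩ (r b (v ⟨i, by omega⟩))) =
        T.curryLeft (w 0) (Function.update v ⟨i + 1, h⟩ (l b (v ⟨i + 1, h⟩))) := by
      intro i h b v
      have := hT (i + 1) (by omega) b (Fin.cons (w 0) v)
      rw [T.curryLeft_apply, T.curryLeft_apply, Fin.cons_update, Fin.cons_update]
      exact this
    have ih := balanced_expansion l r g c hc hr (T.curryLeft (w 0)) hT' (Fin.tail w)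
    rw [T.curryLeft_apply, Fin.cons_self_tail] at ih
    rw [ih, sum_fin_cons]
    refine Finset.sum_congr rfl fun J _ => ?_
    -- After the induction hypothesis, x is the one entry behind the head that is not yet a
    -- generator. It is expanded, and its coefficients `c i x` are moved onto the head by the
    -- balancing of positions 0 and 1.
    obtain ⟨x, hx⟩ : ∃ x, x = r (expansionCoef r c J (Fin.tail (Fin.tail w))) (Fin.tail w 0) :=
      ⟨_, rfl⟩
    rw [← hx, ← hc x, T.curryLeft_apply]
    have h0 : ∀ y : W, (Fin.cons (w 0) (Fin.cons y (fun i => g (J i)) : Fin (n + 1) → W) :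
        Fin (n + 2) → W) = Function.update
          (Fin.cons (w 0) (Fin.cons 0 (fun i => g (J i)) : Fin (n + 1) → W)) 1 y := by
      intro y
      rw [show (1 : Fin (n + 2)) = (0 : Fin (n + 1)).succ from rfl, ← Fin.cons_update,
        Fin.update_cons_zero]
    rw [h0, T.map_update_sum]
    refine Finset.sum_congr rfl fun i _ => ?_
    have h1 := hT 0 (by omega) (c i x)
      (Fin.cons (w 0) (Fin.cons (g i) (fun i => g (J i)) : Fin (n + 1) → W))
    rw [← h0]
    have h2 : (Fin.cons (w 0) (Fin.cons (l (c i x) (g i)) (fun i => g (J i)) : Fin (n + 1) → W) :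
        Fin (n + 2) → W) = Function.update (Fin.cons (w 0)
          (Fin.cons (g i) (fun i => g (J i)) : Fin (n + 1) → W) : Fin (n + 2) → W) ⟨0 + 1, by omega⟩
            (l (c i x) (g i)) := by
      change _ = Function.update (Fin.cons (w 0)
          (Fin.cons (g i) (fun i => g (J i)) : Fin (n + 1) → W) : Fin (n + 2) → W)
            (0 : Fin (n + 1)).succ
            (l (c i x) (g i))
      rw [← Fin.cons_update, Fin.update_cons_zero]
    rw [h2]
    refine h1.symm.trans ?_
    congr 1
    change Function.update (Fin.cons (w 0)
          (Fin.cons (g i) (fun i => g (J i)) : Fin (n + 1) → W) : Fin (n + 2) → W) 0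
            (r (c i x) (w 0)) = _
    rw [Fin.update_cons_zero, hx]
    congr 1
    funext j
    refine Fin.cases ?_ (fun j => ?_) j <;> rfl

/-- The expansion in terms of values on generators, with one coefficient. -/
theorem balanced_expansion_coef [One A] (l r : A → W →ₗ[k] W) {N : ℕ} (g : Fin N → W)
    (c : Fin N → W → A) (hc : ∀ w, ∑ i, l (c i w) (g i) = w) (hr : ∀ w, r 1 w = w)
    {n : ℕ} (T : MultilinearMap k (fun _ : Fin (n + 1) => W) Z)
    (hT : ∀ (i : ℕ) (h : i + 1 < n + 1) (b : A) (w : Fin (n + 1) → W),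
      T (Function.update w ⟨i, by omega⟩ (r b (w ⟨i, by omega⟩))) =
        T (Function.update w ⟨i + 1, h⟩ (l b (w ⟨i + 1, h⟩)))) (w : Fin (n + 1) → W) :
    T w = ∑ J : Fin (n + 1) → Fin N,
      T (Function.update (fun i => g (J i)) 0 (l (expansionCoef r c J w) (g (J 0)))) := by
  rw [balanced_expansion l r g c hc hr T hT, sum_fin_cons]
  refine Finset.sum_congr rfl fun J _ => ?_
  -- Expanding the head as well leaves one coefficient, acting from the left on the first generator,
  -- where it can be pulled out by linearity or by the head relation.
  obtain ⟨x, hx⟩ : ∃ x, x = r (expansionCoef r c J (Fin.tail w)) (w 0) := ⟨_, rfl⟩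
  rw [← hx, ← hc x]
  have h0 : ∀ y : W, (Fin.cons y (fun i => g (J i)) : Fin (n + 1) → W) =
      Function.update (Fin.cons 0 (fun i => g (J i)) : Fin (n + 1) → W) 0 y := by
    intro y
    rw [Fin.update_cons_zero]
  rw [h0, T.map_update_sum]
  refine Finset.sum_congr rfl fun i _ => ?_
  rw [← h0]
  congr 1
  funext j
  refine Fin.cases ?_ (fun j => ?_) j
  · simp only [Fin.cons_zero, Function.update_self, expansionCoef, hx]
    rfl
  · simp

end Expansion

/-! ### The nested pairing as the counit of a product. -/

namespace LeftBialgebroid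

variable {k A U : Type*} [CommRing k] [Ring A] [Algebra k A] [Ring U] [Algebra k U]
  (H : LeftBialgebroid k A U)

theorem counit_mul_t (u v : U) :
    H.counit (u * v) = H.counit (u * H.t (op (H.counit v))) := by
  rw [H.counit_mul, H.counit_blact]

/-- The product `∏ ⟨φᵢ, uⁱ₍₁₎⟩ ▷ uⁱ₍₂₎`. -/
def harpProd {n : ℕ} (φ : Fin n → RightDual H) (u : Fin n → U) : U :=
  (List.ofFn fun i => H.harp (φ i) (u i)).prod

@[simp] theorem harpProd_zero (φ : Fin 0 → RightDual H) (u : Fin 0 → U) : H.harpProd φ u = 1 := by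
  simp [harpProd]

theorem harpProd_succ {n : ℕ} (φ : Fin (n + 1) → RightDual H) (u : Fin (n + 1) → U) :
    H.harpProd φ u = H.harp (φ 0) (u 0) * H.harpProd (Fin.tail φ) (Fin.tail u) := by
  simp only [harpProd, List.ofFn_succ, List.prod_cons]
  rfl

theorem harpProd_succ' {n : ℕ} (φ : Fin (n + 1) → RightDual H) (u : Fin (n + 1) → U) :
    H.harpProd φ u = H.harpProd (Fin.init φ) (Fin.init u) *
      H.harp (φ (Fin.last n)) (u (Fin.last n)) := by
  simp only [harpProd, List.ofFn_succ', List.prod_concat]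
  rfl

/-- By ε(uv) = ε(u t(ε(v))), the inner pairing enters as a right factor `t(·)`, with which `harp`
commutes. All later computations use the product form. -/
theorem nestedPair_eq : ∀ {n : ℕ} (φ : Fin n → RightDual H) (u : Fin n → U),
    nestedPair H φ u = H.counit (H.harpProd φ u)
  | 0, φ, u => by simp [nestedPair, H.counit_one]
  | n + 1, φ, u => by
    rw [nestedPair, nestedPair_eq, harpProd_succ, counit_mul_t, ← harp_mul_t, counit_harp]

end LeftBialgebroid

/-! ### Elementary tensors in iterated balanced tensor products. -/

namespace Tower

variable {k B X Y Z : Type*} [CommRing k] [AddCommGroup X] [Module k X]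
  [AddCommGroup Y] [Module k Y] [AddCommGroup Z] [Module k Z]
  (ρ : B → X →ₗ[k] X) (l r : B → Y →ₗ[k] Y) {n : ℕ}

/-- `y ↦ x ⊗ y₁ ⊗ ⋯ ⊗ yₙ` as a multilinear map, depending linearly on `x`. -/
def mkMultilinear (n : ℕ) :
    X →ₗ[k] MultilinearMap k (fun _ : Fin n => Y) (Tower ρ l r n) where
  toFun x := ((towerRel ρ l r n).mkQ.comp (TensorProduct.mk k X _ x)).compMultilinearMap
    (PiTensorProduct.tprod k)
  map_add' x x' := MultilinearMap.ext fun y =>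
    congrArg (towerRel ρ l r n).mkQ (TensorProduct.add_tmul x x' (PiTensorProduct.tprod k y))
  map_smul' _ _ := rfl

theorem tmul_head (b : B) (x : X) (y : Fin (n + 1) → Y) :
    tmul ρ l r (ρ b x) y = tmul ρ l r x (Function.update y 0 (l b (y 0))) :=
  (Submodule.Quotient.eq _).2 (Submodule.subset_span (Or.inl ⟨n.succ_pos, b, x, y, rfl⟩))

theorem tmul_bal (i : ℕ) (h : i + 1 < n) (b : B) (x : X) (y : Fin n → Y) :
    tmul ρ l r x (Function.update y ⟨i, by omega⟩ (r b (y ⟨i, by omega⟩))) =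
      tmul ρ l r x (Function.update y ⟨i + 1, h⟩ (l b (y ⟨i + 1, h⟩))) :=
  (Submodule.Quotient.eq _).2 (Submodule.subset_span (Or.inr ⟨i, h, b, x, y, rfl⟩))

variable {ρ l r}

theorem hom_ext {f g : Tower ρ l r n →ₗ[k] Z}
    (h : ∀ x y, f (tmul ρ l r x y) = g (tmul ρ l r x y)) : f = g := by
  refine Submodule.linearMap_qext _ (TensorProduct.ext' fun x z => ?_)
  induction z using PiTensorProduct.induction_on with
  | smul_tprod c y =>
    have h' := h x y
    simp only [TensorProduct.tmul_smul, map_smul]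
    exact congrArg _ h'
  | add a b ha hb => simp only [TensorProduct.tmul_add, map_add, ha, hb]

end Tower

/-! ### From the `U^*`-comodule to the `U`-module, and from the `U^*`-module to the contraaction. -/

namespace RightBialgebroid

variable {k B V : Type*} [CommRing k] [Ring B] [Algebra k B] [Ring V] [Algebra k V]
  (R : RightBialgebroid k B V) (M : Type*) [AddCommGroup M] [Module k M] [Module Bᵐᵒᵖ M]
  [IsScalarTower k Bᵐᵒᵖ M]

/-- The map `x ⊗ v ↦ x g(v)` on `M ⊗_B ▸V`, for a left `B`-linear `g`. -/
def evalRight (g : V →ₗ[k] B) (hg : ∀ b v, g (v * R.t (op b)) = b * g v) :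
    Bal (rsmul k (B := B) (M := M)) R.blact →ₗ[k] M :=
  Bal.lift (LinearMap.mk₂ k (fun (x : M) (y : V) => op (g y) • x)
      (fun _ _ _ => by simp) (fun c x y => (rsmul k (g y)).map_smul c x)
      (fun _ _ _ => by simp [add_smul]) (fun _ _ _ => by simp))
    (fun b x y => by
      change op (g y) • op b • x = op (g (y * R.t (op b))) • x
      rw [hg, op_mul, mul_smul])

theorem evalRight_tmul (g : V →ₗ[k] B) (hg : ∀ b v, g (v * R.t (op b)) = b * g v) (x : M)
    (v : V) : R.evalRight M g hg (Bal.tmul _ _ x v) = op (g v) • x :=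
  Bal.lift_tmul _ _ _ _

variable {R M} in
theorem _root_.HopfAlgd.RightComodule.contract_rep (ρ : RightComodule R M) (g : V →ₗ[k] B)
    (hg : ∀ b v, g (v * R.t (op b)) = b * g v) {m : M} {n : ℕ} {x : Fin n → M} {y : Fin n → V}
    (h : ρ.coact m = ∑ i, Bal.tmul _ _ (x i) (y i)) :
    ρ.contract g hg m = ∑ i, op (g (y i)) • x i := by
  change R.evalRight M g hg (ρ.coact m) = _
  rw [h, map_sum]
  simp only [evalRight_tmul]

end RightBialgebroid

namespace LeftBialgebroid

variable {k A U : Type*} [CommRing k] [Ring A] [Algebra k A] [Ring U] [Algebra k U]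
  (H : LeftBialgebroid k A U) {M : Type*} [AddCommGroup M] [Module k M] [Module Aᵐᵒᵖ M]
  [IsScalarTower k Aᵐᵒᵖ M]

section Dual

variable (hU : H.FinProj)

@[simp] theorem dual_s (a : A) : (H.dual hU).s a = H.dualS a := rfl

@[simp] theorem dual_t (a : A) : (H.dual hU).t (op a) = H.dualT a := rfl

@[simp] theorem dual_counit (φ : RightDual H) : (H.dual hU).counit φ = H.pair φ 1 := rfl

end Dual

section Action

variable {H} {hU : H.FinProj} (ρ : RightComodule (H.dual hU) M)

variable (M) in
/-- The map `x ⊗ φ ↦ x ⟨φ, u⟩` on `M ⊗_A ▸U^*`. -/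
noncomputable def evalPair (hU : H.FinProj) (u : U) :
    Bal (rsmul k (B := A) (M := M)) (H.dual hU).blact →ₗ[k] M :=
  (H.dual hU).evalRight M (H.pair.flip u) (fun b φ => H.mul_dualT b φ u)

@[simp] theorem evalPair_tmul (u : U) (x : M) (φ : RightDual H) :
    evalPair M hU u (Bal.tmul _ _ x φ) = op (H.pair φ u) • x :=
  (H.dual hU).evalRight_tmul M _ _ x φ

theorem comoduleAct_rep {m : M} {n : ℕ} {x : Fin n → M} {y : Fin n → RightDual H}
    (h : ρ.coact m = ∑ i, Bal.tmul _ _ (x i) (y i)) (u : U) :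
    comoduleAct ρ u m = ∑ i, op (H.pair (y i) u) • x i := by
  exact ρ.contract_rep _ _ h

theorem comoduleAct_op_smul (a : A) (m : M) (u : U) :
    comoduleAct ρ u (op a • m) = comoduleAct ρ (u * H.t (op a)) m := by
  obtain ⟨n, x, y, h⟩ := Bal.exists_rep (ρ.coact m)
  rw [comoduleAct_rep ρ h, comoduleAct_rep ρ (ρ.coact_smul a m n x y h)]
  simp [mul_dualS]

/-- The counit of `U^*` is evaluation at 1, so this is the comodule counit axiom multiplied by a.
With a = 1 it gives unitality of the action. -/
theorem comoduleAct_t (a : A) (m : M) : comoduleAct ρ (H.t (op a)) m = op a • m := by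
  obtain ⟨n, x, y, h⟩ := Bal.exists_rep (ρ.coact m)
  rw [comoduleAct_rep ρ h]
  conv_rhs => rw [← ρ.counit m n x y h]
  rw [Finset.smul_sum]
  refine Finset.sum_congr rfl fun i _ => ?_
  rw [← mul_one (H.t (op a)), H.pair_ract, op_mul, mul_smul, dual_counit]

theorem comoduleAct_mul (u v : U) (m : M) :
    comoduleAct ρ (u * v) m = comoduleAct ρ u (comoduleAct ρ v m) := by
  obtain ⟨n, x, y, h⟩ := Bal.exists_rep (ρ.coact m)
  -- Evaluate the last leg at v, move the result into the first argument as `t(·)`, and evaluate the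
  -- remaining legs at that argument. Coassociativity then compares acting by v and u in turn with
  -- acting by uv.
  let G : Bal3 (rsmul k (B := A) (M := M)) (H.dual hU).blact (H.dual hU).bract
      (H.dual hU).comm_blact →ₗ[k] M :=
    Bal.lift (LinearMap.mk₂ k (fun z ψ => evalPair M hU (u * H.t (op (H.pair ψ v))) z)
      (fun _ _ _ => by simp) (fun _ _ _ => by simp)
      (fun z _ _ => by
        obtain ⟨n, x, y, rfl⟩ := Bal.exists_rep z
        simp [mul_add, add_smul, Finset.sum_add_distrib])
      (fun _ z _ => by
        obtain ⟨n, x, y, rfl⟩ := Bal.exists_rep z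
        simp [Finset.smul_sum]))
    (fun b z ψ => by
      obtain ⟨n, x, y, rfl⟩ := Bal.exists_rep z
      simp [mul_dualS, mul_dualT, mul_assoc])
  have hG := congrArg G (ρ.coassoc m n x y h)
  simp only [map_sum] at hG
  have h1 : ∀ i, G (Bal3.snoc _ _ _ (H.dual hU).comm_blact (y i) (ρ.coact (x i))) =
      comoduleAct ρ (u * H.t (op (H.pair (y i) v))) (x i) := by
    intro i
    obtain ⟨m, p, q, h'⟩ := Bal.exists_rep (ρ.coact (x i))
    rw [comoduleAct_rep ρ h', h']
    simp only [G, Bal3.snoc, LinearMap.flip_apply, map_sum, Bal.lift_tmul, LinearMap.mk₂_apply,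
      evalPair_tmul]
  have h2 : ∀ i, G (Bal3.cons _ _ _ (H.dual hU).comm_blact (x i) ((H.dual hU).comul (y i))) =
      op (H.pair (y i) (u * v)) • x i := by
    intro i
    obtain ⟨m, p, q, h'⟩ := Bal.exists_rep ((H.dual hU).comul (y i))
    rw [← hU.basis.pair_rep h', h']
    simp only [G, Bal3.cons, map_sum, Bal.lift_tmul, LinearMap.comp_apply, LinearMap.mk₂_apply,
      evalPair_tmul]
    simp [Finset.sum_smul]
  simp only [h1, h2] at hG
  rw [comoduleAct_rep ρ h, ← hG, comoduleAct_rep ρ h, map_sum]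
  simp only [comoduleAct_op_smul]

/-- The left `U`-action on a right `U^*`-comodule. -/
noncomputable def comoduleAlgHom : U →ₐ[k] Module.End k M :=
  AlgHom.ofLinearMap
    { toFun := comoduleAct ρ
      map_add' := fun u v => LinearMap.ext fun m => by
        obtain ⟨n, x, y, h⟩ := Bal.exists_rep (ρ.coact m)
        simp [comoduleAct_rep ρ h, add_smul, Finset.sum_add_distrib]
      map_smul' := fun c u => LinearMap.ext fun m => by
        obtain ⟨n, x, y, h⟩ := Bal.exists_rep (ρ.coact m)
        simp [comoduleAct_rep ρ h, Finset.smul_sum] }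
    (LinearMap.ext fun m => by
      have := comoduleAct_t ρ 1 m
      simpa using this)
    (fun u v => LinearMap.ext fun m => comoduleAct_mul ρ u v m)

@[simp] theorem comoduleAlgHom_apply (u : U) : comoduleAlgHom ρ u = comoduleAct ρ u := rfl

/-- Because ∂(s^r(a)φ) = ⟨s^r(a)φ, 1⟩ = ⟨φ, s(a)⟩. -/
theorem lsmul_eq_comoduleAct (a : A) (m : M) : ρ.lsmul a m = comoduleAct ρ (H.s a) m := by
  obtain ⟨n, x, y, h⟩ := Bal.exists_rep (ρ.coact m)
  rw [comoduleAct_rep ρ h, RightComodule.lsmul, ρ.contract_rep _ _ h]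
  simp [dualS_mul]

end Action

section Contraaction

variable {H}

@[simp] theorem dyad_apply (m : M) (φ : RightDual H) (u : U) :
    (dyad H m φ).1 u = op (H.pair φ u) • m := rfl

/-- The functions m⟨φ, -⟩ span, so identities for γ need checking only on them. -/
theorem DualBasis.sum_dyad (b : DualBasis H) (f : RHom H.toAeRing M) :
    ∑ i, dyad H (f.1 (b.e i)) (b.f i) = f := by
  refine Subtype.ext (LinearMap.ext fun u => ?_)
  conv_rhs => rw [← b.sum_eq u, map_sum]
  rw [AddSubmonoidClass.coe_finsetSum, LinearMap.sum_apply]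
  exact Finset.sum_congr rfl fun i _ => (f.2 _ _).symm

variable [Module (RightDual H) M] [IsScalarTower k (RightDual H) M]

/-- The contraaction on a left `U^*`-module, `f ↦ ∑ eⁱ f(eᵢ)`. -/
def DualBasis.contraaction (b : DualBasis H) : RHom H.toAeRing M →ₗ[k] M where
  toFun f := ∑ i, b.f i • f.1 (b.e i)
  map_add' f g := by simp [Finset.sum_add_distrib]
  map_smul' c f := by
    have : SMulCommClass k (RightDual H) M := IsScalarTower.to_smulCommClass
    simp [Finset.smul_sum, smul_comm c]

theorem DualBasis.contraaction_apply (b : DualBasis H) (f : RHom H.toAeRing M) :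
    b.contraaction f = ∑ i, b.f i • f.1 (b.e i) := rfl

variable (hM : ∀ (a : A) (m : M), H.dualT a • m = op a • m)

include hM in
-- The sum ∑ eⁱ(m⟨φ, eᵢ⟩) equals (∑ eⁱ t^r⟨φ, eᵢ⟩)m. The agreement of the two right `A`-actions on
-- `M` is what allows the scalar to be moved into `U^*`.
theorem DualBasis.contraaction_dyad (b : DualBasis H) (m : M) (φ : RightDual H) :
    b.contraaction (dyad H m φ) = φ • m := by
  conv_rhs => rw [← b.sum_pair φ, Finset.sum_smul]
  simp [contraaction_apply, mul_smul, hM]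

end Contraaction

end LeftBialgebroid

/-! ### The contramodule axioms. -/

namespace LeftBialgebroid

variable {k A U : Type*} [CommRing k] [Ring A] [Algebra k A] [Ring U] [Algebra k U]
  {H : LeftBialgebroid k A U} {M : Type*} [AddCommGroup M] [Module k M] [Module Aᵐᵒᵖ M]
  [IsScalarTower k Aᵐᵒᵖ M]

/-- The elements eⱼ ⊗ eᵢ generate `U_◁ ⊗_A ▷U` with coordinates `convPair eʲ eⁱ`: expand the first
leg, move its coefficient to the second leg, and expand there. On Δ(u) these coordinates are the
values of eʲeⁱ. -/
theorem DualBasis.sum_convPair {N : Type*} [AddCommGroup N] [Module k N] [Module Aᵐᵒᵖ N]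
    (b : DualBasis H) (g : H.LeftTensor →ₗ[k] N)
    (hg : ∀ (a : A) (u v : U), g (H.ltmul u (H.t (op a) * v)) = op a • g (H.ltmul u v))
    (z : H.LeftTensor) :
    ∑ j, ∑ i, op (H.convPair (b.f j) (b.f i) z) • g (H.ltmul (b.e j) (b.e i)) = g z := by
  obtain ⟨n, x, y, rfl⟩ := Bal.exists_rep z
  have key : ∀ x y, ∑ j, ∑ i, op (H.convPair (b.f j) (b.f i) (H.ltmul x y)) •
      g (H.ltmul (b.e j) (b.e i)) = g (H.ltmul x y) := by
    intro x y
    conv_rhs => rw [← b.sum_eq x]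
    simp only [AeRing.ltmul, map_sum, LinearMap.sum_apply]
    refine Finset.sum_congr rfl fun j _ => ?_
    rw [← AeRing.ract_apply, Bal.tmul_bal, AeRing.lact_apply]
    conv_rhs => rw [← b.sum_eq (H.s (H.pair (b.f j) x) * y)]
    simp only [map_sum, convPair_tmul]
    exact Finset.sum_congr rfl fun i _ => (hg _ _ _).symm
  have hop : ∀ c : Fin n → A, op (∑ l, c l) = ∑ l, op (c l) := fun c => map_sum opAddEquiv c _
  simp only [map_sum, hop, Finset.sum_smul]
  rw [← Finset.sum_congr rfl fun l _ => key (x l) (y l)]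
  simp only [Finset.sum_comm (s := (Finset.univ : Finset (Fin n)))]

section Contraaction

variable [Module (RightDual H) M] [IsScalarTower k (RightDual H) M]

theorem DualBasis.isContraaction (b : DualBasis H)
    (hM : ∀ (a : A) (m : M), H.dualT a • m = op a • m) :
    IsContraaction H (b.contraaction (M := M)) where
  smul a f g h := by
    have hg : g = ∑ i, dyad H (f.1 (b.e i)) (H.dualT a * b.f i) := by
      refine Subtype.ext (LinearMap.ext fun u => ?_)
      conv_lhs => rw [h, ← b.sum_dyad f]
      simp [AddSubmonoidClass.coe_finsetSum, dualT_mul]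
    rw [hg, map_sum, b.contraaction_apply f, Finset.smul_sum]
    refine Finset.sum_congr rfl fun i _ => ?_
    rw [b.contraaction_dyad hM, mul_smul, hM]
  coassoc g hg inner outer diag hi ho hd := by
    -- In this form contraassociativity is associativity of the action, (eʲeⁱ)m = eʲ(eⁱm).
    have h1 : diag = ∑ j, ∑ i, dyad H (g (H.ltmul (b.e j) (b.e i))) (b.f j * b.f i) := by
      refine Subtype.ext (LinearMap.ext fun u => ?_)
      rw [hd, ← b.sum_convPair g hg]
      simp [AddSubmonoidClass.coe_finsetSum, pair_mul]
    rw [h1, b.contraaction_apply]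
    simp only [ho, map_sum, b.contraaction_dyad hM, b.contraaction_apply (inner _), hi,
      Finset.smul_sum, mul_smul]
  counit m := by rw [b.contraaction_dyad hM, one_smul]

end Contraaction

/-! ### The isomorphism between the two cochain spaces -/

variable (H)

/-- `harpProd` as a multilinear map in both arguments. -/
def harpMultilinear (n : ℕ) : MultilinearMap k (fun _ : Fin n => RightDual H)
    (MultilinearMap k (fun _ : Fin n => U) U) :=
  ((LinearMap.applyₗ (MultilinearMap.mkPiAlgebraFin k n U)).compMultilinearMap
    MultilinearMap.compLinearMapMultilinear).compLinearMap (fun _ => H.harp)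

theorem harpMultilinear_apply {n : ℕ} (φ : Fin n → RightDual H) (u : Fin n → U) :
    H.harpMultilinear n φ u = H.harpProd φ u := rfl

/-- Both modifications insert `s(b)` between the two factors. Hence ξ respects the tensor relations
between factors of `U^*`. -/
theorem harpProd_update_bal {n : ℕ} (i : ℕ) (h : i + 1 < n) (b : A) (φ : Fin n → RightDual H)
    (u : Fin n → U) :
    H.harpProd (Function.update φ ⟨i, by omega⟩ (φ ⟨i, by omega⟩ * H.dualS b)) u =
      H.harpProd (Function.update φ ⟨i + 1, h⟩ (φ ⟨i + 1, h⟩ * H.dualT b)) u := by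
  have e : ∀ (j : Fin n) ψ, (fun l => H.harp (Function.update φ j ψ l) (u l)) =
      Function.update (fun l => H.harp (φ l) (u l)) j (H.harp ψ (u j)) := by
    intro j ψ
    funext l
    by_cases hl : l = j
    · subst hl; simp
    · simp [hl]
  rw [harpProd, harpProd, e, e]
  refine prod_ofFn_update _ i h _ _ ?_
  rw [harp_mul_dualS, harp_mul_dualT, mul_assoc]

/-- Here both modifications insert `t(b)` between the factors, so the values of ξ are balanced
cochains. -/
theorem harpProd_update_bal' {n : ℕ} (i : ℕ) (h : i + 1 < n) (b : A) (φ : Fin n → RightDual H)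
    (u : Fin n → U) :
    H.harpProd φ (Function.update u ⟨i, by omega⟩ (u ⟨i, by omega⟩ * H.t (op b))) =
      H.harpProd φ (Function.update u ⟨i + 1, h⟩ (H.t (op b) * u ⟨i + 1, h⟩)) := by
  have e : ∀ (j : Fin n) v, (fun l => H.harp (φ l) (Function.update u j v l)) =
      Function.update (fun l => H.harp (φ l) (u l)) j (H.harp (φ j) v) := by
    intro j v
    funext l
    by_cases hl : l = j
    · subst hl; simp
    · simp [hl]
  rw [harpProd, harpProd, e, e]
  refine prod_ofFn_update _ i h _ _ ?_
  rw [harp_mul_t, harp_t_mul, mul_assoc]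

/-- The map `(m, z) ↦ (u ↦ m ⟨z, u⟩)`, before passing to the balanced tensor product. -/
noncomputable def cochainPairing (M : Type*) [AddCommGroup M] [Module k M] [Module Aᵐᵒᵖ M]
    [IsScalarTower k Aᵐᵒᵖ M] (n : ℕ) :
    M ⊗[k] (⨂[k] _ : Fin n, RightDual H) →ₗ[k] MultilinearMap k (fun _ : Fin n => U) M :=
  TensorProduct.lift (LinearMap.mk₂ k
    (fun m z => ((LinearMap.toSpanSingleton Aᵐᵒᵖ M m).restrictScalars k ∘ₗ
      (opLinearEquiv k).toLinearMap ∘ₗ H.counit).compMultilinearMap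
        (PiTensorProduct.lift (H.harpMultilinear n) z))
    (fun _ _ _ => by ext; simp)
    (fun c m z => by
      have : SMulCommClass k Aᵐᵒᵖ M := IsScalarTower.to_smulCommClass
      ext; simp [smul_comm c])
    (fun _ _ _ => by ext; simp)
    (fun _ _ _ => by ext; simp))

theorem cochainPairing_tmul {n : ℕ} (m : M) (φ : Fin n → RightDual H) (u : Fin n → U) :
    H.cochainPairing M n (m ⊗ₜ PiTensorProduct.tprod k φ) u =
      op (H.counit (H.harpProd φ u)) • m := by
  simp [cochainPairing, harpMultilinear_apply]

theorem cochainPairing_mem {n : ℕ} (z : M ⊗[k] (⨂[k] _ : Fin n, RightDual H)) :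
    H.cochainPairing M n z ∈ Cochain H M n := by
  induction z with
  | zero => simp
  | add x y hx hy => rw [map_add]; exact add_mem hx hy
  | tmul m z =>
    induction z using PiTensorProduct.induction_on with
    | add x y hx hy => rw [TensorProduct.tmul_add, map_add]; exact add_mem hx hy
    | smul_tprod c φ =>
      rw [TensorProduct.tmul_smul, map_smul]
      refine Submodule.smul_mem _ _ ⟨fun h a u => ?_, fun i h a u => ?_⟩
      · obtain ⟨n, rfl⟩ : ∃ l, n = l + 1 := ⟨n - 1, by omega⟩
        rw [cochainPairing_tmul, cochainPairing_tmul, ← mul_smul, ← op_mul, ← H.counit_t_mul]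
        congr 3
        rw [harpProd_succ, harpProd_succ, ← mul_assoc, ← harp_t_mul]
        change H.harp _ (Function.update u 0 _ 0) *
          H.harpProd _ (Fin.tail (Function.update u 0 _)) = _
        rw [Fin.tail_update_zero, Function.update_self]
        rfl
      · rw [cochainPairing_tmul, cochainPairing_tmul, harpProd_update_bal']

variable {H} in
/-- The map `ξ : M ⊗_A U^* ⊗_A ⋯ ⊗_A U^* → Hom_{Aᵒᵖ}(U^{⊗_{Aᵒᵖ} n}, M)`. -/
noncomputable def toCochain (hU : H.FinProj) (M : Type*) [AddCommGroup M] [Module k M]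
    [Module Aᵐᵒᵖ M] [IsScalarTower k Aᵐᵒᵖ M] (n : ℕ) :
    CoCochain (H.dual hU) M n →ₗ[k] Cochain H M n :=
  (towerRel (rsmul k (B := A) (M := M)) (H.dual hU).blact (H.dual hU).bract n).liftQ
    ((H.cochainPairing M n).codRestrict _ H.cochainPairing_mem) (by
      refine Submodule.span_le.2 ?_
      rintro _ (⟨h, b, m, φ, rfl⟩ | ⟨i, h, b, m, φ, rfl⟩)
      · obtain ⟨n, rfl⟩ : ∃ l, n = l + 1 := ⟨n - 1, by omega⟩
        rw [SetLike.mem_coe, LinearMap.mem_ker, map_sub, sub_eq_zero]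
        refine Subtype.ext (MultilinearMap.ext fun u => ?_)
        simp only [LinearMap.codRestrict_apply]
        rw [cochainPairing_tmul, cochainPairing_tmul, rsmul_apply, ← mul_smul, ← op_mul,
          ← H.counit_s_mul]
        congr 3
        rw [harpProd_succ, harpProd_succ, ← mul_assoc, ← harp_mul_dualT]
        change _ = H.harp (Function.update φ 0 _ 0) _ *
          H.harpProd (Fin.tail (Function.update φ 0 _)) _
        rw [Fin.tail_update_zero, Function.update_self]
        rfl
      · rw [SetLike.mem_coe, LinearMap.mem_ker, map_sub, sub_eq_zero]
        refine Subtype.ext (MultilinearMap.ext fun u => ?_)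
        simp only [LinearMap.codRestrict_apply]
        rw [cochainPairing_tmul, cochainPairing_tmul]
        congr 3
        exact H.harpProd_update_bal i h b φ u)

theorem toCochain_tmul (hU : H.FinProj) {n : ℕ} (m : M) (φ : Fin n → RightDual H)
    (u : Fin n → U) : (toCochain hU M n (coTmul (H.dual hU) M m φ)).1 u =
      op (H.counit (H.harpProd φ u)) • m :=
  H.cochainPairing_tmul m φ u

end LeftBialgebroid

/-! ### The inverse of ξ, and linear operators on cochains. -/

namespace LeftBialgebroid

variable {k A U : Type*} [CommRing k] [Ring A] [Algebra k A] [Ring U] [Algebra k U]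
  {H : LeftBialgebroid k A U} {M : Type*} [AddCommGroup M] [Module k M] [Module Aᵐᵒᵖ M]
  [IsScalarTower k Aᵐᵒᵖ M]

theorem DualBasis.expansionCoef_left (b : DualBasis H) : ∀ {n : ℕ} (J : Fin n → Fin b.n)
    (u : Fin n → U), expansionCoef H.blact (fun i u => H.pair (b.f i) u) J u =
      nestedPair H (fun l => b.f (J l)) u
  | 0, _, _ => rfl
  | n + 1, J, u => by
    rw [expansionCoef, b.expansionCoef_left]
    rfl

/-- Expansions of cochains in eᵢ and of tensors in eⁱ have the same kind of coefficient, a nested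
pairing. Thus one formula inverts ξ on both sides. -/
theorem DualBasis.expansionCoef_right (b : DualBasis H) : ∀ {n : ℕ} (J : Fin n → Fin b.n)
    (φ : Fin n → RightDual H), expansionCoef H.dualAeRing.bract (fun i φ => H.pair φ (b.e i)) J φ =
      nestedPair H φ (fun l => b.e (J l))
  | 0, _, _ => rfl
  | n + 1, J, φ => by
    rw [expansionCoef, b.expansionCoef_right, AeRing.bract_apply, dualAeRing_s, mul_dualS]
    rfl

theorem DualBasis.cochain_expansion (b : DualBasis H) {n : ℕ} (f : Cochain H M n)
    (u : Fin n → U) :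
    ∑ J : Fin n → Fin b.n, op (H.counit (H.harpProd (fun l => b.f (J l)) u)) •
      f.1 (fun l => b.e (J l)) = f.1 u := by
  cases n with
  | zero =>
    simp only [Finset.univ_unique, Finset.sum_singleton, harpProd_zero, H.counit_one, op_one,
      one_smul]
    congr 1
    exact Subsingleton.elim _ _
  | succ n =>
    rw [balanced_expansion_coef H.ract H.blact b.e (fun i u => H.pair (b.f i) u)
      (fun w => b.sum_eq w) (fun w => by simp) f.1 (fun i h a w => f.2.2 i h a w) u]
    refine Finset.sum_congr rfl fun J _ => ?_
    rw [b.expansionCoef_left, nestedPair_eq]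
    exact (f.2.1 n.succ_pos _ _).symm

theorem DualBasis.coTmul_expansion (b : DualBasis H) (hU : H.FinProj) {n : ℕ} (m : M)
    (φ : Fin n → RightDual H) :
    ∑ J : Fin n → Fin b.n, coTmul (H.dual hU) M
      (op (H.counit (H.harpProd φ (fun l => b.e (J l)))) • m) (fun l => b.f (J l)) =
        coTmul (H.dual hU) M m φ := by
  cases n with
  | zero =>
    simp only [Finset.univ_unique, Finset.sum_singleton, harpProd_zero, H.counit_one, op_one,
      one_smul]
    congr 1
    exact Subsingleton.elim _ _
  | succ n =>
    -- The universal multilinear map into the tensor product is itself balanced, so the expansion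
    -- applies to it; the head relation then passes the coefficient to m.
    have := balanced_expansion_coef H.dualAeRing.blact H.dualAeRing.bract b.f
      (fun i φ => H.pair φ (b.e i)) (fun φ => b.sum_pair φ) (fun φ => by
        rw [AeRing.bract_apply, map_one, mul_one])
      (Tower.mkMultilinear (rsmul k (B := A) (M := M)) (H.dual hU).blact (H.dual hU).bract
        (n + 1) m) (fun i h a w => Tower.tmul_bal _ _ _ i h a m w) φ
    refine Eq.trans ?_ this.symm
    refine Finset.sum_congr rfl fun J _ => ?_
    rw [b.expansionCoef_right, nestedPair_eq]
    exact Tower.tmul_head (rsmul k (B := A) (M := M)) (H.dual hU).blact (H.dual hU).bract _ m _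

/-- The inverse of `ξ`, `f ↦ ∑ f(e_{j₁}, …, e_{jₙ}) ⊗ e^{j₁} ⊗ ⋯ ⊗ e^{jₙ}`. -/
noncomputable def DualBasis.ofCochain (b : DualBasis H) (hU : H.FinProj) (M : Type*)
    [AddCommGroup M] [Module k M] [Module Aᵐᵒᵖ M] [IsScalarTower k Aᵐᵒᵖ M] (n : ℕ) :
    Cochain H M n →ₗ[k] CoCochain (H.dual hU) M n where
  toFun f := ∑ J : Fin n → Fin b.n, Tower.mkMultilinear (rsmul k (B := A) (M := M))
    (H.dual hU).blact (H.dual hU).bract n (f.1 (fun l => b.e (J l))) (fun l => b.f (J l))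
  map_add' f g := by simp [Finset.sum_add_distrib]
  map_smul' c f := by simp [Finset.smul_sum]

theorem DualBasis.ofCochain_toCochain (b : DualBasis H) (hU : H.FinProj) {n : ℕ}
    (z : CoCochain (H.dual hU) M n) : b.ofCochain hU M n (toCochain hU M n z) = z := by
  have : (b.ofCochain hU M n).comp (toCochain hU M n) = LinearMap.id :=
    Tower.hom_ext fun m φ => by
      refine Eq.trans ?_ (b.coTmul_expansion hU m φ)
      refine Finset.sum_congr rfl fun J _ => ?_
      rw [toCochain_tmul]
      rfl
  exact LinearMap.congr_fun this z

theorem DualBasis.toCochain_ofCochain (b : DualBasis H) (hU : H.FinProj) {n : ℕ}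
    (f : Cochain H M n) : toCochain hU M n (b.ofCochain hU M n f) = f := by
  refine Subtype.ext (MultilinearMap.ext fun u => ?_)
  refine Eq.trans ?_ (b.cochain_expansion f u)
  change (toCochain hU M n (∑ J : Fin n → Fin b.n, coTmul (H.dual hU) M
    (f.1 (fun l => b.e (J l))) (fun l => b.f (J l)))).1 u = _
  rw [map_sum, AddSubmonoidClass.coe_finsetSum, sum_apply]
  exact Finset.sum_congr rfl fun J _ => toCochain_tmul H hU _ _ u

/-- The isomorphism `ξ : M ⊗_A U^* ⊗_A ⋯ ⊗_A U^* ≃ Hom_{Aᵒᵖ}(U^{⊗_{Aᵒᵖ} n}, M)`. -/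
noncomputable def cochainEquiv (hU : H.FinProj) (M : Type*) [AddCommGroup M] [Module k M]
    [Module Aᵐᵒᵖ M] [IsScalarTower k Aᵐᵒᵖ M] (n : ℕ) :
    CoCochain (H.dual hU) M n ≃ₗ[k] Cochain H M n :=
  LinearEquiv.ofLinearMap (toCochain hU M n) (hU.basis.ofCochain hU M n)
    (LinearMap.ext fun f => hU.basis.toCochain_ofCochain hU f)
    (LinearMap.ext fun z => hU.basis.ofCochain_toCochain hU z)

theorem cochainEquiv_tmul (hU : H.FinProj) {n : ℕ} (m : M) (φ : Fin n → RightDual H)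
    (u : Fin n → U) : (cochainEquiv hU M n (coTmul (H.dual hU) M m φ)).1 u =
      op (H.counit (H.harpProd φ u)) • m :=
  toCochain_tmul H hU m φ u

/-- The cochains `u ↦ m ⟨φ, u⟩` span the space of all cochains. -/
theorem cochain_induction (hU : H.FinProj) {n : ℕ} {P : Cochain H M n → Prop}
    (h0 : P 0) (hadd : ∀ f g, P f → P g → P (f + g))
    (hP : ∀ m φ, P (cochainEquiv hU M n (coTmul (H.dual hU) M m φ))) (f : Cochain H M n) : P f := by
  rw [← hU.basis.toCochain_ofCochain hU f]
  change P (toCochain hU M n (∑ J : Fin n → Fin hU.basis.n, coTmul (H.dual hU) M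
    (f.1 (fun l => hU.basis.e (J l))) (fun l => hU.basis.f (J l))))
  rw [map_sum]
  exact Finset.sum_induction _ P hadd h0 fun J _ => hP _ _

/-- A linear map from cochains to functions takes values in cochains if it does so on the cochains
`u ↦ m ⟨φ, u⟩`. -/
theorem exists_cochain_operator (hU : H.FinProj) {n N : ℕ}
    (F : Cochain H M n →ₗ[k] (Fin N → U) → M)
    (hF : ∀ m φ, ∃ z : CoCochain (H.dual hU) M N, ∀ u,
      (cochainEquiv hU M N z).1 u = F (cochainEquiv hU M n (coTmul (H.dual hU) M m φ)) u) :
    ∃ δ : Cochain H M n →ₗ[k] Cochain H M N, ∀ f u, (δ f).1 u = F f u := by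
  have h : ∀ f, ∃ g : Cochain H M N, ∀ u, g.1 u = F f u := fun f => by
    induction f using cochain_induction hU with
    | h0 => exact ⟨0, fun u => by simp⟩
    | hadd f g hf hg =>
      obtain ⟨f', hf⟩ := hf
      obtain ⟨g', hg⟩ := hg
      exact ⟨f' + g', fun u => by simp [hf, hg]⟩
    | hP m φ =>
      obtain ⟨z, hz⟩ := hF m φ
      exact ⟨_, hz⟩
  choose δ hδ using h
  exact ⟨{ toFun := δ
           map_add' := fun f g => Subtype.ext (MultilinearMap.ext fun u => by simp [hδ])
           map_smul' := fun c f => Subtype.ext (MultilinearMap.ext fun u => by simp [hδ]) }, hδ⟩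

end LeftBialgebroid

/-! ### Cofaces and codegeneracies on elementary tensors. -/

namespace LeftBialgebroid

variable {k A U : Type*} [CommRing k] [Ring A] [Algebra k A] [Ring U] [Algebra k U]
  {H : LeftBialgebroid k A U} {M : Type*} [AddCommGroup M] [Module k M] [Module Aᵐᵒᵖ M]
  [IsScalarTower k Aᵐᵒᵖ M]

variable (H) in
theorem harpProd_update_last {n : ℕ} (φ : Fin (n + 1) → RightDual H) (u : Fin (n + 1) → U)
    (a : A) : H.harpProd φ (Function.update u (Fin.last n) (u (Fin.last n) * H.t (op a))) =
      H.harpProd φ u * H.t (op a) := by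
  rw [harpProd_succ', harpProd_succ', mul_assoc, ← harp_mul_t, Fin.init_update_last,
    Function.update_self]

/-- The pairing of a coproduct applied to one tensor factor is the pairing with a product. -/
theorem sum_harpProd_insertNth {hU : H.FinProj} {n : ℕ} (p : Fin n) (φ : Fin n → RightDual H)
    {N : ℕ} {x y : Fin N → RightDual H}
    (h : (H.dual hU).comul (φ p) = ∑ j, (H.dual hU).rtmul (x j) (y j)) (u : Fin (n + 1) → U) :
    ∑ j, H.harpProd (Fin.insertNth (α := fun _ => RightDual H) p.castSucc (x j)
      (Function.update φ p (y j))) u =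
        H.harpProd φ (Fin.contractNth p.castSucc (· * ·) u) := by
  -- The tuple v holds the factors that do not depend on j; its entry at p is always overwritten.
  -- Multilinearity of the product then brings the sum over j to position p, where `harp_mul`
  -- applies.
  obtain ⟨v, hv⟩ : ∃ v : Fin n → U, ∀ l, v l =
      H.harp (φ l) (Fin.contractNth p.castSucc (· * ·) u l) := ⟨_, fun _ => rfl⟩
  have h1 : ∀ j, H.harpProd (Fin.insertNth (α := fun _ => RightDual H) p.castSucc (x j)
      (Function.update φ p (y j))) u = MultilinearMap.mkPiAlgebraFin k n U
        (Function.update v p (H.harp (x j) (u p.castSucc) * H.harp (y j) (u p.succ))) := by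
    intro j
    rw [harpProd, ← prod_ofFn_contractNth p, MultilinearMap.mkPiAlgebraFin_apply]
    congr 2
    funext l
    rcases lt_trichotomy l p with hl | rfl | hl
    · rw [Fin.contractNth_apply_of_lt _ _ _ _ (by simpa using hl),
        Function.update_of_ne hl.ne, hv,
        Fin.contractNth_apply_of_lt _ _ _ _ (by simpa using hl),
        ← Fin.succAbove_of_castSucc_lt p.castSucc l (by simpa using hl),
        Fin.insertNth_apply_succAbove, Function.update_of_ne hl.ne]
    · rw [Fin.contractNth_apply_of_eq _ _ _ _ (by simp), Function.update_self,
        Fin.insertNth_apply_same, ← Fin.succAbove_castSucc_self l,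
        Fin.insertNth_apply_succAbove, Function.update_self]
    · rw [Fin.contractNth_apply_of_gt _ _ _ _ (by simpa using hl),
        Function.update_of_ne hl.ne', hv,
        Fin.contractNth_apply_of_gt _ _ _ _ (by simpa using hl),
        ← Fin.succAbove_of_le_castSucc p.castSucc l (by simpa using hl.le),
        Fin.insertNth_apply_succAbove, Function.update_of_ne hl.ne']
  simp only [h1]
  rw [← MultilinearMap.map_update_sum, H.harp_mul h, MultilinearMap.mkPiAlgebraFin_apply, harpProd]
  congr 2
  funext l
  by_cases hl : l = p
  · subst hl
    rw [Function.update_self, Fin.contractNth_apply_of_eq _ _ _ _ (by simp)]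
  · rw [Function.update_of_ne hl, hv]

/-- The inserted 1 contributes the factor `s⟨φ, 1⟩`, which the factor to its left absorbs through
`s^r` by `harp_mul_dualS`. -/
theorem harpProd_removeNth {n : ℕ} (q : Fin n) (φ : Fin (n + 1) → RightDual H) (u : Fin n → U) :
    H.harpProd (Fin.removeNth q.succ (Function.update φ q.castSucc
      (φ q.castSucc * H.dualS (H.pair (φ q.succ) 1)))) u =
        H.harpProd φ (Fin.insertNth (α := fun _ => U) q.succ 1 u) := by
  rw [harpProd, harpProd, ← prod_ofFn_contractNth q]
  congr 2
  funext l
  simp only [Fin.removeNth]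
  rcases lt_trichotomy l q with hl | rfl | hl
  · have h1 : l.castSucc < q.succ := Fin.castSucc_lt_succ_iff.2 hl.le
    rw [Fin.contractNth_apply_of_lt _ _ _ _ (by simpa using hl),
      Fin.succAbove_of_castSucc_lt q.succ l h1,
      Function.update_of_ne (by simpa using hl.ne)]
    conv_rhs => rw [← Fin.succAbove_of_castSucc_lt q.succ l h1,
      Fin.insertNth_apply_succAbove]
    rw [Fin.succAbove_of_castSucc_lt q.succ l h1]
  · rw [Fin.contractNth_apply_of_eq _ _ _ _ (by simp), Fin.insertNth_apply_same,
      Fin.succAbove_of_castSucc_lt l.succ l (Fin.castSucc_lt_succ), Function.update_self,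
      harp_mul_dualS, harp_apply_one]
    congr 2
    conv_rhs => rw [← Fin.succAbove_of_castSucc_lt l.succ l (Fin.castSucc_lt_succ),
      Fin.insertNth_apply_succAbove]
  · have h1 : q.succ ≤ l.castSucc := by simpa using hl
    rw [Fin.contractNth_apply_of_gt _ _ _ _ (by simpa using hl),
      ← Fin.succAbove_of_le_castSucc q.succ l h1, Fin.insertNth_apply_succAbove,
      Function.update_of_ne]
    rw [Fin.succAbove_of_le_castSucc q.succ l h1]
    exact (Fin.castSucc_lt_succ_iff.2 hl.le).ne'

section Operators

variable {hU : H.FinProj}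

theorem cochainEquiv_coface_zero_zero (m : M) (φ : Fin 0 → RightDual H) (u : Fin 1 → U) :
    (cochainEquiv hU M _ (coTmul (H.dual hU) M m (Fin.snoc φ 1 : Fin 1 → RightDual H))).1 u =
      op (H.counit (u 0)) • (cochainEquiv hU M _ (coTmul (H.dual hU) M m φ)).1 (Fin.tail u) := by
  rw [cochainEquiv_tmul, cochainEquiv_tmul, harpProd_succ]
  simp [H.counit_one, Fin.snoc]

theorem cochainEquiv_coface_zero_succ {n : ℕ} (m : M) (φ : Fin (n + 1) → RightDual H)
    (u : Fin (n + 2) → U) :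
    (cochainEquiv hU M _ (coTmul (H.dual hU) M m (Fin.snoc φ 1 : Fin (n + 2) → RightDual H))).1 u =
      (cochainEquiv hU M _ (coTmul (H.dual hU) M m φ)).1 (Function.update (Fin.init u) (Fin.last n)
        (u (Fin.last n).castSucc * H.t (op (H.counit (u (Fin.last (n + 1))))))) := by
  rw [cochainEquiv_tmul, cochainEquiv_tmul]
  change _ = op (H.counit (H.harpProd φ (Function.update (Fin.init u) (Fin.last n)
    (Fin.init u (Fin.last n) * _)))) • m
  rw [harpProd_succ', harpProd_update_last, Fin.init_snoc, Fin.snoc_last, harp_one,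
    ← counit_mul_t]

theorem cochainEquiv_coface_mid {n : ℕ} (p : Fin n) (m : M) (φ : Fin n → RightDual H) {N : ℕ}
    {x y : Fin N → RightDual H}
    (h : (H.dual hU).comul (φ p) = ∑ j, (H.dual hU).rtmul (x j) (y j)) (u : Fin (n + 1) → U) :
    (cochainEquiv hU M _ (∑ j, coTmul (H.dual hU) M m (Fin.insertNth (α := fun _ => RightDual H)
      p.castSucc (x j) (Function.update φ p (y j))))).1 u =
        (cochainEquiv hU M _ (coTmul (H.dual hU) M m φ)).1
          (Fin.contractNth p.castSucc (· * ·) u) := by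
  rw [map_sum, AddSubmonoidClass.coe_finsetSum, sum_apply, cochainEquiv_tmul,
    ← sum_harpProd_insertNth p φ h, map_sum]
  have hop : ∀ c : Fin N → A, op (∑ l, c l) = ∑ l, op (c l) := fun c => map_sum opAddEquiv c _
  rw [hop, Finset.sum_smul]
  exact Finset.sum_congr rfl fun j _ => cochainEquiv_tmul hU _ _ _

/-- Acting by u¹ on m·a is acting by u¹t(a) on m, so the inner value a becomes part of the argument
of m⁽¹⁾. The cyclic operator uses this again to rewrite u¹₊f(…). -/
theorem cochainEquiv_coface_last (ρ : RightComodule (H.dual hU) M) {n : ℕ} (m : M)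
    (φ : Fin n → RightDual H) {N : ℕ} {x : Fin N → M} {y : Fin N → RightDual H}
    (h : ρ.coact m = ∑ j, Bal.tmul _ _ (x j) (y j)) (u : Fin (n + 1) → U) :
    (cochainEquiv hU M _ (∑ j, coTmul (H.dual hU) M (x j)
      (Fin.cons (y j) φ : Fin (n + 1) → RightDual H))).1 u =
      comoduleAct ρ (u 0) ((cochainEquiv hU M _ (coTmul (H.dual hU) M m φ)).1 (Fin.tail u)) := by
  rw [map_sum, AddSubmonoidClass.coe_finsetSum, sum_apply, cochainEquiv_tmul,
    comoduleAct_op_smul, comoduleAct_rep ρ h]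
  refine Finset.sum_congr rfl fun j _ => ?_
  rw [cochainEquiv_tmul, harpProd_succ, counit_mul_t, ← harp_mul_t, counit_harp, Fin.cons_zero,
    Fin.tail_cons]

theorem cochainEquiv_codegeneracy_last {n : ℕ} (m : M) (φ : Fin (n + 1) → RightDual H)
    (u : Fin n → U) :
    (cochainEquiv hU M _ (coTmul (H.dual hU) M (op (H.pair (φ 0) 1) • m) (Fin.tail φ))).1 u =
      (cochainEquiv hU M _ (coTmul (H.dual hU) M m φ)).1
        (Fin.insertNth (α := fun _ => U) 0 1 u) := by
  rw [cochainEquiv_tmul, cochainEquiv_tmul, harpProd_succ _ φ, Fin.insertNth_apply_same,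
    harp_apply_one, counit_s_mul, op_mul, mul_smul, Fin.insertNth_zero']
  rfl

theorem cochainEquiv_codegeneracy {n : ℕ} (q : Fin n) (m : M) (φ : Fin (n + 1) → RightDual H)
    (u : Fin n → U) :
    (cochainEquiv hU M _ (coTmul (H.dual hU) M m (Fin.removeNth q.succ (Function.update φ q.castSucc
      (φ q.castSucc * H.dualS (H.pair (φ q.succ) 1)))))).1 u =
      (cochainEquiv hU M _ (coTmul (H.dual hU) M m φ)).1
        (Fin.insertNth (α := fun _ => U) q.succ 1 u) := by
  rw [cochainEquiv_tmul, cochainEquiv_tmul, harpProd_removeNth]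

end Operators

end LeftBialgebroid

/-! ### Cofaces and codegeneracies as operators on `C(U, M)`. -/

namespace LeftBialgebroid

variable {k A U : Type*} [CommRing k] [Ring A] [Algebra k A] [Ring U] [Algebra k U]
  {H : LeftBialgebroid k A U} {M : Type*} [AddCommGroup M] [Module k M] [Module Aᵐᵒᵖ M]
  [IsScalarTower k Aᵐᵒᵖ M]

theorem exists_coface_zero_zero (hU : H.FinProj) :
    ∃ δ : Cochain H M 0 →ₗ[k] Cochain H M 1, ∀ f (u : Fin 1 → U),
      (δ f).1 u = op (H.counit (u 0)) • f.1 (Fin.tail u) :=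
  exists_cochain_operator hU
    { toFun := fun f (u : Fin 1 → U) => op (H.counit (u 0)) • f.1 (Fin.tail u)
      map_add' := fun f g => funext fun u => by simp
      map_smul' := fun c f => funext fun u => (rsmul k (H.counit (u 0))).map_smul c _ }
    fun m φ => ⟨_, cochainEquiv_coface_zero_zero m φ⟩

theorem exists_coface_zero_succ (hU : H.FinProj) (n : ℕ) :
    ∃ δ : Cochain H M (n + 1) →ₗ[k] Cochain H M (n + 2), ∀ f (u : Fin (n + 2) → U),
      (δ f).1 u = f.1 (Function.update (Fin.init u) (Fin.last n)
        (u (Fin.last n).castSucc * H.t (op (H.counit (u (Fin.last (n + 1))))))) :=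
  exists_cochain_operator hU
    { toFun := fun f (u : Fin (n + 2) → U) => f.1 (Function.update (Fin.init u) (Fin.last n)
        (u (Fin.last n).castSucc * H.t (op (H.counit (u (Fin.last (n + 1)))))))
      map_add' := fun _ _ => rfl
      map_smul' := fun _ _ => rfl }
    fun m φ => ⟨_, cochainEquiv_coface_zero_succ m φ⟩

theorem exists_coface_mid (hU : H.FinProj) (n : ℕ) (p : Fin n) :
    ∃ δ : Cochain H M n →ₗ[k] Cochain H M (n + 1), ∀ f (u : Fin (n + 1) → U),
      (δ f).1 u = f.1 (Fin.contractNth p.castSucc (· * ·) u) :=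
  exists_cochain_operator hU
    { toFun := fun f (u : Fin (n + 1) → U) => f.1 (Fin.contractNth p.castSucc (· * ·) u)
      map_add' := fun _ _ => rfl
      map_smul' := fun _ _ => rfl }
    fun m φ => by
      obtain ⟨N, x, y, h⟩ := Bal.exists_rep ((H.dual hU).comul (φ p))
      exact ⟨_, cochainEquiv_coface_mid p m φ h⟩

theorem exists_coface_last {hU : H.FinProj} (ρ : RightComodule (H.dual hU) M) (n : ℕ) :
    ∃ δ : Cochain H M n →ₗ[k] Cochain H M (n + 1), ∀ f (u : Fin (n + 1) → U),
      (δ f).1 u = comoduleAct ρ (u 0) (f.1 (Fin.tail u)) :=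
  exists_cochain_operator hU
    { toFun := fun f (u : Fin (n + 1) → U) => comoduleAct ρ (u 0) (f.1 (Fin.tail u))
      map_add' := fun f g => funext fun u => by simp
      map_smul' := fun c f => funext fun u => by simp }
    fun m φ => by
      obtain ⟨N, x, y, h⟩ := Bal.exists_rep (ρ.coact m)
      exact ⟨_, cochainEquiv_coface_last ρ m φ h⟩

/-- The cofaces of `C(U, M)`. -/
theorem exists_cofaces {hU : H.FinProj} (ρ : RightComodule (H.dual hU) M) :
    ∃ δ : ∀ n, Fin (n + 2) → Cochain H M n →ₗ[k] Cochain H M (n + 1),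
      (∀ f (u : Fin 1 → U), (δ 0 0 f).1 u = op (H.counit (u 0)) • f.1 (Fin.tail u)) ∧
      (∀ n f (u : Fin (n + 2) → U), (δ (n + 1) 0 f).1 u =
        f.1 (Function.update (Fin.init u) (Fin.last n)
          (u (Fin.last n).castSucc * H.t (op (H.counit (u (Fin.last (n + 1)))))))) ∧
      (∀ n (i : Fin n) f (u : Fin (n + 1) → U), (δ n i.succ.castSucc f).1 u =
        f.1 (Fin.contractNth i.rev.castSucc (· * ·) u)) ∧
      (∀ n f (u : Fin (n + 1) → U), (δ n (Fin.last (n + 1)) f).1 u =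
        comoduleAct ρ (u 0) (f.1 (Fin.tail u))) := by
  obtain ⟨d0, h0⟩ := exists_coface_zero_zero (M := M) hU
  choose ds hs using exists_coface_zero_succ (M := M) hU
  choose dm hm using exists_coface_mid (M := M) hU
  choose dl hl using exists_coface_last ρ
  -- In degree zero there is no argument on which ε(u) could act, so the zeroth coface is assembled
  -- by cases on the degree.
  obtain ⟨dz, hz0, hzs⟩ : ∃ dz : ∀ n, Cochain H M n →ₗ[k] Cochain H M (n + 1),
      dz 0 = d0 ∧ ∀ n, dz (n + 1) = ds n :=
    ⟨fun n => match n with | 0 => d0 | n + 1 => ds n, rfl, fun _ => rfl⟩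
  obtain ⟨δ, hδ0, hδm, hδl⟩ : ∃ δ : ∀ n, Fin (n + 2) → Cochain H M n →ₗ[k] Cochain H M (n + 1),
      (∀ n, δ n 0 = dz n) ∧ (∀ n (i : Fin n), δ n i.succ.castSucc = dm n i.rev) ∧
        ∀ n, δ n (Fin.last (n + 1)) = dl n :=
    ⟨fun n => Fin.cons (dz n) (Fin.snoc (fun i => dm n i.rev) (dl n) : Fin (n + 1) → _),
      fun n => rfl, fun n i => by
        beta_reduce
        rw [← Fin.succ_castSucc, Fin.cons_succ, Fin.snoc_castSucc],
      fun n => by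
        beta_reduce
        rw [← Fin.succ_last, Fin.cons_succ, Fin.snoc_last]⟩
  refine ⟨δ, fun f u => ?_, fun n f u => ?_, fun n i f u => ?_, fun n f u => ?_⟩
  · rw [hδ0, hz0, h0]
  · rw [hδ0, hzs, hs]
  · rw [hδm, hm]
  · rw [hδl, hl]

/-- The codegeneracies of `C(U, M)`. -/
theorem exists_codegeneracies (hU : H.FinProj) :
    ∃ σ : ∀ n, Fin (n + 1) → Cochain H M (n + 1) →ₗ[k] Cochain H M n,
      ∀ n j f (u : Fin n → U),
        (σ n j f).1 u = f.1 (Fin.insertNth (α := fun _ => U) j.rev 1 u) := by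
  have h : ∀ n (j : Fin (n + 1)), ∃ σ : Cochain H M (n + 1) →ₗ[k] Cochain H M n,
      ∀ f (u : Fin n → U), (σ f).1 u = f.1 (Fin.insertNth (α := fun _ => U) j 1 u) := fun n j =>
    exists_cochain_operator hU
      { toFun := fun f (u : Fin n → U) => f.1 (Fin.insertNth (α := fun _ => U) j 1 u)
        map_add' := fun _ _ => rfl
        map_smul' := fun _ _ => rfl }
      fun m φ => by
        induction j using Fin.cases with
        | zero => exact ⟨_, cochainEquiv_codegeneracy_last m φ⟩
        | succ q => exact ⟨_, cochainEquiv_codegeneracy q m φ⟩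
  choose σ hσ using h
  exact ⟨fun n j => σ n j.rev, fun n j => hσ n j.rev⟩

end LeftBialgebroid

/-! ### Translation elements of several arguments, and iterated coproducts. -/

namespace LeftBialgebroid

variable {k A U : Type*} [CommRing k] [Ring A] [Algebra k A] [Ring U] [Algebra k U]
  (H : LeftBialgebroid k A U)

/-- The map `x ⊗ y ↦ x v ⊗ y w` on `U_◁ ⊗_A ▷U`. -/
def mulRightBoth (v w : U) : H.LeftTensor →ₗ[k] H.LeftTensor :=
  Bal.lift ((Bal.tmul H.ract H.lact).compl₁₂ (LinearMap.mulRight k v) (LinearMap.mulRight k w))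
    (fun b x y => by
      have := Bal.tmul_bal H.ract H.lact b (x * v) (y * w)
      simpa [mul_assoc] using this)

@[simp] theorem mulRightBoth_tmul (v w x y : U) :
    H.mulRightBoth v w (Bal.tmul H.ract H.lact x y) = Bal.tmul H.ract H.lact (x * v) (y * w) := by
  simp [mulRightBoth]

/-- The map `v ⊗ w ↦ x₍₁₎ v ⊗ x₍₂₎ w` on `U_◁ ⊗_A ▷U`. -/
def comulMul (x : U) : H.LeftTensor →ₗ[k] H.LeftTensor :=
  Bal.lift (LinearMap.mk₂ k (fun v w => H.mulRightBoth v w (H.comul x))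
    (fun _ _ _ => by
      obtain ⟨n, p, q, h⟩ := H.exists_rep x
      simp [h, mul_add, Finset.sum_add_distrib])
    (fun _ _ _ => by
      obtain ⟨n, p, q, h⟩ := H.exists_rep x
      simp [h, Finset.smul_sum])
    (fun _ _ _ => by
      obtain ⟨n, p, q, h⟩ := H.exists_rep x
      simp [h, mul_add, Finset.sum_add_distrib])
    (fun _ _ _ => by
      obtain ⟨n, p, q, h⟩ := H.exists_rep x
      simp [h, Finset.smul_sum]))
    (fun a v w => by
      obtain ⟨n, p, q, h⟩ := H.exists_rep x
      have := congrArg (H.mulRightBoth v w) (H.takeuchi a x n p q h)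
      simpa [h, AeRing.ltmul, mul_assoc] using this)

theorem comulMul_tmul (x v w : U) :
    H.comulMul x (Bal.tmul H.ract H.lact v w) = H.mulRightBoth v w (H.comul x) := by
  simp [comulMul]

theorem galois_mul (x y z : U) :
    H.galois (H.otmul (x * y) z) = H.comulMul x (H.galois (H.otmul y z)) := by
  obtain ⟨n, p, q, h⟩ := H.exists_rep x
  obtain ⟨m, p', q', h'⟩ := H.exists_rep y
  rw [galois_tmul, galois_tmul, H.comul_mul _ _ _ _ _ _ _ _ h h', h']
  simp only [map_sum, AeRing.ltmul, mulSnd_tmul, comulMul_tmul, h, mulRightBoth_tmul, mul_assoc]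
  rw [Finset.sum_comm]

/-- Both sides are x₍₁₎d ⊗ x₍₂₎z. Reading this as a Galois image of x ⊗ z is what lets an induction
continue with x. -/
theorem comulMul_tmul_eq (x d z : U) :
    H.comulMul x (H.ltmul d z) = H.mulRightBoth d 1 (H.galois (H.otmul x z)) := by
  obtain ⟨n, p, q, h⟩ := H.exists_rep x
  simp [comulMul_tmul, galois_tmul, h]

/-- By `comul_harp`, `harp φ` affects only the first leg of the coproduct, so it can be applied
after the Galois map. -/
theorem galois_harp (φ : RightDual H) (x y z : U) :
    H.galois (H.otmul (H.harp φ x) (y * z)) =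
      H.harpFst φ (H.mulSnd z (H.galois (H.otmul x y))) := by
  obtain ⟨n, p, q, h⟩ := H.exists_rep x
  simp [galois_tmul, comul_harp, h, mul_assoc]

/-- Applying the translation map `u ↦ u₊ ⊗ u₋` to several elements, with `harp` applied to the
first components:
`∏ (φᵢ · uⁱ₊) ⊗ uⁿ₋ ⋯ u¹₋ w` is mapped to `∏ (φᵢ · uⁱ) ⊗ w` by the Hopf-Galois map. -/
theorem galois_translation : ∀ {n : ℕ} (φ : Fin n → RightDual H) (u : Fin n → U)
    (N : Fin n → ℕ) (p q : ∀ i, Fin (N i) → U)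
    (_ : ∀ i, H.galois (∑ j, H.otmul (p i j) (q i j)) = H.ltmul (u i) 1) (w : U),
    ∑ J : (∀ i, Fin (N i)), H.galois (H.otmul (H.harpProd φ (fun i => p i (J i)))
      ((List.ofFn fun i => q i (J i)).reverse.prod * w)) = H.ltmul (H.harpProd φ u) w
  | 0, φ, u, N, p, q, h, w => by
    simp [galois_tmul, H.comul_one]
  | n + 1, φ, u, N, p, q, h, w => by
    have ih := galois_translation (Fin.init φ) (Fin.init u) (fun i => N i.castSucc)
      (fun i => p i.castSucc) (fun i => q i.castSucc) (fun i => h i.castSucc) w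
    rw [harpProd_succ' _ φ u]
    have h1 : H.ltmul (H.harpProd (Fin.init φ) (Fin.init u) *
        H.harp (φ (Fin.last n)) (u (Fin.last n))) w =
        H.mulRightBoth (H.harp (φ (Fin.last n)) (u (Fin.last n))) 1
          (H.ltmul (H.harpProd (Fin.init φ) (Fin.init u)) w) := by simp
    rw [h1, ← ih, map_sum, ← (Fin.snocEquiv (fun i => Fin (N i))).sum_comp,
      Fintype.sum_prod_type, Finset.sum_comm]
    refine Finset.sum_congr rfl fun J _ => ?_
    obtain ⟨z, hz⟩ : ∃ z, z = (List.ofFn fun i => q i.castSucc (J i)).reverse.prod * w := ⟨_, rfl⟩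
    obtain ⟨P, hP⟩ : ∃ P, P = H.harpProd (Fin.init φ) (fun i => p i.castSucc (J i)) := ⟨_, rfl⟩
    -- The last argument is split off because its translation pair is innermost: its first leg ends
    -- the product and its second leg begins the reversed product. Summing over j replaces the pair
    -- by uⁿ ⊗ 1, and the other arguments are left to the induction hypothesis.
    have h2 : ∀ j, H.galois (H.otmul
        (H.harpProd φ (fun i => p i (Fin.snocEquiv (fun i => Fin (N i)) (j, J) i)))
        ((List.ofFn fun i => q i (Fin.snocEquiv (fun i => Fin (N i)) (j, J) i)).reverse.prod
          * w)) = H.comulMul P (H.harpFst (φ (Fin.last n)) (H.mulSnd z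
            (H.galois (H.otmul (p (Fin.last n) j) (q (Fin.last n) j))))) := by
      intro j
      rw [← galois_harp, ← galois_mul, harpProd_succ', List.ofFn_succ', List.concat_eq_append,
        List.reverse_append, List.reverse_singleton, List.singleton_append, List.prod_cons,
        mul_assoc]
      simp only [Fin.snocEquiv, Equiv.coe_fn_mk, Fin.snoc_last, Fin.snoc_castSucc, hz, hP]
      congr 5
      funext i
      simp [Fin.init]
    simp only [h2, ← map_sum]
    rw [h, ← hz, ← hP, ← comulMul_tmul_eq]
    simp

variable {H}

/-- The pairing of iterated coproducts with tuples. -/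
theorem sum_iterComul {hU : H.FinProj} : ∀ {n : ℕ} {χ : RightDual H}
    {L : List (Fin (n + 1) → RightDual H)} (_ : (H.dual hU).IterComul n χ L)
    (ψ : Fin (n + 1) → RightDual H) (u : Fin (n + 1) → U),
    (L.map fun w => H.counit (H.harpProd (ψ * w) u)).sum = H.pair χ (H.harpProd ψ u) := by
  intro n χ L hL
  induction hL with
  | zero v =>
    intro ψ u
    simp [harpProd_succ, pair_mul_eq_harp]
  | @succ n m v x y L h hL ih =>
    intro ψ u
    have h' : hU.basis.comul v = ∑ i, H.dualAeRing.rtmul (x i) (y i) := h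
    rw [List.map_flatten, List.sum_flatten, List.map_map, List.map_ofFn, List.sum_ofFn,
      harpProd_succ', ← hU.basis.pair_rep h']
    refine Finset.sum_congr rfl fun i _ => ?_
    simp only [Function.comp_apply, List.map_map]
    -- The value of the last leg on the last argument becomes a factor `t(·)` on the preceding
    -- argument, so the induction hypothesis applies with one argument fewer.
    rw [← pair_mul_eq_harp, ← harpProd_update_last, ← ih]
    congr 2
    funext w
    have e : Fin.init (ψ * (Fin.snoc w (y i) : Fin (n + 2) → RightDual H)) = Fin.init ψ * w := by
      funext l
      simp [Fin.init]
    rw [Function.comp_apply, harpProd_succ', counit_mul_t, counit_harp, harpProd_update_last, e]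
    simp

theorem exists_iterComul {B V : Type*} [Ring B] [Algebra k B] [Ring V]
    [Algebra k V] (R : RightBialgebroid k B V) : ∀ (n : ℕ) (v : V), ∃ L, R.IterComul n v L
  | 0, v => ⟨_, .zero v⟩
  | n + 1, v => by
    obtain ⟨m, x, y, h⟩ := Bal.exists_rep (R.comul v)
    choose L hL using fun i => exists_iterComul R n (x i)
    exact ⟨_, .succ v x y L h hL⟩

end LeftBialgebroid

/-! ### The cyclic operator. -/

namespace LeftBialgebroid

variable {k A U : Type*} [CommRing k] [Ring A] [Algebra k A] [Ring U] [Algebra k U]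
  {H : LeftBialgebroid k A U} {M : Type*} [AddCommGroup M] [Module k M] [Module Aᵐᵒᵖ M]
  [IsScalarTower k Aᵐᵒᵖ M]

/-- The translation map of `U^*` in terms of the Hopf-Galois map of `U`. -/
theorem convPairing_galois_of_eq {hU : H.FinProj} {χ : RightDual H} {K : ℕ}
    {p q : Fin K → RightDual H}
    (h : (H.dual hU).galois (∑ j, (H.dual hU).otmul (p j) (q j)) = (H.dual hU).rtmul 1 χ)
    (y z : U) :
    H.convPairing (∑ j, H.dualAeRing.otmul (p j) (q j)) (H.galois (H.otmul y z)) =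
      H.counit (y * H.t (op (H.pair χ z))) := by
  have h' : H.dualGalois hU (∑ j, H.dualAeRing.otmul (p j) (q j)) = H.dualAeRing.rtmul 1 χ := h
  rw [← H.opPair_galois hU, h', opPair_tmul, pair2_tmul, pair_one]

section Cyclic

variable {hU : H.FinProj} (ρ : RightComodule (H.dual hU) M)

/-- The last functional φₙ meets the last argument z = uⁿ₋⋯u¹₋w. The shift by one comes from m⁽¹⁾,
which pairs with u¹₊, so φᵢ pairs with the argument of index i+1. The outcome is a value of 1 ⊗ φₙ,
ready for transposition. -/
theorem cons_snoc_harpProd {n : ℕ} (ψ : RightDual H) (φ : Fin (n + 1) → RightDual H)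
    (p : Fin (n + 1) → U) (z : U) :
    H.counit (H.harpProd (Fin.cons ψ φ : Fin (n + 2) → RightDual H)
      (Fin.cons (p 0) (Fin.snoc (Fin.tail p) z : Fin (n + 1) → U) : Fin (n + 2) → U)) =
        H.counit (H.harpProd (Fin.cons ψ (Fin.init φ) : Fin (n + 1) → RightDual H) p *
          H.t (op (H.pair (φ (Fin.last n)) z))) := by
  have h1 : (Fin.cons (p 0) (Fin.snoc (Fin.tail p) z : Fin (n + 1) → U) : Fin (n + 2) → U) =
      Fin.snoc p z := by
    rw [Fin.cons_snoc_eq_snoc_cons, Fin.cons_self_tail]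
  have h2 : (Fin.cons ψ φ : Fin (n + 2) → RightDual H) =
      Fin.snoc (Fin.cons ψ (Fin.init φ) : Fin (n + 1) → RightDual H) (φ (Fin.last n)) := by
    conv_lhs => rw [← Fin.snoc_init_self φ]
    rw [Fin.cons_snoc_eq_snoc_cons]
  rw [h1, h2, harpProd_succ', counit_mul_t, counit_harp, Fin.init_snoc, Fin.init_snoc,
    Fin.snoc_last, Fin.snoc_last]

variable (H) in
/-- The function `w ↦ u¹₊ f(u²₊, …, uⁿ₊, uⁿ₋ ⋯ u¹₋ w)`, for given representations of the
elements `uⁱ₊ ⊗ uⁱ₋`. -/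
noncomputable def cyclicKernel {n : ℕ} (f : Cochain H M (n + 1)) {N : Fin (n + 1) → ℕ}
    (p q : ∀ i, Fin (N i) → U) (w : U) : M :=
  ∑ J : (∀ i, Fin (N i)), comoduleAct ρ (p 0 (J 0))
    (f.1 (Fin.snoc (fun i : Fin n => p i.succ (J i.succ))
      ((List.ofFn fun i => q i (J i)).reverse.prod * w) : Fin (n + 1) → U))

/-- The cyclic kernel of an elementary cochain, as an element of `Hom_{Aᵒᵖ}(U_◁, M)`. -/
noncomputable def elementaryKernel {n : ℕ} (φ : Fin (n + 1) → RightDual H) {N K : ℕ}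
    (x : Fin N → M) (y : Fin N → RightDual H) (p q : Fin K → RightDual H)
    (u : Fin (n + 1) → U) : RHom H.toAeRing M :=
  ∑ i, ∑ j, dyad H (x i) (H.dualT (H.pair (p j)
    (H.harpProd (Fin.cons (y i) (Fin.init φ) : Fin (n + 1) → RightDual H) u)) * q j)

theorem cyclicKernel_elementary {n : ℕ} (m : M) (φ : Fin (n + 1) → RightDual H) {N K : ℕ}
    {x : Fin N → M} {y : Fin N → RightDual H} {p q : Fin K → RightDual H}
    (hρ : ρ.coact m = ∑ j, Bal.tmul _ _ (x j) (y j))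
    (h : (H.dual hU).galois (∑ j, (H.dual hU).otmul (p j) (q j)) =
      (H.dual hU).rtmul 1 (φ (Fin.last n)))
    (u : Fin (n + 1) → U) {N' : Fin (n + 1) → ℕ} (p' q' : ∀ i, Fin (N' i) → U)
    (hu : ∀ i, H.galois (∑ j, H.otmul (p' i j) (q' i j)) = H.ltmul (u i) 1) (w : U) :
    (elementaryKernel φ x y p q u).1 w =
      cyclicKernel H ρ (cochainEquiv hU M _ (coTmul (H.dual hU) M m φ)) p' q' w := by
  have h1 : ∀ J : (∀ i, Fin (N' i)), comoduleAct ρ (p' 0 (J 0))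
      ((cochainEquiv hU M _ (coTmul (H.dual hU) M m φ)).1
        (Fin.snoc (fun i : Fin n => p' i.succ (J i.succ))
          ((List.ofFn fun i => q' i (J i)).reverse.prod * w) : Fin (n + 1) → U)) =
      ∑ i, op (H.convPairing (∑ j, H.dualAeRing.otmul (p j) (q j)) (H.galois (H.otmul
        (H.harpProd (Fin.cons (y i) (Fin.init φ) : Fin (n + 1) → RightDual H)
          (fun i => p' i (J i))) ((List.ofFn fun i => q' i (J i)).reverse.prod * w)))) • x i := by
    intro J
    have := cochainEquiv_coface_last ρ m φ hρ (Fin.cons (p' 0 (J 0))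
      (Fin.snoc (fun i : Fin n => p' i.succ (J i.succ))
          ((List.ofFn fun i => q' i (J i)).reverse.prod * w) : Fin (n + 1) → U) :
          Fin (n + 2) → U)
    rw [Fin.cons_zero, Fin.tail_cons] at this
    rw [← this, map_sum, AddSubmonoidClass.coe_finsetSum, sum_apply]
    refine Finset.sum_congr rfl fun i _ => ?_
    rw [cochainEquiv_tmul, convPairing_galois_of_eq h]
    -- At this point 1 ⊗ φₙ has been exchanged for φₙ⁻ ⊗ φₙ⁺ paired with a Galois image.
    exact congrArg (fun a => op a • x i)
      (cons_snoc_harpProd (y i) φ (fun i => p' i (J i)) _)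
  rw [cyclicKernel, Finset.sum_congr rfl fun J _ => h1 J, Finset.sum_comm, elementaryKernel,
    AddSubmonoidClass.coe_finsetSum, LinearMap.sum_apply]
  refine Finset.sum_congr rfl fun i _ => ?_
  have hop : ∀ {ι : Type _} [Fintype ι] (c : ι → A), ∑ l, op (c l) = op (∑ l, c l) :=
    fun c => (map_sum opAddEquiv c _).symm
  -- All translation elements cancel here, which also shows independence of their chosen
  -- representatives.
  rw [← Finset.sum_smul, hop, ← map_sum, H.galois_translation _ u N' p' q' hu w,
    AddSubmonoidClass.coe_finsetSum, LinearMap.sum_apply]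
  simp only [dyad_apply]
  rw [← Finset.sum_smul, hop]
  simp only [map_sum, LinearMap.sum_apply, AeRing.otmul, AeRing.ltmul, convPairing_tmul, dualT_mul]

theorem cyclicKernel_add {n : ℕ} (f g : Cochain H M (n + 1)) {N : Fin (n + 1) → ℕ}
    (p q : ∀ i, Fin (N i) → U) (w : U) :
    cyclicKernel H ρ (f + g) p q w = cyclicKernel H ρ f p q w + cyclicKernel H ρ g p q w := by
  simp [cyclicKernel, Finset.sum_add_distrib]

theorem cyclicKernel_smul {n : ℕ} (c : k) (f : Cochain H M (n + 1)) {N : Fin (n + 1) → ℕ}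
    (p q : ∀ i, Fin (N i) → U) (w : U) :
    cyclicKernel H ρ (c • f) p q w = c • cyclicKernel H ρ f p q w := by
  simp [cyclicKernel, Finset.smul_sum]

/-- Right linearity in w and independence of the representatives are read off from the explicit
kernel of an elementary cochain and extended additively. The Hopf property of the dual is needed for
φₙ⁻ ⊗ φₙ⁺ to exist. -/
theorem exists_cyclicKernel (hV : (H.dual hU).IsHopf) {n : ℕ} (f : Cochain H M (n + 1))
    (u : Fin (n + 1) → U) : ∃ g : RHom H.toAeRing M,
      ∀ {N : Fin (n + 1) → ℕ} (p q : ∀ i, Fin (N i) → U),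
        (∀ i, H.galois (∑ j, H.otmul (p i j) (q i j)) = H.ltmul (u i) 1) →
          ∀ w, g.1 w = cyclicKernel H ρ f p q w := by
  induction f using cochain_induction hU with
  | h0 => exact ⟨0, fun p q _ w => by simp [cyclicKernel]⟩
  | hadd f g hf hg =>
    obtain ⟨f', hf⟩ := hf
    obtain ⟨g', hg⟩ := hg
    refine ⟨f' + g', fun p q h w => ?_⟩
    rw [cyclicKernel_add, ← hf p q h, ← hg p q h]
    rfl
  | hP m φ =>
    obtain ⟨N, x, y, hρ⟩ := Bal.exists_rep (ρ.coact m)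
    obtain ⟨z, hz⟩ := hV.2 ((H.dual hU).rtmul 1 (φ (Fin.last n)))
    obtain ⟨K, p, q, rfl⟩ := Bal.exists_rep z
    exact ⟨_, fun p' q' h w => cyclicKernel_elementary ρ m φ hρ hz u p' q' h w⟩

/-- The map `u ↦ u m`. -/
noncomputable def orbit : M →ₗ[k] RHom H.toAeRing M where
  toFun m := ⟨(comoduleAlgHom ρ).toLinearMap.flip m, fun a u => by
    change comoduleAct ρ (H.t (op a) * u) m = op a • comoduleAct ρ u m
    rw [comoduleAct_mul, comoduleAct_t]⟩
  map_add' _ _ := Subtype.ext (LinearMap.ext fun _ => by simp)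
  map_smul' _ _ := Subtype.ext (LinearMap.ext fun _ => by simp)

theorem orbit_apply (m : M) (u : U) : (orbit ρ m).1 u = comoduleAct ρ u m := rfl

variable [Module (RightDual H) M] [IsScalarTower k (RightDual H) M]

/-- On each summand γ gives t^r(a)φₙ⁺m⁽⁰⁾ with a = ⟨φₙ⁻, P⟩, P being the product of `harp` factors;
`sum_iterComul` expands a over the iterated coproduct of φₙ⁻. -/
theorem contraaction_elementaryKernel (b : DualBasis H)
    (hM : ∀ (a : A) (m : M), H.dualT a • m = op a • m) {n : ℕ} (φ : Fin (n + 1) → RightDual H)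
    {N K : ℕ} (x : Fin N → M) (y : Fin N → RightDual H) (p q : Fin K → RightDual H)
    (L : Fin K → List (Fin (n + 1) → RightDual H)) (hL : ∀ j, (H.dual hU).IterComul n (p j) (L j))
    (u : Fin (n + 1) → U) :
    (cochainEquiv hU M _ (∑ i, ∑ j, ((L j).map fun w => coTmul (H.dual hU) M (q j • x i)
      ((Fin.cons (y i) (Fin.init φ) : Fin (n + 1) → RightDual H) * w)).sum)).1 u =
        b.contraaction (elementaryKernel φ x y p q u) := by
  let ev : CoCochain (H.dual hU) M (n + 1) →ₗ[k] M :=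
    { toFun := fun z => (cochainEquiv hU M (n + 1) z).1 u
      map_add' := fun _ _ => by simp
      map_smul' := fun _ _ => by simp }
  change ev _ = _
  rw [elementaryKernel]
  simp only [map_sum, b.contraaction_dyad hM, mul_smul, hM]
  refine Finset.sum_congr rfl fun i _ => Finset.sum_congr rfl fun j _ => ?_
  rw [← sum_iterComul (hL j), map_list_sum, List.map_map]
  have h1 : (ev ∘ fun w => coTmul (H.dual hU) M (q j • x i)
      ((Fin.cons (y i) (Fin.init φ) : Fin (n + 1) → RightDual H) * w)) =
      fun w => op (H.counit (H.harpProd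
        ((Fin.cons (y i) (Fin.init φ) : Fin (n + 1) → RightDual H) * w) u)) • q j • x i :=
    funext fun w => cochainEquiv_tmul hU _ _ u
  rw [h1]
  have h2 : ∀ l : List (Fin (n + 1) → RightDual H), (l.map fun w => op (H.counit (H.harpProd
        ((Fin.cons (y i) (Fin.init φ) : Fin (n + 1) → RightDual H) * w) u)) • q j • x i).sum =
      op (l.map fun w => H.counit (H.harpProd
        ((Fin.cons (y i) (Fin.init φ) : Fin (n + 1) → RightDual H) * w) u)).sum • q j • x i := by
    intro l
    induction l with
    | nil => simp
    | cons a l ih => simp [ih, add_smul]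
  exact h2 _

/-- The cyclic operator of `C(U, M)` in positive degrees. -/
theorem exists_cyclic_succ (hH : H.IsHopf) (b : DualBasis H)
    (hM : ∀ (a : A) (m : M), H.dualT a • m = op a • m) (n : ℕ) :
    ∃ τ : Cochain H M (n + 1) →ₗ[k] Cochain H M (n + 1), ∀ f (u : Fin (n + 1) → U),
      ∃ g : RHom H.toAeRing M, (∀ {N : Fin (n + 1) → ℕ} (p q : ∀ i, Fin (N i) → U),
        (∀ i, H.galois (∑ j, H.otmul (p i j) (q i j)) = H.ltmul (u i) 1) →
          ∀ w, g.1 w = cyclicKernel H ρ f p q w) ∧ (τ f).1 u = b.contraaction g := by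
  have hV := hH.dual hU
  have htr : ∀ v : U, ∃ (N : ℕ) (p q : Fin N → U),
      H.galois (∑ j, H.otmul (p j) (q j)) = H.ltmul v 1 := fun v => by
    obtain ⟨z, hz⟩ := hH.2 (H.ltmul v 1)
    obtain ⟨N, p, q, rfl⟩ := Bal.exists_rep z
    exact ⟨N, p, q, hz⟩
  choose N p q hpq using htr
  choose g hg using fun (f : Cochain H M (n + 1)) u => exists_cyclicKernel ρ hV f u
  -- With the representatives fixed by u alone, the chosen kernel is determined by its values, and
  -- these are linear in f.
  have hg' : ∀ f u w, (g f u).1 w =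
      cyclicKernel H ρ f (fun i => p (u i)) (fun i => q (u i)) w :=
    fun f u w => hg f u _ _ (fun i => hpq (u i)) w
  obtain ⟨τ, hτ⟩ := exists_cochain_operator hU
    ({ toFun := fun f (u : Fin (n + 1) → U) => b.contraaction (g f u)
       map_add' := fun f f' => funext fun u => by
        rw [Pi.add_apply, ← map_add]
        congr 1
        refine Subtype.ext (LinearMap.ext fun w => ?_)
        rw [hg', cyclicKernel_add, ← hg', ← hg']
        rfl
       map_smul' := fun c f => funext fun u => by
        rw [Pi.smul_apply, RingHom.id_apply, ← map_smul]
        congr 1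
        refine Subtype.ext (LinearMap.ext fun w => ?_)
        rw [hg', cyclicKernel_smul, ← hg']
        rfl } : Cochain H M (n + 1) →ₗ[k] (Fin (n + 1) → U) → M)
    (fun m φ => by
      obtain ⟨N', x, y, hρ⟩ := Bal.exists_rep (ρ.coact m)
      obtain ⟨z, hz⟩ := hV.2 ((H.dual hU).rtmul 1 (φ (Fin.last n)))
      obtain ⟨K, p', q', rfl⟩ := Bal.exists_rep z
      choose L hL using fun j => exists_iterComul (H.dual hU) n (p' j)
      refine ⟨_, fun u => (contraaction_elementaryKernel b hM φ x y p' q' L hL u).trans ?_⟩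
      refine congrArg b.contraaction (Subtype.ext (LinearMap.ext fun w => ?_))
      rw [hg']
      exact cyclicKernel_elementary ρ m φ hρ hz u _ _ (fun i => hpq (u i)) w)
  exact ⟨τ, fun f u => ⟨g f u, hg f u, hτ f u⟩⟩

theorem contraaction_orbit (b : DualBasis H) (hM : ∀ (a : A) (m : M), H.dualT a • m = op a • m)
    {m : M} {N : ℕ} {x : Fin N → M} {y : Fin N → RightDual H}
    (h : ρ.coact m = ∑ j, Bal.tmul _ _ (x j) (y j)) :
    b.contraaction (orbit ρ m) = ∑ j, y j • x j := by
  have : orbit ρ m = ∑ j, dyad H (x j) (y j) := by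
    refine Subtype.ext (LinearMap.ext fun u => ?_)
    rw [orbit_apply, comoduleAct_rep ρ h]
    simp [AddSubmonoidClass.coe_finsetSum]
  rw [this, map_sum]
  simp only [b.contraaction_dyad hM]

theorem cochainEquiv_cyclic_zero (b : DualBasis H)
    (hM : ∀ (a : A) (m : M), H.dualT a • m = op a • m) {m : M} (φ : Fin 0 → RightDual H)
    {N : ℕ} {x : Fin N → M} {y : Fin N → RightDual H}
    (h : ρ.coact m = ∑ j, Bal.tmul _ _ (x j) (y j)) (u : Fin 0 → U) :
    (cochainEquiv hU M 0 (coTmul (H.dual hU) M (∑ j, y j • x j) φ)).1 u =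
      b.contraaction (orbit ρ ((cochainEquiv hU M 0 (coTmul (H.dual hU) M m φ)).1 u)) := by
  rw [cochainEquiv_tmul, cochainEquiv_tmul, harpProd_zero, H.counit_one, op_one, one_smul,
    one_smul, contraaction_orbit ρ b hM h]

/-- The cyclic operator of `C(U, M)` in degree zero. -/
theorem exists_cyclic_zero (b : DualBasis H)
    (hM : ∀ (a : A) (m : M), H.dualT a • m = op a • m) :
    ∃ τ : Cochain H M 0 →ₗ[k] Cochain H M 0, ∀ f (u : Fin 0 → U),
      (τ f).1 u = b.contraaction (orbit ρ (f.1 u)) :=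
  exists_cochain_operator hU
    { toFun := fun f (u : Fin 0 → U) => b.contraaction (orbit ρ (f.1 u))
      map_add' := fun f g => funext fun u => by simp
      map_smul' := fun c f => funext fun u => by simp }
    fun m φ => by
      obtain ⟨N, x, y, h⟩ := Bal.exists_rep (ρ.coact m)
      exact ⟨_, cochainEquiv_cyclic_zero ρ b hM φ h⟩

end Cyclic

end LeftBialgebroid

/-! ### Transport of the operators to `C_co(U^*, M)`, and the theorem. -/

namespace LeftBialgebroid

variable {k A U : Type*} [CommRing k] [Ring A] [Algebra k A] [Ring U] [Algebra k U]
  {H : LeftBialgebroid k A U} {M : Type*} [AddCommGroup M] [Module k M] [Module Aᵐᵒᵖ M]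
  [IsScalarTower k Aᵐᵒᵖ M]

/-- The operator on `C_co(U^*, M)` that corresponds to an operator on `C(U, M)`. -/
noncomputable def conjOperator (hU : H.FinProj) {n N : ℕ}
    (δ : Cochain H M n →ₗ[k] Cochain H M N) :
    CoCochain (H.dual hU) M n →ₗ[k] CoCochain (H.dual hU) M N :=
  (cochainEquiv hU M N).symm.toLinearMap ∘ₗ δ ∘ₗ (cochainEquiv hU M n).toLinearMap

theorem eq_conj_conjOperator (hU : H.FinProj) {n N : ℕ}
    (δ : Cochain H M n →ₗ[k] Cochain H M N) :
    δ = (cochainEquiv hU M N).toLinearMap ∘ₗ conjOperator hU δ ∘ₗ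
      (cochainEquiv hU M n).symm.toLinearMap :=
  LinearMap.ext fun f => by simp [conjOperator]

/-- A formula for a conjugated operator, with any choice of Sweedler representatives, reduces to an
identity of values after applying ξ. -/
theorem conjOperator_eq {hU : H.FinProj} {n N : ℕ} {δ : Cochain H M n →ₗ[k] Cochain H M N}
    {x : CoCochain (H.dual hU) M n} {z : CoCochain (H.dual hU) M N}
    (h : ∀ u, (cochainEquiv hU M N z).1 u = (δ (cochainEquiv hU M n x)).1 u) :
    conjOperator hU δ x = z := by
  rw [conjOperator, LinearMap.comp_apply, LinearMap.comp_apply, LinearEquiv.coe_coe,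
    LinearEquiv.coe_coe, LinearEquiv.symm_apply_eq]
  exact Subtype.ext (MultilinearMap.ext fun u => (h u).symm)

variable [Module (RightDual H) M] [IsScalarTower k (RightDual H) M]

/-- The cofaces, codegeneracies and cyclic operators of `C(U, M)`, which correspond to those of
`C_co(U^*, M)`. -/
theorem exists_operators (hH : H.IsHopf) {hU : H.FinProj} (ρ : RightComodule (H.dual hU) M)
    (b : DualBasis H) (hM : ∀ (a : A) (m : M), H.dualT a • m = op a • m) :
    ∃ (δ : ∀ n, Fin (n + 2) → Cochain H M n →ₗ[k] Cochain H M (n + 1))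
      (σ : ∀ n, Fin (n + 1) → Cochain H M (n + 1) →ₗ[k] Cochain H M n)
      (τ : ∀ n, Cochain H M n →ₗ[k] Cochain H M n),
      IsCoOperators ρ (fun n i => conjOperator hU (δ n i)) (fun n j => conjOperator hU (σ n j))
        (fun n => conjOperator hU (τ n)) ∧
      IsOperators H (comoduleAlgHom ρ) b.contraaction δ σ τ := by
  obtain ⟨δ, hδ0, hδs, hδm, hδl⟩ := exists_cofaces ρ
  obtain ⟨σ, hσ⟩ := exists_codegeneracies (M := M) hU
  obtain ⟨τ0, hτ0⟩ := exists_cyclic_zero ρ b hM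
  choose τs hτs using exists_cyclic_succ ρ hH b hM
  obtain ⟨τ, rfl, hτ⟩ : ∃ τ : ∀ n, Cochain H M n →ₗ[k] Cochain H M n,
      τ 0 = τ0 ∧ ∀ n, τ (n + 1) = τs n :=
    ⟨fun n => match n with | 0 => τ0 | n + 1 => τs n, rfl, fun _ => rfl⟩
  refine ⟨δ, σ, τ, ?_, ?_⟩
  · constructor
    case coface_zero =>
      intro n m v
      refine conjOperator_eq fun u => ?_
      cases n with
      | zero => rw [hδ0]; exact cochainEquiv_coface_zero_zero m v u
      | succ n => rw [hδs]; exact cochainEquiv_coface_zero_succ m v u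
    case coface_mid =>
      intro n i m v N x y h
      refine conjOperator_eq fun u => ?_
      rw [hδm]
      exact cochainEquiv_coface_mid i.rev m v h u
    case coface_last =>
      intro n m v N x y h
      refine conjOperator_eq fun u => ?_
      rw [hδl]
      exact cochainEquiv_coface_last ρ m v h u
    case codegeneracy_last =>
      intro n m v
      refine conjOperator_eq fun u => ?_
      rw [hσ, Fin.rev_last]
      exact cochainEquiv_codegeneracy_last m v u
    case codegeneracy =>
      intro n q m v
      refine conjOperator_eq fun u => ?_
      rw [hσ, Fin.rev_rev]
      exact cochainEquiv_codegeneracy q m v u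
    case cyclic_zero =>
      intro m v N x y h
      refine conjOperator_eq fun u => ?_
      rw [hτ0]
      exact cochainEquiv_cyclic_zero ρ b hM v h u
    case cyclic_succ =>
      intro n m v N x y K p q L hρ hpq hL
      refine conjOperator_eq fun u => ?_
      obtain ⟨g, hg, hgτ⟩ := hτs n (cochainEquiv hU M _ (coTmul (H.dual hU) M m v)) u
      rw [hτ, hgτ, contraaction_elementaryKernel b hM v x y p q L hL u]
      refine congrArg b.contraaction (Subtype.ext (LinearMap.ext fun w => ?_))
      -- Any one choice of the uⁱ₊ ⊗ uⁱ₋ suffices to compare the two kernels, because g is valid for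
      -- all of them.
      choose z hz using fun i => hH.2 (H.ltmul (u i) 1)
      choose N' p' q' h' using fun i => Bal.exists_rep (z i)
      have hu : ∀ i, H.galois (∑ j, H.otmul (p' i j) (q' i j)) = H.ltmul (u i) 1 := fun i => by
        rw [← hz, h']
      rw [hg p' q' hu, cyclicKernel_elementary ρ m v hρ hpq u p' q' hu]
  · constructor
    case coface_zero_zero => exact hδ0
    case coface_zero_succ => exact hδs
    case coface_mid => exact hδm
    case coface_last => exact hδl
    case codegeneracy => exact hσ
    case cyclic_zero => exact fun f u => ⟨orbit ρ (f.1 u), fun _ => rfl, hτ0 f u⟩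
    case cyclic_succ =>
      intro n f u N p q h
      obtain ⟨g, hg, hgτ⟩ := hτs n f u
      exact ⟨g, hg p q h, by rw [hτ, hgτ]⟩

end LeftBialgebroid

end HopfAlgd

theorem proposition4p6 {k A U M : Type*} [CommRing k] [Ring A] [Algebra k A] [Ring U] [Algebra k U]
    (H : HopfAlgd.LeftBialgebroid k A U) (hHopf : H.IsHopf) (hU : H.FinProj)
    [AddCommGroup M] [Module k M] [Module Aᵐᵒᵖ M] [IsScalarTower k Aᵐᵒᵖ M]
    [Module (HopfAlgd.RightDual H) M] [IsScalarTower k (HopfAlgd.RightDual H) M]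
    (ρ : HopfAlgd.RightComodule (H.dual hU) M)
    (hcompat : ∀ (a : A) (m : M), (H.dual hU).t (op a) • m = op a • m) :
    (H.dual hU).IsHopf ∧
    ∃ (act : U →ₐ[k] Module.End k M) (γ : HopfAlgd.RHom H.toAeRing M →ₗ[k] M),
      HopfAlgd.IsContraaction H γ ∧
      (∀ u m, act u m = HopfAlgd.comoduleAct ρ u m) ∧
      (∀ φ m, γ (HopfAlgd.dyad H m φ) = φ • m) ∧
      (∀ a m, act (H.t (op a)) m = op a • m) ∧
      ((∀ a m, (H.dual hU).s a • m = ρ.lsmul a m) ↔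
        ∀ a m, act (H.s a) m = γ (HopfAlgd.dyad H m ((H.dual hU).s a))) ∧
      ∃ ξ : ∀ n, HopfAlgd.CoCochain (H.dual hU) M n ≃ₗ[k] HopfAlgd.Cochain H M n,
        (∀ n m (φ : Fin n → HopfAlgd.RightDual H) (u : Fin n → U),
          (ξ n (HopfAlgd.coTmul (H.dual hU) M m φ)).1 u =
            op (HopfAlgd.nestedPair H φ u) • m) ∧
        ∃ δ' σ' τ' δ σ τ,
          HopfAlgd.IsCoOperators ρ δ' σ' τ' ∧ HopfAlgd.IsOperators H act γ δ σ τ ∧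
          (∀ n i, δ n i = (ξ (n + 1)).toLinearMap ∘ₗ δ' n i ∘ₗ (ξ n).symm.toLinearMap) ∧
          (∀ n j, σ n j = (ξ n).toLinearMap ∘ₗ σ' n j ∘ₗ (ξ (n + 1)).symm.toLinearMap) ∧
          (∀ n, τ n = (ξ n).toLinearMap ∘ₗ τ' n ∘ₗ (ξ n).symm.toLinearMap) := by
  have hM : ∀ (a : A) (m : M), H.dualT a • m = op a • m := hcompat
  obtain ⟨δ, σ, τ, hco, hop⟩ :=
    HopfAlgd.LeftBialgebroid.exists_operators hHopf ρ hU.basis hM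
  refine ⟨hHopf.dual hU, HopfAlgd.LeftBialgebroid.comoduleAlgHom ρ, hU.basis.contraaction,
    hU.basis.isContraaction hM, fun _ _ => rfl, fun φ m => hU.basis.contraaction_dyad hM m φ,
    fun a m => HopfAlgd.LeftBialgebroid.comoduleAct_t ρ a m, ?_,
    HopfAlgd.LeftBialgebroid.cochainEquiv hU M, fun n m φ u => ?_, _, _, _, δ, σ, τ, hco, hop,
    fun n i => HopfAlgd.LeftBialgebroid.eq_conj_conjOperator hU _,
    fun n j => HopfAlgd.LeftBialgebroid.eq_conj_conjOperator hU _,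
    fun n => HopfAlgd.LeftBialgebroid.eq_conj_conjOperator hU _⟩
  -- For each a and m the two conditions are one equation with its sides exchanged: γ(m ε(- ◂ a)) =
  -- s^r(a)m, and the comodule's left action is the action of `s(a)`.
  · refine forall₂_congr fun a m => ?_
    rw [hU.basis.contraaction_dyad hM, HopfAlgd.LeftBialgebroid.lsmul_eq_comoduleAct]
    exact eq_comm
  · rw [HopfAlgd.LeftBialgebroid.nestedPair_eq]
    exact HopfAlgd.LeftBialgebroid.cochainEquiv_tmul hU m φ u
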